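/- Let $P$ be a convex polytope. A linear functional $f$ is called admissible for $P$ if it is not constant on any edge of $P$; such an $f$ orients every edge of $P$ in the direction in which $f$ increases, and the resulting directed graph has a unique source and a unique sink. For integers $0<d<n$ let $\Delta_{sm}(d,n)$ denote the maximum, over all $d$-dimensional convex polytopes $P$ with exactly $n$ facets and all linear functionals $f$ admissible for $P$, of the length (number of edges) of a shortest directed path from the source to the sink. Then $$\Delta_{sm}(4,8)=4 .$$ That is, in every such orientation of a $4$-dimensional polytope with $8$ facets there is a directed path of length at most $4$ from the source to the sink, and for some such polytope and admissible functional the shortest directed path from source to sink has length exactly $4$. -/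

import Mathlib

namespace PolytopePaths

section General

variable {E : Type*} [AddCommGroup E] [Module ℝ E] [TopologicalSpace E]

/-- A convex polytope: the convex hull of a finite nonempty set of points. -/
def IsPolytope (P : Set E) : Prop :=
  ∃ S : Finset E, S.Nonempty ∧ P = convexHull ℝ (S : Set E)

/-- The set `P` is nonempty and its affine span has dimension `d`. -/
def HasDim (P : Set E) (d : ℕ) : Prop :=
  P.Nonempty ∧ Module.finrank ℝ (vectorSpan ℝ P) = d

/-- The facets of `P`: its nonempty faces (intersections with a supporting hyperplane) of
dimension one less than that of `P`. -/
def facets (P : Set E) : Set (Set E) :=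
  {F | IsExposed ℝ P F ∧ ∃ k : ℕ, HasDim F k ∧ HasDim P (k + 1)}

/-- The vertices of `P`: the points `x` such that `{x}` is a face. -/
def vertices (P : Set E) : Set E := P.exposedPoints ℝ

/-- `x` and `y` are the two endpoints of an edge (a one-dimensional face) of `P`. -/
def IsEdge (P : Set E) (x y : E) : Prop :=
  x ≠ y ∧ x ∈ vertices P ∧ y ∈ vertices P ∧ IsExposed ℝ P (segment ℝ x y)

/-- The linear functional `f` is not constant on any edge of `P`. -/
def IsAdmissible (P : Set E) (f : E →ₗ[ℝ] ℝ) : Prop :=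
  ∀ x y : E, IsEdge P x y → ¬ ∃ c : ℝ, ∀ z ∈ segment ℝ x y, f z = c

/-- The graph of `P` has an edge between `x` and `y`, directed from `x` to `y` in the direction of
increase of `f`. -/
def IsArc (P : Set E) (f : E →ₗ[ℝ] ℝ) (x y : E) : Prop :=
  IsEdge P x y ∧ f x < f y

/-- A source: a vertex that no arc enters. -/
def IsSource (P : Set E) (f : E →ₗ[ℝ] ℝ) (s : E) : Prop :=
  s ∈ vertices P ∧ ∀ x : E, ¬ IsArc P f x s

/-- A sink: a vertex that no arc leaves. -/
def IsSink (P : Set E) (f : E →ₗ[ℝ] ℝ) (t : E) : Prop :=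
  t ∈ vertices P ∧ ∀ x : E, ¬ IsArc P f t x

/-- There is a directed path with exactly `k` arcs from `s` to `t`. -/
def HasDirectedPath (P : Set E) (f : E →ₗ[ℝ] ℝ) (s t : E) (k : ℕ) : Prop :=
  ∃ v : Fin (k + 1) → E, v 0 = s ∧ v (Fin.last k) = t ∧
    ∀ i : Fin k, IsArc P f (v i.castSucc) (v i.succ)

/-- The length of a shortest directed path from `s` to `t` (`⊤` if there is no such path). -/
noncomputable def directedDist (P : Set E) (f : E →ₗ[ℝ] ℝ) (s t : E) : ℕ∞ :=
  sInf {l : ℕ∞ | ∃ k : ℕ, l = (k : ℕ∞) ∧ HasDirectedPath P f s t k}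

end General

/-- All the values taken by the length of a shortest directed path from the source to the sink,
over all `d`-dimensional polytopes with exactly `n` facets (in a space `ℝ^N`) and all
admissible linear functionals. -/
def sourceSinkDistances (d n : ℕ) : Set ℕ∞ :=
  {l | ∃ (N : ℕ) (P : Set (Fin N → ℝ)) (f : (Fin N → ℝ) →ₗ[ℝ] ℝ) (s t : Fin N → ℝ),
    IsPolytope P ∧ HasDim P d ∧ (facets P).encard = (n : ℕ∞) ∧ IsAdmissible P f ∧
    IsSource P f s ∧ IsSink P f t ∧ l = directedDist P f s t}

/-- The strict monotone diameter function: the supremum of the source-to-sink distances. -/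
noncomputable def deltaSM (d n : ℕ) : ℕ∞ := sSup (sourceSinkDistances d n)

end PolytopePaths

/-!
The strict monotone diameter of four-dimensional polytopes with eight facets is four.

*Upper bound.* By polarity, a polytope with eight facets is cut out by eight linear inequalities
inside its affine span (`exists_polyhedron_of_facets`), and the source and the sink of an admissible
functional are its unique minimum and its unique maximum (`IsSource.exists_isMin`). A small
perturbation of the constants and of the functional gives a nondegenerate linear program, and a
directed path of the perturbed program becomes, in the limit, a directed path of the polytope that
is not longer (`exists_short_walk`). It remains to consider the combinatorics of nondegenerate
programs, `AbstractObjective`: the vertices are recorded by the sets of their active constraints,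
and only three properties are used, namely that edges have two ends, that the objective is not
constant on an edge, and that a local maximum or minimum of a face is the strict global one.

If the minimum `s` and the maximum `t` have a constraint in common, one can pass to its facet, which
has one dimension and one constraint less. So the essential claim is that, in dimension `d ≤ 4` with
at most `d + 4` constraints, `s` and `t` are joined by a directed path of at most four edges when
they have no constraint in common. In dimension two one goes around a polygon with at most six
sides. In dimension three the program has at most ten vertices (`card_feas_le_ten`), which leaves no
room for `s`, `t`, their neighbours and the vertices that a longer path would need
(`exists_reach_of_rank_three`).

In dimension four, let the constraints of `s` and of `t` be indexed by `Fin 4` each. The vertices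
that share two constraints with `s` and two with `t` form a `6 × 6` grid, whose rows and columns are
indexed by pairs of constraints. A row together with `s` and two neighbours of `s` is a polygon,
which makes it a path in the complete graph on the constraints of `t`; likewise for the columns. The
direction of the edges in these polygons forces upward edges from neighbours of `s` to entries of
the grid, and from entries of the grid to neighbours of `t`, and a path of four edges exists as soon
as such edges meet in an entry. Since every facet of `s` has at most ten vertices, the grids are so
restricted that an exhaustive search, carried out by the kernel (`check`), finds none in which the
edges could avoid each other (`not_opposite`).

*Lower bound.* On the cube `[0, 1]⁴` with the sum of the coordinates, every edge changes one
coordinate, so that four edges are needed from `0` to `1`.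
-/

/-! ### Abstract objective functions -/

namespace PolytopePaths

/-- The combinatorics of a simple bounded linear program of dimension `d` whose constraints are
labelled by `ι`: the bases of its vertices and the values of the objective at them. A vertex is
recorded by its basis, the set of the `d` labels of the constraints that are active there; a face
is recorded by a set `A` of labels, and its vertices are the feasible bases that contain `A`. -/
structure AbstractObjective (ι : Type*) [DecidableEq ι] (d : ℕ) where
  /-- The bases of the vertices. -/
  feas : Finset ι → Prop
  /-- The objective at a vertex; the value at a set that is not feasible is irrelevant. -/
  val : Finset ι → ℝ
  card_eq : ∀ {B : Finset ι}, feas B → B.card = d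
  /-- The edge along which the constraint `i` is released has a second end. -/
  exists_pivot : ∀ {C : Finset ι} {i : ι}, i ∉ C → feas (insert i C) →
    ∃ k, k ∉ C ∧ k ≠ i ∧ feas (insert k C)
  /-- An edge has at most two ends. -/
  pivot_unique : ∀ {C : Finset ι} {i k l : ι}, i ∉ C → k ∉ C → l ∉ C → k ≠ i → l ≠ i →
    feas (insert i C) → feas (insert k C) → feas (insert l C) → k = l
  /-- The objective is not constant on an edge. -/
  val_ne : ∀ {C : Finset ι} {i k : ι}, i ∉ C → k ∉ C → k ≠ i → feas (insert i C) →
    feas (insert k C) → val (insert k C) ≠ val (insert i C)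
  /-- A vertex of a face that is larger than its neighbours in the face is the strict maximum of
  the face. -/
  lt_of_localMax : ∀ {A B B' : Finset ι}, A ⊆ B → A ⊆ B' → feas B → feas B' → B' ≠ B →
    (∀ C i k, A ⊆ C → i ∉ C → k ∉ C → k ≠ i → B = insert i C → feas (insert k C) →
      val (insert k C) < val B) → val B' < val B
  /-- A vertex of a face that is smaller than its neighbours in the face is the strict minimum of
  the face. -/
  lt_of_localMin : ∀ {A B B' : Finset ι}, A ⊆ B → A ⊆ B' → feas B → feas B' → B' ≠ B →
    (∀ C i k, A ⊆ C → i ∉ C → k ∉ C → k ≠ i → B = insert i C → feas (insert k C) →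
      val B < val (insert k C)) → val B < val B'

namespace AbstractObjective

variable {ι κ : Type*} [DecidableEq ι] [DecidableEq κ] {d : ℕ}

/-- The objective with its sign changed. -/
def neg (S : AbstractObjective ι d) : AbstractObjective ι d where
  feas := S.feas
  val B := -S.val B
  card_eq := S.card_eq
  exists_pivot := S.exists_pivot
  pivot_unique := S.pivot_unique
  val_ne hi hk hki h1 h2 h := S.val_ne hi hk hki h1 h2 (neg_injective h)
  lt_of_localMax h1 h2 h3 h4 h5 h6 := neg_lt_neg (S.lt_of_localMin h1 h2 h3 h4 h5
    fun C i k a b c e g h => neg_lt_neg_iff.1 (h6 C i k a b c e g h))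
  lt_of_localMin h1 h2 h3 h4 h5 h6 := neg_lt_neg (S.lt_of_localMax h1 h2 h3 h4 h5
    fun C i k a b c e g h => neg_lt_neg_iff.1 (h6 C i k a b c e g h))

/-- The same program with its constraints relabelled along an equivalence. -/
def comap (S : AbstractObjective ι d) (e : κ ≃ ι) : AbstractObjective κ d where
  feas B := S.feas (B.map e.toEmbedding)
  val B := S.val (B.map e.toEmbedding)
  card_eq h := by simpa using S.card_eq h
  exists_pivot {C i} hi h := by
    rw [Finset.map_insert] at h
    obtain ⟨k, h1, h2, h3⟩ := S.exists_pivot (by simpa using hi) h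
    refine ⟨e.symm k, ?_, ?_, ?_⟩
    · intro hk; exact h1 (Finset.mem_map.2 ⟨_, hk, by simp⟩)
    · rintro rfl; exact h2 (by simp)
    · simpa [Finset.map_insert] using h3
  pivot_unique {C i k l} hi hk hl hki hli h1 h2 h3 := by
    rw [Finset.map_insert] at h1 h2 h3
    exact e.injective (S.pivot_unique (by simpa using hi) (by simpa using hk) (by simpa using hl)
      (by simpa using hki) (by simpa using hli) h1 h2 h3)
  val_ne {C i k} hi hk hki h1 h2 := by
    rw [Finset.map_insert] at h1 h2 ⊢
    rw [Finset.map_insert]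
    exact S.val_ne (by simpa using hi) (by simpa using hk) (by simpa using hki) h1 h2
  lt_of_localMax {A B B'} h1 h2 h3 h4 h5 h6 := by
    refine S.lt_of_localMax (Finset.map_subset_map.2 h1) (Finset.map_subset_map.2 h2) h3 h4
      (by simpa using h5) fun C i k a b c e' g h => ?_
    have hC : C = (C.map e.symm.toEmbedding).map e.toEmbedding := by
      simp [Finset.map_map]
    have := h6 (C.map e.symm.toEmbedding) (e.symm i) (e.symm k) ?_ (by simpa using b)
      (by simpa using c) (by simpa using e') ?_ ?_
    · rw [Finset.map_insert, ← hC] at this; simpa using this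
    · rw [hC] at a; exact Finset.map_subset_map.1 a
    · apply Finset.map_injective e.toEmbedding
      rw [g, Finset.map_insert, ← hC]; simp
    · rw [Finset.map_insert, ← hC]; simpa using h
  lt_of_localMin {A B B'} h1 h2 h3 h4 h5 h6 := by
    refine S.lt_of_localMin (Finset.map_subset_map.2 h1) (Finset.map_subset_map.2 h2) h3 h4
      (by simpa using h5) fun C i k a b c e' g h => ?_
    have hC : C = (C.map e.symm.toEmbedding).map e.toEmbedding := by
      simp [Finset.map_map]
    have := h6 (C.map e.symm.toEmbedding) (e.symm i) (e.symm k) ?_ (by simpa using b)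
      (by simpa using c) (by simpa using e') ?_ ?_
    · rw [Finset.map_insert, ← hC] at this; simpa using this
    · rw [hC] at a; exact Finset.map_subset_map.1 a
    · apply Finset.map_injective e.toEmbedding
      rw [g, Finset.map_insert, ← hC]; simp
    · rw [Finset.map_insert, ← hC]; simpa using h

/-- The program on the facet of `c`: its bases are the feasible bases that contain `c`, with `c`
removed. -/
def link (S : AbstractObjective ι (d + 1)) (c : ι) : AbstractObjective ι d where
  feas B := c ∉ B ∧ S.feas (insert c B)
  val B := S.val (insert c B)
  card_eq {B} h := by
    have := S.card_eq h.2
    rw [Finset.card_insert_of_notMem h.1] at this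
    omega
  exists_pivot {C i} hi h := by
    have h1 := h.1
    simp only [Finset.mem_insert, not_or] at h1
    have h2 := h.2
    rw [Finset.insert_comm] at h2
    obtain ⟨k, hk, hki, hf⟩ := S.exists_pivot (by simp [hi, Ne.symm h1.1]) h2
    simp only [Finset.mem_insert, not_or] at hk
    exact ⟨k, hk.2, hki, by simp [h1.2, Ne.symm hk.1], by rwa [Finset.insert_comm]⟩
  pivot_unique {C i k l} hi hk hl hki hli h1 h2 h3 := by
    obtain ⟨a1, b1⟩ := h1
    obtain ⟨a2, b2⟩ := h2
    obtain ⟨a3, b3⟩ := h3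
    simp only [Finset.mem_insert, not_or] at a1 a2 a3
    rw [Finset.insert_comm] at b1 b2 b3
    exact S.pivot_unique (by simp [hi, Ne.symm a1.1]) (by simp [hk, Ne.symm a2.1])
      (by simp [hl, Ne.symm a3.1]) hki hli b1 b2 b3
  val_ne {C i k} hi hk hki h1 h2 := by
    obtain ⟨a1, b1⟩ := h1
    obtain ⟨a2, b2⟩ := h2
    simp only [Finset.mem_insert, not_or] at a1 a2
    rw [Finset.insert_comm] at b1 b2
    rw [Finset.insert_comm, Finset.insert_comm c i]
    exact S.val_ne (by simp [hi, Ne.symm a1.1]) (by simp [hk, Ne.symm a2.1]) hki b1 b2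
  lt_of_localMax {A B B'} h1 h2 h3 h4 h5 h6 := by
    refine S.lt_of_localMax (A := insert c A) (Finset.insert_subset_insert c h1)
      (Finset.insert_subset_insert c h2) h3.2 h4.2 ?_ fun C i k a b f e g h => ?_
    · intro h; apply h5
      rw [← Finset.erase_insert h3.1, ← Finset.erase_insert h4.1, h]
    · have hc : c ∈ C := a (Finset.mem_insert_self _ _)
      have hic : c ≠ i := by rintro rfl; exact b hc
      have hkc : c ≠ k := by rintro rfl; exact f hc
      have := h6 (C.erase c) i k ?_ (by simp [b]) (by simp [f]) e ?_ ?_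
      · rwa [Finset.insert_comm, Finset.insert_erase hc] at this
      · intro x hx
        refine Finset.mem_erase.2 ⟨?_, a (Finset.mem_insert_of_mem hx)⟩
        rintro rfl; exact h3.1 (h1 hx)
      · rw [← Finset.erase_insert h3.1, g, Finset.erase_insert_of_ne hic.symm]
      · refine ⟨by simp [hkc], ?_⟩
        rwa [Finset.insert_comm, Finset.insert_erase hc]
  lt_of_localMin {A B B'} h1 h2 h3 h4 h5 h6 := by
    refine S.lt_of_localMin (A := insert c A) (Finset.insert_subset_insert c h1)
      (Finset.insert_subset_insert c h2) h3.2 h4.2 ?_ fun C i k a b f e g h => ?_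
    · intro h; apply h5
      rw [← Finset.erase_insert h3.1, ← Finset.erase_insert h4.1, h]
    · have hc : c ∈ C := a (Finset.mem_insert_self _ _)
      have hic : c ≠ i := by rintro rfl; exact b hc
      have hkc : c ≠ k := by rintro rfl; exact f hc
      have := h6 (C.erase c) i k ?_ (by simp [b]) (by simp [f]) e ?_ ?_
      · rwa [Finset.insert_comm, Finset.insert_erase hc] at this
      · intro x hx
        refine Finset.mem_erase.2 ⟨?_, a (Finset.mem_insert_of_mem hx)⟩
        rintro rfl; exact h3.1 (h1 hx)
      · rw [← Finset.erase_insert h3.1, g, Finset.erase_insert_of_ne hic.symm]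
      · refine ⟨by simp [hkc], ?_⟩
        rwa [Finset.insert_comm, Finset.insert_erase hc]

/-- An edge of the program, directed upwards, from the vertex `P` to the vertex `Q`. -/
def Step (S : AbstractObjective ι d) (P Q : Finset ι) : Prop :=
  ∃ C i k, i ∉ C ∧ k ∉ C ∧ k ≠ i ∧ P = insert i C ∧ Q = insert k C ∧ S.feas P ∧ S.feas Q ∧
    S.val P < S.val Q

/-- There is a directed path of exactly `n` edges from `P` to `Q`. -/
def Reach (S : AbstractObjective ι d) : ℕ → Finset ι → Finset ι → Prop
  | 0, P, Q => P = Q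
  | n + 1, P, Q => ∃ R, S.Step P R ∧ S.Reach n R Q

/-- The vertex `s` is the strict minimum. -/
def IsMin (S : AbstractObjective ι d) (s : Finset ι) : Prop :=
  S.feas s ∧ ∀ B, S.feas B → B ≠ s → S.val s < S.val B

/-- The vertex `t` is the strict maximum. -/
def IsMax (S : AbstractObjective ι d) (t : Finset ι) : Prop :=
  S.feas t ∧ ∀ B, S.feas B → B ≠ t → S.val B < S.val t

theorem Step.feas_left {S : AbstractObjective ι d} {P Q} (h : S.Step P Q) : S.feas P := by
  obtain ⟨_, _, _, _, _, _, _, _, h, _⟩ := h; exact h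

theorem Step.feas_right {S : AbstractObjective ι d} {P Q} (h : S.Step P Q) : S.feas Q := by
  obtain ⟨_, _, _, _, _, _, _, _, _, h, _⟩ := h; exact h

theorem Step.lt {S : AbstractObjective ι d} {P Q} (h : S.Step P Q) : S.val P < S.val Q := by
  obtain ⟨_, _, _, _, _, _, _, _, _, _, h⟩ := h; exact h

theorem IsMin.neg {S : AbstractObjective ι d} {s} (h : S.IsMin s) : S.neg.IsMax s :=
  ⟨h.1, fun B h1 h2 => neg_lt_neg (h.2 B h1 h2)⟩

theorem IsMax.neg {S : AbstractObjective ι d} {s} (h : S.IsMax s) : S.neg.IsMin s :=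
  ⟨h.1, fun B h1 h2 => neg_lt_neg (h.2 B h1 h2)⟩

theorem step_neg {S : AbstractObjective ι d} {P Q} : S.neg.Step P Q ↔ S.Step Q P := by
  constructor
  · rintro ⟨C, i, k, h1, h2, h3, h4, h5, h6, h7, h8⟩
    exact ⟨C, k, i, h2, h1, h3.symm, h5, h4, h7, h6, neg_lt_neg_iff.1 h8⟩
  · rintro ⟨C, i, k, h1, h2, h3, h4, h5, h6, h7, h8⟩
    exact ⟨C, k, i, h2, h1, h3.symm, h5, h4, h7, h6, neg_lt_neg h8⟩

theorem IsMin.comap {S : AbstractObjective ι d} {s : Finset ι} (h : S.IsMin s) (e : κ ≃ ι)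
    {s' : Finset κ} (hs : s'.map e.toEmbedding = s) : (S.comap e).IsMin s' := by
  subst hs
  exact ⟨h.1, fun B h1 h2 => h.2 _ h1 (by simpa using h2)⟩

theorem IsMax.comap {S : AbstractObjective ι d} {s : Finset ι} (h : S.IsMax s) (e : κ ≃ ι)
    {s' : Finset κ} (hs : s'.map e.toEmbedding = s) : (S.comap e).IsMax s' := by
  subst hs
  exact ⟨h.1, fun B h1 h2 => h.2 _ h1 (by simpa using h2)⟩

theorem Step.of_comap {S : AbstractObjective ι d} {e : κ ≃ ι} {P Q} (h : (S.comap e).Step P Q) :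
    S.Step (P.map e.toEmbedding) (Q.map e.toEmbedding) := by
  obtain ⟨C, i, k, h1, h2, h3, h4, h5, h6, h7, h8⟩ := h
  exact ⟨C.map e.toEmbedding, e i, e k, by simpa using h1, by simpa using h2, by simpa using h3,
    by rw [h4, Finset.map_insert]; rfl, by rw [h5, Finset.map_insert]; rfl, h6, h7, h8⟩

theorem Reach.of_comap {S : AbstractObjective ι d} {e : κ ≃ ι} {n : ℕ} {P Q}
    (h : (S.comap e).Reach n P Q) : S.Reach n (P.map e.toEmbedding) (Q.map e.toEmbedding) := by
  induction n generalizing P with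
  | zero => exact congrArg _ h
  | succ n ih =>
    obtain ⟨R, h1, h2⟩ := h
    exact ⟨_, h1.of_comap, ih h2⟩

theorem Step.of_link {S : AbstractObjective ι (d + 1)} {c : ι} {P Q} (h : (S.link c).Step P Q) :
    S.Step (insert c P) (insert c Q) := by
  obtain ⟨C, i, k, h1, h2, h3, rfl, rfl, h6, h7, h8⟩ := h
  have a := h6.1
  have b := h7.1
  simp only [Finset.mem_insert, not_or] at a b
  exact ⟨insert c C, i, k, by simp [h1, Ne.symm a.1], by simp [h2, Ne.symm b.1], h3,
    Finset.insert_comm _ _ _, Finset.insert_comm _ _ _, h6.2, h7.2, h8⟩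

theorem Reach.of_link {S : AbstractObjective ι (d + 1)} {c : ι} {n : ℕ} {P Q}
    (h : (S.link c).Reach n P Q) : S.Reach n (insert c P) (insert c Q) := by
  induction n generalizing P with
  | zero => exact congrArg _ h
  | succ n ih =>
    obtain ⟨R, h1, h2⟩ := h
    exact ⟨_, h1.of_link, ih h2⟩

theorem IsMin.link {S : AbstractObjective ι (d + 1)} {s : Finset ι} (h : S.IsMin s) {c : ι}
    (hc : c ∈ s) : (S.link c).IsMin (s.erase c) := by
  refine ⟨⟨by simp, by simpa [Finset.insert_erase hc] using h.1⟩, fun B h1 h2 => ?_⟩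
  change S.val (insert c (s.erase c)) < _
  rw [Finset.insert_erase hc]
  refine h.2 _ h1.2 ?_
  rintro rfl; exact h2 (Finset.erase_insert h1.1).symm

theorem IsMax.link {S : AbstractObjective ι (d + 1)} {s : Finset ι} (h : S.IsMax s) {c : ι}
    (hc : c ∈ s) : (S.link c).IsMax (s.erase c) := by
  have := (h.neg.link hc)
  refine ⟨this.1, fun B h1 h2 => neg_lt_neg_iff.1 (this.2 B h1 h2)⟩

theorem Reach.snoc {S : AbstractObjective ι d} {n P Q R} (h : S.Reach n P Q) (h' : S.Step Q R) :
    S.Reach (n + 1) P R := by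
  induction n generalizing P with
  | zero => obtain rfl : P = Q := h; exact ⟨R, h', rfl⟩
  | succ n ih => obtain ⟨T, h1, h2⟩ := h; exact ⟨T, h1, ih h2⟩

/-- Inside a face, every vertex other than the maximum of the face has a larger neighbour. -/
theorem exists_step_of_lt (S : AbstractObjective ι d) {A B B' : Finset ι} (hA : A ⊆ B)
    (hA' : A ⊆ B') (hB : S.feas B) (hB' : S.feas B') (hlt : S.val B ≤ S.val B') (hne : B' ≠ B) :
    ∃ C i k, A ⊆ C ∧ i ∉ C ∧ k ∉ C ∧ k ≠ i ∧ B = insert i C ∧ S.feas (insert k C) ∧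
      S.val B < S.val (insert k C) := by
  by_contra! hcon
  refine absurd (S.lt_of_localMax hA hA' hB hB' hne fun C i k h1 h2 h3 h4 h5 h6 => ?_)
    (not_lt.2 hlt)
  refine lt_of_le_of_ne (hcon C i k h1 h2 h3 h4 h5 h6) ?_
  subst h5
  exact S.val_ne h2 h3 h4 hB h6

theorem IsMax.exists_step {S : AbstractObjective ι d} {t B : Finset ι} (ht : S.IsMax t)
    (hB : S.feas B) (hne : B ≠ t) : ∃ Q, S.Step B Q := by
  obtain ⟨C, i, k, -, h1, h2, h3, h4, h5, h6⟩ := S.exists_step_of_lt (Finset.empty_subset B)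
    (Finset.empty_subset t) hB ht.1 (ht.2 B hB hne).le hne.symm
  exact ⟨_, C, i, k, h1, h2, h3, h4, rfl, hB, h5, h6⟩

theorem IsMin.exists_step {S : AbstractObjective ι d} {s B : Finset ι} (hs : S.IsMin s)
    (hB : S.feas B) (hne : B ≠ s) : ∃ Q, S.Step Q B := by
  obtain ⟨Q, hQ⟩ := hs.neg.exists_step hB hne
  exact ⟨Q, step_neg.1 hQ⟩

theorem exists_isMax [Finite ι] (S : AbstractObjective ι d) {B : Finset ι} (hB : S.feas B) :
    ∃ t, S.IsMax t := by
  classical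
  have hfin : {B | S.feas B}.Finite := Set.toFinite _
  obtain ⟨t, ht, hmax⟩ := hfin.exists_maximalFor S.val _ ⟨B, hB⟩
  have hle : ∀ B, S.feas B → S.val B ≤ S.val t := fun B hB => by
    by_contra! h
    exact absurd (hmax hB h.le) (not_le.2 h)
  refine ⟨t, ht, fun B' hB' hne => ?_⟩
  refine lt_of_le_of_ne (hle B' hB') fun heq => ?_
  obtain ⟨C, i, k, -, h1, h2, h3, h4, h5, h6⟩ := S.exists_step_of_lt (Finset.empty_subset t)
    (Finset.empty_subset B') ht hB' heq.ge hne
  exact absurd (hle _ h5) (not_le.2 h6)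

end AbstractObjective
end PolytopePaths

/-! ### Programs of dimension at most three -/

namespace PolytopePaths
namespace AbstractObjective

variable {ι κ : Type*} [DecidableEq ι] [DecidableEq κ] {d : ℕ}

theorem IsMin.exists_nbr {S : AbstractObjective ι d} {s : Finset ι} (hs : S.IsMin s) {i : ι}
    (hi : i ∈ s) : ∃ k, k ∉ s ∧ S.Step s (insert k (s.erase i)) := by
  obtain ⟨k, h1, h2, h3⟩ := S.exists_pivot (C := s.erase i) (i := i) (by simp)
    (by rw [Finset.insert_erase hi]; exact hs.1)
  have hk : k ∉ s := fun h => h1 (Finset.mem_erase.2 ⟨h2, h⟩)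
  refine ⟨k, hk, s.erase i, i, k, by simp, h1, h2, (Finset.insert_erase hi).symm, rfl, hs.1, h3,
    hs.2 _ h3 fun h => hk ?_⟩
  rw [← h]; simp

theorem IsMax.exists_nbr {S : AbstractObjective ι d} {t : Finset ι} (ht : S.IsMax t) {i : ι}
    (hi : i ∈ t) : ∃ k, k ∉ t ∧ S.Step (insert k (t.erase i)) t := by
  obtain ⟨k, h1, h2⟩ := ht.neg.exists_nbr hi
  exact ⟨k, h1, step_neg.1 h2⟩

theorem reach_one_of_rank_one {S : AbstractObjective ι 1} {s t : Finset ι} (hs : S.IsMin s)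
    (ht : S.IsMax t) (hst : Disjoint s t) : S.Reach 1 s t := by
  obtain ⟨p, rfl⟩ := Finset.card_eq_one.1 (S.card_eq hs.1)
  obtain ⟨q, rfl⟩ := Finset.card_eq_one.1 (S.card_eq ht.1)
  have hpq : q ≠ p := by rintro rfl; simp at hst
  exact ⟨_, ⟨∅, p, q, by simp, by simp, hpq, rfl, rfl, hs.1, ht.1, hs.2 _ ht.1 (by simpa)⟩, rfl⟩

section RankTwo

variable {S : AbstractObjective ι 2}

theorem ne_of_feas_pair {a b : ι} (h : S.feas {a, b}) : a ≠ b := by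
  rintro rfl; simpa using S.card_eq h

theorem pair_unique {c x y z : ι} (hx : S.feas {c, x}) (hy : S.feas {c, y}) (hz : S.feas {c, z})
    (hxy : y ≠ x) (hxz : z ≠ x) : y = z := by
  have h1 := ne_of_feas_pair hx
  have h2 := ne_of_feas_pair hy
  have h3 := ne_of_feas_pair hz
  rw [Finset.pair_comm] at hx hy hz
  exact S.pivot_unique (C := {c}) (by simpa using h1.symm) (by simpa using h2.symm)
    (by simpa using h3.symm) hxy hxz hx hy hz

/-- In a polygon, an ascent goes on in its direction until it reaches the maximum. -/
theorem exists_next {t : Finset ι} (ht : S.IsMax t) {x a b : ι} (hst : S.Step {x, a} {a, b})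
    (hxb : x ≠ b) (hne : {a, b} ≠ t) : ∃ c, c ≠ a ∧ c ≠ b ∧ S.Step {a, b} {b, c} := by
  obtain ⟨Q, hQ⟩ := ht.exists_step hst.feas_right hne
  have hQ' := hQ
  obtain ⟨C, i, k, h1, h2, h3, h4, rfl, h6, h7, h8⟩ := hQ
  have hab := ne_of_feas_pair h6
  have hi : i ∈ ({a, b} : Finset ι) := by rw [h4]; simp
  have hC : C = ({a, b} : Finset ι).erase i := by rw [h4, Finset.erase_insert h1]
  simp only [Finset.mem_insert, Finset.mem_singleton] at hi
  rcases hi with rfl | rfl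
  · have : C = {b} := by rw [hC]; ext z; simp; grind
    subst this
    rw [Finset.pair_comm k b] at hQ'
    exact ⟨k, h3, by simpa using h2, hQ'⟩
  · have : C = {a} := by rw [hC]; ext z; simp; grind
    subst this
    have hx := hst.feas_left
    rw [Finset.pair_comm] at hx h7
    have : x = k := pair_unique h6 hx h7 hxb h3
    subst this
    rw [Finset.pair_comm x a] at h8
    have := hst.lt
    rw [Finset.pair_comm] at this
    exact absurd h8 this.not_gt

/-- The walk that leaves `{p, q}` through `p` never meets `q` again. -/
theorem not_step_back {p q x a : ι} {t : Finset ι} (hs : S.IsMin {p, q}) (ht : S.IsMax t)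
    (hq : q ∉ t) (hst : S.Step {x, a} {a, q}) (hxq : x ≠ q) (hap : a ≠ p) : False := by
  obtain ⟨c, h1, h2, h3⟩ := exists_next ht hst hxq (by rintro rfl; simp at hq)
  have f1 := hst.feas_right
  have f2 := hs.1
  rw [Finset.pair_comm] at f1 f2
  have : p = c := pair_unique f1 f2 h3.feas_right hap.symm h1
  subst this
  have hlt := h3.lt
  rw [Finset.pair_comm q p] at hlt
  refine absurd (hs.2 _ h3.feas_left fun h => ?_) hlt.not_gt
  have : a ∈ ({p, q} : Finset ι) := by rw [← h]; simp
  simp only [Finset.mem_insert, Finset.mem_singleton] at this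
  rcases this with h | h
  · exact hap h
  · exact ne_of_feas_pair h3.feas_left h

/-- In a polygon with at most six sides, of which two contain the minimum `{p, q}` and two others
contain the maximum, either of the two ascents takes at most four steps: the ascent that leaves
through `p` would otherwise visit five further sides, none of which is `p` or `q`. -/
theorem exists_reach_of_rank_two {s t U : Finset ι} (hU : ∀ B, S.feas B → B ⊆ U)
    (hcard : U.card ≤ 6) (hs : S.IsMin s) (ht : S.IsMax t) (hst : Disjoint s t) :
    ∃ n ≤ 4, S.Reach n s t := by
  obtain ⟨p, q, hpq, rfl⟩ := Finset.card_eq_two.1 (S.card_eq hs.1)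
  rw [Finset.disjoint_left] at hst
  have hp : p ∉ t := hst (by simp)
  have hq : q ∉ t := hst (by simp)
  obtain ⟨k1, hk1, h1⟩ := hs.exists_nbr (i := q) (by simp)
  have e1 : insert k1 (({p, q} : Finset ι).erase q) = {p, k1} := by
    ext z; simp; grind
  rw [e1] at h1
  simp only [Finset.mem_insert, Finset.mem_singleton, not_or] at hk1
  have h1' : S.Step {q, p} {p, k1} := by rwa [Finset.pair_comm q p]
  obtain ⟨k2, a2, b2, h2⟩ := exists_next ht h1' (Ne.symm hk1.2) (by rintro rfl; simp at hp)
  have q2 : k2 ≠ q := by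
    rintro rfl; exact not_step_back hs ht hq h2 hpq hk1.1
  by_cases e2 : ({k1, k2} : Finset ι) = t
  · exact ⟨2, by norm_num, _, h1, _, h2, e2⟩
  obtain ⟨k3, a3, b3, h3⟩ := exists_next ht h2 (Ne.symm a2) e2
  have p3 : k3 ≠ p := by
    rintro rfl
    have f1 := h1'.feas_left
    have f2 := h1.feas_right
    have f3 := h3.feas_right
    rw [Finset.pair_comm] at f1 f3
    exact q2.symm (pair_unique f2 f1 f3 (Ne.symm hk1.2) b2)
  have q3 : k3 ≠ q := by
    rintro rfl; exact not_step_back hs ht hq h3 (Ne.symm a3) a2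
  by_cases e3 : ({k2, k3} : Finset ι) = t
  · exact ⟨3, by norm_num, _, h1, _, h2, _, h3, e3⟩
  obtain ⟨k4, a4, b4, h4⟩ := exists_next ht h3 (Ne.symm a3) e3
  have p4 : k4 ≠ p := by
    rintro rfl
    have f1 := h1'.feas_left
    have f2 := h1.feas_right
    have f3 := h4.feas_right
    rw [Finset.pair_comm] at f1 f3
    exact q3.symm (pair_unique f2 f1 f3 (Ne.symm hk1.2) a3)
  have q4 : k4 ≠ q := by
    rintro rfl; exact not_step_back hs ht hq h4 (Ne.symm a4) p3
  have k41 : k4 ≠ k1 := by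
    rintro rfl
    have f1 := h1.feas_right
    have f2 := h2.feas_right
    have f3 := h4.feas_right
    rw [Finset.pair_comm] at f1 f3
    exact b3.symm (pair_unique f1 f2 f3 a2 p3)
  by_cases e4 : ({k3, k4} : Finset ι) = t
  · exact ⟨4, le_rfl, _, h1, _, h2, _, h3, _, h4, e4⟩
  obtain ⟨k5, a5, b5, h5⟩ := exists_next ht h4 (Ne.symm a4) e4
  have p5 : k5 ≠ p := by
    rintro rfl
    have f1 := h1'.feas_left
    have f2 := h1.feas_right
    have f3 := h5.feas_right
    rw [Finset.pair_comm] at f1 f3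
    exact q4.symm (pair_unique f2 f1 f3 (Ne.symm hk1.2) k41)
  have q5 : k5 ≠ q := by
    rintro rfl; exact not_step_back hs ht hq h5 (Ne.symm a5) p4
  have k51 : k5 ≠ k1 := by
    rintro rfl
    have f1 := h1.feas_right
    have f2 := h2.feas_right
    have f3 := h5.feas_right
    rw [Finset.pair_comm] at f1 f3
    exact a4.symm (pair_unique f1 f2 f3 a2 p4)
  have k52 : k5 ≠ k2 := by
    rintro rfl
    have f1 := h2.feas_right
    have f2 := h3.feas_right
    have f3 := h5.feas_right
    rw [Finset.pair_comm] at f1 f3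
    exact b4.symm (pair_unique f1 f2 f3 a3 k41)
  have hsub : ({p, q, k1, k2, k3, k4, k5} : Finset ι) ⊆ U := by
    have u0 := hU _ hs.1
    have u1 := hU _ h2.feas_right
    have u2 := hU _ h4.feas_right
    have u3 := hU _ h5.feas_right
    intro z hz
    simp only [Finset.mem_insert, Finset.mem_singleton] at hz
    rcases hz with rfl | rfl | rfl | rfl | rfl | rfl | rfl
    · exact u0 (by simp)
    · exact u0 (by simp)
    · exact u1 (by simp)
    · exact u1 (by simp)
    · exact u2 (by simp)
    · exact u2 (by simp)
    · exact u3 (by simp)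
  have hc : ({p, q, k1, k2, k3, k4, k5} : Finset ι).card = 7 := by
    obtain ⟨x1, x2⟩ := hk1
    repeat rw [Finset.card_insert_of_notMem]
    · simp
    all_goals simp only [Finset.mem_insert, Finset.mem_singleton, not_or]
    all_goals grind
  have := Finset.card_le_card hsub
  omega

end RankTwo

section RankThree

variable {S : AbstractObjective ι 3}

/-- The vertex `B` is the strict maximum of the facet of `c`. -/
def IsTop (S : AbstractObjective ι d) (c : ι) (B : Finset ι) : Prop :=
  c ∈ B ∧ S.feas B ∧ ∀ B', c ∈ B' → S.feas B' → B' ≠ B → S.val B' < S.val B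

/-- The vertex `B` is the strict minimum of the facet of `c`. -/
def IsBot (S : AbstractObjective ι d) (c : ι) (B : Finset ι) : Prop :=
  c ∈ B ∧ S.feas B ∧ ∀ B', c ∈ B' → S.feas B' → B' ≠ B → S.val B < S.val B'

theorem IsTop.unique {S : AbstractObjective ι d} {c : ι} {B B' : Finset ι} (h : S.IsTop c B)
    (h' : S.IsTop c B') : B = B' := by
  by_contra hne
  exact (h.2.2 _ h'.1 h'.2.1 (Ne.symm hne)).not_gt (h'.2.2 _ h.1 h.2.1 hne)

theorem IsBot.unique {S : AbstractObjective ι d} {c : ι} {B B' : Finset ι} (h : S.IsBot c B)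
    (h' : S.IsBot c B') : B = B' := by
  by_contra hne
  exact (h.2.2 _ h'.1 h'.2.1 (Ne.symm hne)).not_gt (h'.2.2 _ h.1 h.2.1 hne)

/-- Every vertex of a three-dimensional program is the maximum or the minimum of a facet: of its
three edges two have the same direction, and they lie in a common facet. -/
theorem exists_isTop_or_isBot {B : Finset ι} (hB : S.feas B) :
    (∃ c, S.IsTop c B) ∨ ∃ c, S.IsBot c B := by
  -- the edge that releases `i` leads upwards, or downwards
  let up : ι → Prop := fun i => ∀ C k, i ∉ C → k ∉ C → k ≠ i → B = insert i C →
    S.feas (insert k C) → S.val B < S.val (insert k C)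
  let dn : ι → Prop := fun i => ∀ C k, i ∉ C → k ∉ C → k ≠ i → B = insert i C →
    S.feas (insert k C) → S.val (insert k C) < S.val B
  have hdir : ∀ i ∈ B, up i ∨ dn i := by
    intro i hi
    by_contra! hcon
    obtain ⟨h1, h2⟩ := hcon
    simp only [up, dn] at h1 h2
    push Not at h1 h2
    obtain ⟨C, k, a1, a2, a3, a4, a5, a6⟩ := h1
    obtain ⟨C', k', b1, b2, b3, b4, b5, b6⟩ := h2
    have : C' = C := by
      rw [← Finset.erase_insert a1, ← a4, b4, Finset.erase_insert b1]
    subst this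
    have hkk : k = k' := S.pivot_unique a1 a2 b2 a3 b3 (a4 ▸ hB) a5 b5
    subst hkk
    subst a4
    exact S.val_ne a1 a2 a3 hB a5 (le_antisymm a6 b6)
  have htop : ∀ x y z, B = {x, y, z} → dn x → dn y → S.IsTop z B := by
    rintro x y z rfl hx hy
    refine ⟨by simp, hB, fun B' hz hB' hne => S.lt_of_localMax (A := {z}) (by simp) (by simpa) hB
      hB' hne fun C i k h1 h2 h3 h4 h5 h6 => ?_⟩
    have hi : i ∈ ({x, y, z} : Finset ι) := by rw [h5]; simp
    simp only [Finset.mem_insert, Finset.mem_singleton] at hi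
    rcases hi with rfl | rfl | rfl
    · exact hx C k h2 h3 h4 h5 h6
    · exact hy C k h2 h3 h4 h5 h6
    · exact absurd (h1 (by simp)) h2
  have hbot : ∀ x y z, B = {x, y, z} → up x → up y → S.IsBot z B := by
    rintro x y z rfl hx hy
    refine ⟨by simp, hB, fun B' hz hB' hne => S.lt_of_localMin (A := {z}) (by simp) (by simpa) hB
      hB' hne fun C i k h1 h2 h3 h4 h5 h6 => ?_⟩
    have hi : i ∈ ({x, y, z} : Finset ι) := by rw [h5]; simp
    simp only [Finset.mem_insert, Finset.mem_singleton] at hi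
    rcases hi with rfl | rfl | rfl
    · exact hx C k h2 h3 h4 h5 h6
    · exact hy C k h2 h3 h4 h5 h6
    · exact absurd (h1 (by simp)) h2
  obtain ⟨x, y, z, -, -, -, hxyz⟩ := Finset.card_eq_three.1 (S.card_eq hB)
  have e1 : B = {x, z, y} := by rw [hxyz]; ext; simp; tauto
  have e2 : B = {y, z, x} := by rw [hxyz]; ext; simp; tauto
  rcases hdir x (by simp [hxyz]) with hx | hx <;> rcases hdir y (by simp [hxyz]) with hy | hy <;>
    rcases hdir z (by simp [hxyz]) with hz | hz
  · exact .inr ⟨z, hbot _ _ _ hxyz hx hy⟩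
  · exact .inr ⟨z, hbot _ _ _ hxyz hx hy⟩
  · exact .inr ⟨y, hbot _ _ _ e1 hx hz⟩
  · exact .inl ⟨x, htop _ _ _ e2 hy hz⟩
  · exact .inr ⟨x, hbot _ _ _ e2 hy hz⟩
  · exact .inl ⟨y, htop _ _ _ e1 hx hz⟩
  · exact .inl ⟨z, htop _ _ _ hxyz hx hy⟩
  · exact .inl ⟨z, htop _ _ _ hxyz hx hy⟩

/-- A simple three-dimensional program with at most seven constraints has at most ten vertices:
apart from `s` and `t`, every vertex is the maximum of one of the four facets that miss `t`, or the
minimum of one of the four facets that miss `s`. -/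
theorem card_feas_le_ten {s t U : Finset ι} (hU : ∀ B, S.feas B → B ⊆ U)
    (hcard : U.card ≤ 7) (hs : S.IsMin s) (ht : S.IsMax t) (F : Finset (Finset ι))
    (hF : ∀ B ∈ F, S.feas B) : F.card ≤ 10 := by
  classical
  have key : ∀ B ∈ (F.erase s).erase t, ∃ x ∈ (U \ t).disjSum (U \ s),
      Sum.elim (fun c => S.IsTop c B) (fun c => S.IsBot c B) x := by
    intro B hB
    simp only [Finset.mem_erase] at hB
    obtain ⟨h1, h2, h3⟩ := hB
    have hfe := hF B h3
    rcases exists_isTop_or_isBot hfe with ⟨c, hc⟩ | ⟨c, hc⟩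
    · refine ⟨Sum.inl c, ?_, hc⟩
      simp only [Finset.inl_mem_disjSum, Finset.mem_sdiff]
      exact ⟨hU _ hfe hc.1, fun h => (hc.2.2 t h ht.1 (Ne.symm h1)).not_gt (ht.2 _ hfe h1)⟩
    · refine ⟨Sum.inr c, ?_, hc⟩
      simp only [Finset.inr_mem_disjSum, Finset.mem_sdiff]
      exact ⟨hU _ hfe hc.1, fun h => (hc.2.2 s h hs.1 (Ne.symm h2)).not_gt (hs.2 _ hfe h2)⟩
  choose g hg1 hg2 using key
  have h1 : ((F.erase s).erase t).card ≤ ((U \ t).disjSum (U \ s)).card := by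
    rw [← Finset.card_attach (s := (F.erase s).erase t)]
    refine Finset.card_le_card_of_injOn (fun B => g B.1 B.2) (fun B _ => hg1 B.1 B.2)
      fun B _ B' _ heq => Subtype.ext ?_
    have a := hg2 B.1 B.2
    have b := hg2 B'.1 B'.2
    simp only at heq
    rw [← heq] at b
    rcases hgB : g B.1 B.2 with c | c
    · rw [hgB] at a b; exact a.unique b
    · rw [hgB] at a b; exact a.unique b
  rw [Finset.card_disjSum, Finset.card_sdiff_of_subset (hU _ ht.1),
    Finset.card_sdiff_of_subset (hU _ hs.1), S.card_eq ht.1, S.card_eq hs.1] at h1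
  have h2 := Finset.pred_card_le_card_erase (s := F) (a := s)
  have h3 := Finset.pred_card_le_card_erase (s := F.erase s) (a := t)
  omega

/-- In a three-dimensional program with at most seven constraints whose minimum `s` and maximum `t`
have no constraint in common, there is a directed path of at most four edges from `s` to `t`. If
there were none, the highest neighbour of `s` would have an upper neighbour `a` and the lowest
neighbour of `t` a lower neighbour `b`, and `s`, `t`, their six neighbours, `a` and `b` would be
all the vertices. Two neighbours of `s` then lie with `s` in a polygon that either is a triangle or
contains `a`, and it follows that `a` is a neighbour of `s`, although it is higher than all of
them. -/
theorem exists_reach_of_rank_three {s t U : Finset ι} (hU : ∀ B, S.feas B → B ⊆ U)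
    (hcard : U.card ≤ 7) (hs : S.IsMin s) (ht : S.IsMax t) (hst : Disjoint s t) :
    ∃ n ≤ 4, S.Reach n s t := by
  classical
  by_contra hcon
  have no2 : ∀ P, S.Step s P → ¬ S.Step P t := fun P h1 h2 =>
    hcon ⟨2, by norm_num, P, h1, t, h2, rfl⟩
  have no3 : ∀ P Q, S.Step s P → S.Step P Q → ¬ S.Step Q t := fun P Q h1 h2 h3 =>
    hcon ⟨3, by norm_num, P, h1, Q, h2, t, h3, rfl⟩
  have no4 : ∀ P Q R, S.Step s P → S.Step P Q → S.Step Q R → ¬ S.Step R t :=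
    fun P Q R h1 h2 h3 h4 => hcon ⟨4, le_rfl, P, h1, Q, h2, R, h3, t, h4, rfl⟩
  have hnbr : ∀ i ∈ s, ∃ k, k ∉ s ∧ S.Step s (insert k (s.erase i)) := fun i hi => hs.exists_nbr hi
  have hnbr' : ∀ i ∈ t, ∃ k, k ∉ t ∧ S.Step (insert k (t.erase i)) t :=
    fun i hi => ht.exists_nbr hi
  -- `v i` and `w i` are the neighbours of `s` and `t` across the edges that release `i`
  choose! j hj1 hj2 using hnbr
  choose! l hl1 hl2 using hnbr'
  set v : ι → Finset ι := fun i => insert (j i) (s.erase i) with hv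
  set w : ι → Finset ι := fun i => insert (l i) (t.erase i) with hw
  have hcs := S.card_eq hs.1
  have hct := S.card_eq ht.1
  -- a basis that shares two labels with `s` is `s` or a neighbour of `s`
  have hnear : ∀ Q k, S.feas Q → k ∈ s → s.erase k ⊆ Q → Q = s ∨ Q = v k := by
    intro Q k hQ hk hsub
    have hcQ := S.card_eq hQ
    have : (Q \ s.erase k).card = 1 := by
      rw [Finset.card_sdiff_of_subset hsub, hcQ, Finset.card_erase_of_mem hk, hcs]
    obtain ⟨m, hm⟩ := Finset.card_eq_one.1 this
    have hmQ : Q = insert m (s.erase k) := by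
      rw [Finset.insert_eq, ← hm, Finset.sdiff_union_of_subset hsub]
    have hmn : m ∉ s.erase k := by
      have : m ∈ Q \ s.erase k := by rw [hm]; simp
      exact (Finset.mem_sdiff.1 this).2
    by_cases hmk : m = k
    · left; rw [hmQ, hmk, Finset.insert_erase hk]
    · right
      have : j k = m := S.pivot_unique (C := s.erase k) (i := k) (by simp)
        (by simp [hj1 k hk]) hmn (fun h => hj1 k hk (h.symm ▸ hk)) hmk
        (by rw [Finset.insert_erase hk]; exact hs.1) (hj2 k hk).feas_right (hmQ ▸ hQ)
      rw [hmQ, hv, ← this]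
  obtain ⟨i0, hi0, hmax⟩ := Finset.exists_max_image s (fun i => S.val (v i))
    (Finset.card_pos.1 (by omega))
  obtain ⟨o0, ho0, hmin⟩ := Finset.exists_min_image t (fun i => S.val (w i))
    (Finset.card_pos.1 (by omega))
  have hvs : ∀ i ∈ s, v i ≠ s := fun i hi h => by
    have : j i ∈ s := by rw [← h]; simp [hv]
    exact hj1 i hi this
  have hwt : ∀ i ∈ t, w i ≠ t := fun i hi h => by
    have : l i ∈ t := by rw [← h]; simp [hw]
    exact hl1 i hi this
  have hdis := Finset.disjoint_left.1 hst
  have hvt : ∀ i ∈ s, v i ≠ t := fun i hi h => by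
    have : (s.erase i).card = 2 := by rw [Finset.card_erase_of_mem hi, hcs]
    obtain ⟨x, hx⟩ := Finset.card_pos.1 (by omega : 0 < (s.erase i).card)
    exact hdis (Finset.mem_of_mem_erase hx) (h ▸ Finset.mem_insert_of_mem hx)
  have hws : ∀ i ∈ t, w i ≠ s := fun i hi h => by
    have : (t.erase i).card = 2 := by rw [Finset.card_erase_of_mem hi, hct]
    obtain ⟨x, hx⟩ := Finset.card_pos.1 (by omega : 0 < (t.erase i).card)
    exact hdis (h ▸ Finset.mem_insert_of_mem hx) (Finset.mem_of_mem_erase hx)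
  have hvw : ∀ i ∈ s, ∀ o ∈ t, v i ≠ w o := fun i hi o ho h => by
    have h2 : s.erase i ⊆ {l o} := by
      intro x hx
      have : x ∈ w o := h ▸ Finset.mem_insert_of_mem hx
      rcases Finset.mem_insert.1 this with h | h
      · simpa using h
      · exact absurd (Finset.mem_of_mem_erase h) (hdis (Finset.mem_of_mem_erase hx))
    have := Finset.card_le_card h2
    rw [Finset.card_erase_of_mem hi, hcs] at this
    simp at this
  obtain ⟨a, ha⟩ := ht.exists_step (hj2 i0 hi0).feas_right (hvt i0 hi0)
  obtain ⟨b, hb⟩ := hs.exists_step (hl2 o0 ho0).feas_left (hws o0 ho0)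
  have hsn : ∀ {P}, S.Step P s → False := fun {P} h =>
    (hs.2 P h.feas_left (fun e => by subst e; exact lt_irrefl _ h.lt)).not_gt h.lt
  have htn : ∀ {P}, S.Step t P → False := fun {P} h =>
    (ht.2 P h.feas_right (fun e => by subst e; exact lt_irrefl _ h.lt)).not_gt h.lt
  have has : a ≠ s := by rintro rfl; exact hsn ha
  have hat : a ≠ t := by rintro rfl; exact no2 _ (hj2 i0 hi0) ha
  have hav : ∀ i ∈ s, a ≠ v i := fun i hi h => by
    subst h; exact (hmax i hi).not_gt ha.lt
  have haw : ∀ o ∈ t, a ≠ w o := fun o ho h => by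
    subst h; exact no3 _ _ (hj2 i0 hi0) ha (hl2 o ho)
  have hbt : b ≠ t := by rintro rfl; exact htn hb
  have hbs : b ≠ s := by rintro rfl; exact no2 _ hb (hl2 o0 ho0)
  have hbw : ∀ o ∈ t, b ≠ w o := fun o ho h => by
    subst h; exact (hmin o ho).not_gt hb.lt
  have hbv : ∀ i ∈ s, b ≠ v i := fun i hi h => by
    subst h; exact no3 _ _ (hj2 i hi) hb (hl2 o0 ho0)
  have hab : a ≠ b := by rintro rfl; exact no4 _ _ _ (hj2 i0 hi0) ha hb (hl2 o0 ho0)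
  -- these ten bases are distinct, so there is no other
  have hlist : ∀ Q, S.feas Q → Q = s ∨ Q = t ∨ Q = a ∨ Q = b ∨ (∃ i ∈ s, Q = v i) ∨
      ∃ o ∈ t, Q = w o := by
    intro Q hQ
    by_contra! hn
    obtain ⟨n1, n2, n3, n4, n5, n6⟩ := hn
    have hvinj : Set.InjOn v s := fun i hi i' hi' h => by
      by_contra hne
      have : i' ∈ v i := Finset.mem_insert_of_mem (Finset.mem_erase.2 ⟨Ne.symm hne, hi'⟩)
      rw [h] at this
      rcases Finset.mem_insert.1 this with h | h
      · exact hj1 i' hi' (h ▸ hi')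
      · simp at h
    have hwinj : Set.InjOn w t := fun i hi i' hi' h => by
      by_contra hne
      have : i' ∈ w i := Finset.mem_insert_of_mem (Finset.mem_erase.2 ⟨Ne.symm hne, hi'⟩)
      rw [h] at this
      rcases Finset.mem_insert.1 this with h | h
      · exact hl1 i' hi' (h ▸ hi')
      · simp at h
    have hc : (insert Q (insert s (insert t (insert a (insert b (s.image v ∪ t.image w)))))).card
        = 11 := by
      rw [Finset.card_insert_of_notMem, Finset.card_insert_of_notMem,
        Finset.card_insert_of_notMem, Finset.card_insert_of_notMem,
        Finset.card_insert_of_notMem, Finset.card_union_of_disjoint,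
        Finset.card_image_of_injOn hvinj, Finset.card_image_of_injOn hwinj, hcs, hct]
      · rw [Finset.disjoint_left]
        simp only [Finset.mem_image]
        rintro _ ⟨i, hi, rfl⟩ ⟨o, ho, h⟩
        exact hvw i hi o ho h.symm
      · simp only [Finset.mem_union, Finset.mem_image]
        rintro (⟨i, hi, h⟩ | ⟨o, ho, h⟩)
        exacts [hbv i hi h.symm, hbw o ho h.symm]
      · simp only [Finset.mem_insert, Finset.mem_union, Finset.mem_image]
        rintro (h | ⟨i, hi, h⟩ | ⟨o, ho, h⟩)
        exacts [hab h, hav i hi h.symm, haw o ho h.symm]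
      · simp only [Finset.mem_insert, Finset.mem_union, Finset.mem_image]
        rintro (h | h | ⟨i, hi, h⟩ | ⟨o, ho, h⟩)
        exacts [hat h.symm, hbt h.symm, hvt i hi h, hwt o ho h]
      · simp only [Finset.mem_insert, Finset.mem_union, Finset.mem_image]
        rintro (h | h | h | ⟨i, hi, h⟩ | ⟨o, ho, h⟩)
        · obtain ⟨x, hx⟩ := Finset.card_pos.1 (by omega : 0 < s.card)
          exact hdis hx (h ▸ hx)
        exacts [has h.symm, hbs h.symm, hvs i hi h, hws o ho h]
      · simp only [Finset.mem_insert, Finset.mem_union, Finset.mem_image]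
        rintro (h | h | h | h | ⟨i, hi, h⟩ | ⟨o, ho, h⟩)
        exacts [n1 h, n2 h, n3 h, n4 h, n5 i hi h.symm, n6 o ho h.symm]
    have := card_feas_le_ten hU hcard hs ht (insert Q (insert s (insert t (insert a
      (insert b (s.image v ∪ t.image w)))))) (by
        intro B hB
        simp only [Finset.mem_insert, Finset.mem_union, Finset.mem_image] at hB
        rcases hB with rfl | rfl | rfl | rfl | rfl | ⟨i, hi, rfl⟩ | ⟨o, ho, rfl⟩
        · exact hQ
        · exact hs.1
        · exact ht.1
        · exact ha.feas_right
        · exact hb.feas_left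
        · exact (hj2 i hi).feas_right
        · exact (hl2 o ho).feas_left)
    omega
  have hlt : S.val a < S.val b := by
    obtain ⟨Q, hQ⟩ := ht.exists_step ha.feas_right hat
    rcases hlist Q hQ.feas_right with rfl | rfl | rfl | rfl | ⟨i, hi, rfl⟩ | ⟨o, ho, rfl⟩
    · exact (hsn hQ).elim
    · exact (no3 _ _ (hj2 i0 hi0) ha hQ).elim
    · exact (lt_irrefl _ hQ.lt).elim
    · exact hQ.lt
    · exact absurd (ha.lt.trans hQ.lt) (hmax i hi).not_gt
    · exact (no4 _ _ _ (hj2 i0 hi0) ha hQ (hl2 o ho)).elim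
  -- leave `v i` by releasing `k`: the edge either closes a triangle with `s` at `v k`, or leads
  -- to `a`
  have hslot : ∀ i ∈ s, ∀ k ∈ s, k ≠ i → j i = j k ∨
      ∀ x ∈ s, x ≠ i → x ≠ k → x ∈ a := by
    intro i hi k hk hki
    have hkv : k ∈ v i := Finset.mem_insert_of_mem (Finset.mem_erase.2 ⟨hki, hk⟩)
    have hvi := (hj2 i hi).feas_right
    obtain ⟨m, m1, m2, m3⟩ := S.exists_pivot (C := (v i).erase k) (i := k) (by simp)
      (by rw [Finset.insert_erase hkv]; exact hvi)
    have hjm : j i ∈ insert m ((v i).erase k) := by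
      refine Finset.mem_insert_of_mem (Finset.mem_erase.2 ⟨?_, by simp [hv]⟩)
      rintro rfl; exact hj1 i hi hk
    have hxm : ∀ x ∈ s, x ≠ i → x ≠ k → x ∈ insert m ((v i).erase k) := fun x hx h1 h2 =>
      Finset.mem_insert_of_mem (Finset.mem_erase.2 ⟨h2, Finset.mem_insert_of_mem
        (Finset.mem_erase.2 ⟨h1, hx⟩)⟩)
    have hkm : k ∉ insert m ((v i).erase k) := by
      simp [Ne.symm m2]
    have hstep : S.val (v i) < S.val (insert m ((v i).erase k)) →
        S.Step (v i) (insert m ((v i).erase k)) := fun h =>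
      ⟨(v i).erase k, k, m, by simp, m1, m2, (Finset.insert_erase hkv).symm, rfl, hvi, m3, h⟩
    have hbig : S.val (v i) < S.val b := ((hmax i hi).trans_lt ha.lt).trans hlt
    have hthird : ∃ x ∈ s, x ≠ i ∧ x ≠ k := by
      have : 0 < ((s.erase i).erase k).card := by
        rw [Finset.card_erase_of_mem (Finset.mem_erase.2 ⟨hki, hk⟩), Finset.card_erase_of_mem hi]
        omega
      obtain ⟨x, hx⟩ := Finset.card_pos.1 this
      simp only [Finset.mem_erase] at hx
      exact ⟨x, hx.2.2, hx.2.1, hx.1⟩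
    rcases hlist _ m3 with h | h | h | h | ⟨i', hi', h⟩ | ⟨o, ho, h⟩
    · exact absurd (h ▸ hjm) (hj1 i hi)
    · obtain ⟨x, hx, h1, h2⟩ := hthird
      exact absurd (h ▸ hxm x hx h1 h2) (hdis hx)
    · right; rw [← h]; exact hxm
    · rw [h] at hstep
      exact (no4 _ _ _ (hj2 i hi) (hstep hbig) hb (hl2 o0 ho0)).elim
    · left
      by_cases e : i' = k
      · subst e
        rw [h] at hjm
        rcases Finset.mem_insert.1 hjm with h | h
        · exact h
        · exact absurd (Finset.mem_of_mem_erase h) (hj1 i hi)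
      · exfalso
        by_cases e' : i' = i
        · subst e'; rw [h] at hkm; exact hkm hkv
        · have := hxm i' hi' e' e
          rw [h] at this
          rcases Finset.mem_insert.1 this with h | h
          · exact hj1 i' hi' (h ▸ hi')
          · simp at h
    · rw [h] at hstep
      exact (no3 _ _ (hj2 i hi) (hstep (hbig.trans (hb.lt.trans_le (hmin o ho)))) (hl2 o ho)).elim
  -- the step from `v i0` to `a` keeps two labels of `v i0`; the case where it gives up `j i0` makes
  -- `a` a neighbour of `s`, and otherwise all three new labels agree and `a` is the neighbour `v k`
  obtain ⟨C, k, y, c1, c2, c3, c4, c5, -, hfa, -⟩ := ha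
  have hC : C = (v i0).erase k := by
    change C = (insert (j i0) (s.erase i0)).erase k
    rw [c4, Finset.erase_insert c1]
  have hkv : k ∈ insert (j i0) (s.erase i0) := by rw [c4]; simp
  have hnear' : ∀ Q, S.feas Q → Q = a → ∀ x ∈ s, ¬ s.erase x ⊆ Q := by
    rintro Q hQ rfl x hx hsub
    rcases hnear _ x hQ hx hsub with h | h
    · exact has h
    · exact hav x hx h
  rcases Finset.mem_insert.1 hkv with hk | hk
  · refine hnear' a hfa rfl i0 hi0 ?_
    rw [c5, hC, hk, hv]
    intro x hx
    simp only [Finset.mem_insert, Finset.mem_erase] at hx ⊢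
    refine .inr ⟨?_, .inr hx⟩
    rintro rfl; exact hj1 i0 hi0 hx.2
  · obtain ⟨hki, hks⟩ := Finset.mem_erase.1 hk
    have : ((s.erase i0).erase k).card = 1 := by
      rw [Finset.card_erase_of_mem hk, Finset.card_erase_of_mem hi0]; omega
    obtain ⟨m, hm⟩ := Finset.card_eq_one.1 this
    have hmm : m ∈ (s.erase i0).erase k := by rw [hm]; simp
    simp only [Finset.mem_erase] at hmm
    obtain ⟨hmk, hmi, hms⟩ := hmm
    have hthree : ∀ x ∈ s, x = i0 ∨ x = k ∨ x = m := by
      intro x hx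
      by_contra! h
      have : x ∈ (s.erase i0).erase k := by simp [h, hx]
      rw [hm] at this
      exact h.2.2 (by simpa using this)
    have hma : m ∈ a := by
      rw [c5, hC]; exact Finset.mem_insert_of_mem (by simp [hv, hmk, hmi, hms])
    have hi0a : i0 ∉ a := fun h => hnear' a hfa rfl k hks fun x hx => by
      simp only [Finset.mem_erase] at hx
      rcases hthree x hx.2 with rfl | rfl | rfl
      exacts [h, absurd rfl hx.1, hma]
    have hka : k ∉ a := fun h => hnear' a hfa rfl i0 hi0 fun x hx => by
      simp only [Finset.mem_erase] at hx
      rcases hthree x hx.2 with rfl | rfl | rfl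
      exacts [absurd rfl hx.1, h, hma]
    have j1 : j i0 = j m := (hslot i0 hi0 m hms hmi).resolve_right fun h =>
      hka (h k hks hki (Ne.symm hmk))
    have j2 : j k = j m := (hslot k hks m hms hmk).resolve_right fun h =>
      hi0a (h i0 hi0 (Ne.symm hki) (Ne.symm hmi))
    refine hnear' a hfa rfl k hks ?_ |>.elim
    have hvk : v k = insert i0 C := by
      rw [hC]
      ext x
      simp only [hv, Finset.mem_insert, Finset.mem_erase, j2, j1]
      constructor
      · rintro (h | ⟨h1, h2⟩)
        · exact .inr ⟨by rintro rfl; exact hj1 m hms (h ▸ hks), .inl h⟩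
        · by_cases e : x = i0
          · exact .inl e
          · exact .inr ⟨h1, .inr ⟨e, h2⟩⟩
      · rintro (rfl | ⟨h1, h | ⟨h2, h3⟩⟩)
        · exact .inr ⟨Ne.symm hki, hi0⟩
        · exact .inl h
        · exact .inr ⟨h1, h3⟩
    have hi0C : i0 ∉ C := fun h => hi0a (by rw [c5]; exact Finset.mem_insert_of_mem h)
    have : y = i0 := S.pivot_unique c1 c2 hi0C c3 (Ne.symm hki) (c4 ▸ (hj2 i0 hi0).feas_right)
      (c5 ▸ hfa) (hvk ▸ (hj2 k hks).feas_right)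
    rw [this] at c5
    exact absurd (hvk ▸ c5) (hav k hks)

end RankThree
end AbstractObjective
end PolytopePaths

/-! ### Paths in the complete graph on four vertices, encoded by numbers -/

namespace PolytopePaths

section PairPaths

/-- The smaller element of the `a`-th pair of elements of `Fin 4`; the six pairs are listed in
lexicographic order, so that `Fin.rev` takes a pair to its complement. -/
def pairFst : Fin 6 → Fin 4 := ![0, 0, 0, 1, 1, 2]

/-- The larger element of the `a`-th pair of elements of `Fin 4`. -/
def pairSnd : Fin 6 → Fin 4 := ![1, 2, 3, 2, 3, 3]

/-- The `a`-th pair of elements of `Fin 4`, an edge of the complete graph `K₄`. -/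
def pairSet (a : Fin 6) : Finset (Fin 4) := {pairFst a, pairSnd a}

/-- The edges `pairSet k` with `g k` form a path of `K₄` from `e` to `f`, and possibly some cycles:
every vertex has degree `0` or `2` when a further half-edge is attached at `e` and at `f`, and
there are no edges if `e = f`. With four vertices a path from `e` to `f ≠ e` leaves no room for a
cycle. -/
def IsPathSet (e f : Fin 4) (g : Fin 6 → Bool) : Prop :=
  (∀ c, ((if c = e then 1 else 0) + (if c = f then 1 else 0) +
      ∑ k, if c ∈ pairSet k ∧ g k = true then 1 else 0 : ℕ) ∈ ({0, 2} : Finset ℕ)) ∧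
    (e = f → ∀ k, g k = false)

instance (e f g) : Decidable (IsPathSet e f g) := by unfold IsPathSet; infer_instance

/-- The place of the pair `{c, d}`, with `c ≠ d`, in the list of the pairs. -/
def pairIdx (c d : Fin 4) : ℕ :=
  if c.val + d.val < 3 then c.val + d.val - 1
  else if c.val + d.val = 3 then (if c = 0 ∨ d = 0 then 2 else 3)
  else c.val + d.val

/-- A simple path of `K₄`, encoded by numbers on which the kernel computes quickly. -/
structure PathCode where
  /-- The number of edges. -/
  len : ℕ
  /-- The set of the edges, as a sum of powers of two. -/
  bits : ℕ
  /-- The place of the first edge in the list of the pairs (`0` for the path without edges). -/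
  fst : ℕ
  /-- The place of the last edge in the list of the pairs (`0` for the path without edges). -/
  lst : ℕ

/-- The codes of the simple paths of `K₄` from `e` to `f`, where the edge `pairSet k` is
represented by the binary digit at the place `h * k`. -/
def pathCodes (h : ℕ) (e f : Fin 4) : List PathCode :=
  if e = f then [⟨0, 0, 0, 0⟩] else
  ⟨1, 2 ^ (h * pairIdx e f), pairIdx e f, pairIdx e f⟩ ::
  ([0, 1, 2, 3].filter fun c => c ≠ e ∧ c ≠ f).flatMap fun c =>
    ⟨2, 2 ^ (h * pairIdx e c) + 2 ^ (h * pairIdx c f), pairIdx e c, pairIdx c f⟩ ::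
    ([0, 1, 2, 3].filter fun d => d ≠ e ∧ d ≠ f ∧ d ≠ c).map fun d =>
      ⟨3, 2 ^ (h * pairIdx e c) + 2 ^ (h * pairIdx c d) + 2 ^ (h * pairIdx d f), pairIdx e c,
        pairIdx d f⟩

/-- The code `o` describes the path from `e` to `f` with the edges `pairSet k`, `g k`. -/
def Encodes (h : ℕ) (e f : Fin 4) (g : Fin 6 → Bool) (o : PathCode) : Prop :=
  (o.bits < 2 ^ 36 ∧
    ∀ n : Fin 36, o.bits.testBit n = true ↔ ∃ k : Fin 6, (n : ℕ) = h * k ∧ g k = true) ∧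
  o.len = (∑ k, if g k = true then 1 else 0) ∧
  (e ≠ f → (∃ k : Fin 6, (k : ℕ) = o.fst ∧ ∀ k', k' = k ↔ g k' = true ∧ e ∈ pairSet k') ∧
    (∃ k : Fin 6, (k : ℕ) = o.lst ∧ ∀ k', k' = k ↔ g k' = true ∧ f ∈ pairSet k'))

instance (h e f g o) : Decidable (Encodes h e f g o) := by unfold Encodes; infer_instance

set_option maxRecDepth 100000 in
theorem exists_code_aux : ∀ b ∈ [1, 6], ∀ e f : Fin 4, ∀ g0 g1 g2 g3 g4 g5 : Bool,
    IsPathSet e f ![g0, g1, g2, g3, g4, g5] →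
    ∃ o ∈ pathCodes b e f, Encodes b e f ![g0, g1, g2, g3, g4, g5] o := by
  decide +kernel

theorem exists_code {b : ℕ} (hb : b = 1 ∨ b = 6) {e f : Fin 4} {g : Fin 6 → Bool}
    (h : IsPathSet e f g) : ∃ o ∈ pathCodes b e f, Encodes b e f g o := by
  have hg : g = ![g 0, g 1, g 2, g 3, g 4, g 5] := by
    ext k; fin_cases k <;> rfl
  rw [hg] at h ⊢
  exact exists_code_aux b (by simpa using hb) e f _ _ _ _ _ _ h

theorem Encodes.testBit {h : ℕ} (hh : h = 1 ∨ h = 6) {e f : Fin 4} {g : Fin 6 → Bool}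
    {o : PathCode} (ho : Encodes h e f g o) (n : ℕ) :
    o.bits.testBit n = true ↔ ∃ k : Fin 6, n = h * k ∧ g k = true := by
  by_cases hn : n < 36
  · exact ho.1.2 ⟨n, hn⟩
  · have h1 : o.bits < 2 ^ n := ho.1.1.trans_le (Nat.pow_le_pow_right (by norm_num) (by omega))
    rw [Nat.testBit_lt_two_pow h1]
    simp only [Bool.false_eq_true, false_iff, not_exists, not_and]
    rintro k rfl
    rcases hh with rfl | rfl <;> omega

/-- A `6 × 6` grid of zeros and ones as a number: the entry of row `a` and column `k` is the digit
at the place `6 * k + (5 - a)`. The rows are given by numbers with digits at the places `6 * k`. -/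
def gridBits (r0 r1 r2 r3 r4 r5 : ℕ) : ℕ :=
  r0 <<< 5 ||| r1 <<< 4 ||| r2 <<< 3 ||| r3 <<< 2 ||| r4 <<< 1 ||| r5

theorem testBit_gridBits {r : Fin 6 → ℕ} {g : Fin 6 → Fin 6 → Bool}
    (hr : ∀ a n, (r a).testBit n = true ↔ ∃ k : Fin 6, n = 6 * k ∧ g a k = true) (n : ℕ) :
    (gridBits (r 0) (r 1) (r 2) (r 3) (r 4) (r 5)).testBit n = true ↔
      ∃ a k : Fin 6, n = 6 * k + (5 - a) ∧ g a k = true := by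
  have key : (gridBits (r 0) (r 1) (r 2) (r 3) (r 4) (r 5)).testBit n = true ↔
      ∃ a : Fin 6, 5 - (a : ℕ) ≤ n ∧ (r a).testBit (n - (5 - a)) = true := by
    simp only [gridBits, Nat.testBit_or, Nat.testBit_shiftLeft, Bool.or_eq_true, Bool.and_eq_true,
      decide_eq_true_eq]
    constructor
    · rintro (((((h | h) | h) | h) | h) | h)
      exacts [⟨0, h⟩, ⟨1, h⟩, ⟨2, h⟩, ⟨3, h⟩, ⟨4, h⟩, ⟨5, by simpa using h⟩]
    · rintro ⟨a, h⟩
      fin_cases a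
      · exact .inl (.inl (.inl (.inl (.inl h))))
      · exact .inl (.inl (.inl (.inl (.inr h))))
      · exact .inl (.inl (.inl (.inr h)))
      · exact .inl (.inl (.inr h))
      · exact .inl (.inr h)
      · exact .inr (by simpa using h)
  rw [key]
  constructor
  · rintro ⟨a, h1, h2⟩
    obtain ⟨k, h3, h4⟩ := (hr a _).1 h2
    exact ⟨a, k, by omega, h4⟩
  · rintro ⟨a, k, h1, h2⟩
    exact ⟨a, by omega, (hr a _).2 ⟨k, by omega, h2⟩⟩

/-- The `k`-th column of a grid; the entry of row `a` is the digit at the place `5 - a`. -/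
def gridCol (M k : ℕ) : ℕ := (M >>> (6 * k)) % 64

theorem testBit_gridCol {M : ℕ} {g : Fin 6 → Fin 6 → Bool}
    (hM : ∀ n, M.testBit n = true ↔ ∃ a k : Fin 6, n = 6 * k + (5 - a) ∧ g a k = true)
    (k : Fin 6) (n : ℕ) :
    (gridCol M k).testBit n = true ↔ ∃ a : Fin 6, n = 5 - a ∧ g a k = true := by
  have : gridCol M k = (M >>> (6 * (k : ℕ))) % 2 ^ 6 := rfl
  rw [this, Nat.testBit_mod_two_pow, Nat.testBit_shiftRight]
  simp only [Bool.and_eq_true, decide_eq_true_eq, hM]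
  constructor
  · rintro ⟨h1, a, k', h2, h3⟩
    have : k' = k := by ext; omega
    subst this
    exact ⟨a, by omega, h3⟩
  · rintro ⟨a, h1, h2⟩
    exact ⟨by omega, a, k, by omega, h2⟩

/-- The set of the numbers below `64` that are the edge set of a simple path of `K₄`, as a sum of
powers of two. -/
def codeBits : ℕ := 1991477909219199

/-- Every column of the grid is the edge set of a simple path of `K₄`. -/
def validGrid (M : ℕ) : Bool :=
  [0, 1, 2, 3, 4, 5].all fun k => Nat.beq ((codeBits >>> gridCol M k) % 2) 1

theorem codeBits_valid : ∀ e f : Fin 4, ∀ o ∈ pathCodes 1 e f,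
    Nat.beq ((codeBits >>> o.bits) % 2) 1 = true := by
  decide +kernel

/-- The number `1` if `a = b`, and `0` otherwise. -/
def eqn (a b : Fin 4) : ℕ := if a = b then 1 else 0

/-- The entries of column `k` are in row `a` and in one of the rows `a'`, `a''`, and in no other.
-/
def colPair (M a a' a'' k : ℕ) : Bool :=
  Nat.beq (gridCol M k) (2 ^ (5 - a) + 2 ^ (5 - a')) ||
    Nat.beq (gridCol M k) (2 ^ (5 - a) + 2 ^ (5 - a''))

/-- The row `5 - e` of a grid; the entry of column `k` is the digit at the place `6 * k`. -/
def gridRow (M e : ℕ) : ℕ := M >>> e &&& (2 ^ 0 + 2 ^ 6 + 2 ^ 12 + 2 ^ 18 + 2 ^ 24 + 2 ^ 30)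

/-- The entries of row `5 - e` are in column `k` and in one of the columns `k'`, `k''`, and in no
other. -/
def rowPair (M k k' k'' e : ℕ) : Bool :=
  Nat.beq (gridRow M e) (2 ^ (6 * k) + 2 ^ (6 * k')) ||
    Nat.beq (gridRow M e) (2 ^ (6 * k) + 2 ^ (6 * k''))

theorem testBit_gridRow {M : ℕ} {g : Fin 6 → Fin 6 → Bool}
    (hM : ∀ n, M.testBit n = true ↔ ∃ a k : Fin 6, n = 6 * k + (5 - a) ∧ g a k = true)
    (a k : Fin 6) : (gridRow M (5 - a)).testBit (6 * k) = true ↔ g a k = true := by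
  have h6 : (2 ^ 0 + 2 ^ 6 + 2 ^ 12 + 2 ^ 18 + 2 ^ 24 + 2 ^ 30 : ℕ).testBit (6 * k) = true := by
    revert k; decide
  rw [gridRow, Nat.testBit_and, Nat.testBit_shiftRight, h6, Bool.and_true, hM]
  constructor
  · rintro ⟨a', k', h1, h2⟩
    have h3 : k' = k := by ext; omega
    have h4 : a' = a := by ext; omega
    rwa [h3, h4] at h2
  · intro h
    exact ⟨a, k, by omega, h⟩

theorem colPair_iff {M : ℕ} {g : Fin 6 → Fin 6 → Bool}
    (hM : ∀ n, M.testBit n = true ↔ ∃ a k : Fin 6, n = 6 * k + (5 - a) ∧ g a k = true)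
    {a b c k : Fin 6} (hab : b ≠ a) (hac : c ≠ a) (h : colPair M a b c k = true) :
    ∃ a' : Fin 6, (a' = b ∨ a' = c) ∧ g a k = true ∧ g a' k = true ∧
      ∀ a'', g a'' k = true → a'' = a ∨ a'' = a' := by
  have key : ∀ a a' a'' : Fin 6, a' ≠ a →
      ((2 ^ (5 - (a : ℕ)) + 2 ^ (5 - (a' : ℕ))).testBit (5 - a'') = true ↔ a'' = a ∨ a'' = a') := by
    decide +kernel
  have key2 : ∀ a' : Fin 6, a' ≠ a → gridCol M k = 2 ^ (5 - (a : ℕ)) + 2 ^ (5 - (a' : ℕ)) →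
      ∀ a'', g a'' k = true ↔ a'' = a ∨ a'' = a' := by
    intro a' ha' hk a''
    rw [← key a a' a'' ha', ← hk, testBit_gridCol hM]
    constructor
    · intro h; exact ⟨a'', rfl, h⟩
    · rintro ⟨x, h1, h2⟩
      have : x = a'' := by ext; omega
      rwa [this] at h2
  simp only [colPair, Bool.or_eq_true] at h
  rcases h with h | h
  · have := key2 b hab (Nat.eq_of_beq_eq_true h)
    exact ⟨b, .inl rfl, (this a).2 (.inl rfl), (this b).2 (.inr rfl), fun x hx => (this x).1 hx⟩
  · have := key2 c hac (Nat.eq_of_beq_eq_true h)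
    exact ⟨c, .inr rfl, (this a).2 (.inl rfl), (this c).2 (.inr rfl), fun x hx => (this x).1 hx⟩

theorem rowPair_iff {M : ℕ} {g : Fin 6 → Fin 6 → Bool}
    (hM : ∀ n, M.testBit n = true ↔ ∃ a k : Fin 6, n = 6 * k + (5 - a) ∧ g a k = true)
    {a k b c : Fin 6} (hab : b ≠ k) (hac : c ≠ k) (h : rowPair M k b c (5 - a) = true) :
    ∃ k' : Fin 6, (k' = b ∨ k' = c) ∧ g a k = true ∧ g a k' = true ∧
      ∀ k'', g a k'' = true → k'' = k ∨ k'' = k' := by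
  have key : ∀ a a' a'' : Fin 6, a' ≠ a →
      ((2 ^ (6 * (a : ℕ)) + 2 ^ (6 * (a' : ℕ))).testBit (6 * a'') = true ↔
        a'' = a ∨ a'' = a') := by
    decide +kernel
  have key2 : ∀ k' : Fin 6, k' ≠ k →
      gridRow M (5 - a) = 2 ^ (6 * (k : ℕ)) + 2 ^ (6 * (k' : ℕ)) →
      ∀ k'', g a k'' = true ↔ k'' = k ∨ k'' = k' := by
    intro k' hk' hk k''
    rw [← key k k' k'' hk', ← hk, testBit_gridRow hM]
  simp only [rowPair, Bool.or_eq_true] at h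
  rcases h with h | h
  · have := key2 b hab (Nat.eq_of_beq_eq_true h)
    exact ⟨b, .inl rfl, (this k).2 (.inl rfl), (this b).2 (.inr rfl), fun x hx => (this x).1 hx⟩
  · have := key2 c hac (Nat.eq_of_beq_eq_true h)
    exact ⟨c, .inr rfl, (this k).2 (.inl rfl), (this c).2 (.inr rfl), fun x hx => (this x).1 hx⟩

/-- The possible sets of marked ends of the path in row `a`: the first edge, the last edge, or
both. The first edge belongs to the label shared with the rows `b` and `c`, the last one to the
label shared with the rows `b'` and `c'`; an end is ruled out if its column has just one other
entry and that is in one of these rows. A choice is the number with digits at the marked places of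
the grid, and whether both ends are marked. -/
def rowChoices (M a b c b' c' : ℕ) (o : PathCode) : List (ℕ × Bool) :=
  if Nat.beq o.len 0 then [(0, false)] else
  (if colPair M a b c o.fst then [] else [(2 ^ (6 * o.fst + (5 - a)), false)]) ++
  (if colPair M a b' c' o.lst then [] else [(2 ^ (6 * o.lst + (5 - a)), false)]) ++
  (if colPair M a b c o.fst || colPair M a b' c' o.lst then [] else
    [(2 ^ (6 * o.fst + (5 - a)) ||| 2 ^ (6 * o.lst + (5 - a)), true)])

/-- The two ends of the path in column `k`: for each of them, whether it is ruled out by the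
condition of `rowChoices` with rows and columns exchanged, and its place in the grid. The list is
empty if the path is. -/
def colEnds (M k b c b' c' : ℕ) (o : PathCode) : List (Bool × ℕ × Bool × ℕ) :=
  if Nat.beq o.len 0 then [] else
   [(rowPair M k b c o.fst, 6 * k + o.fst, rowPair M k b' c' o.lst, 6 * k + o.lst)]

/-- The end of a column at the place `n` is not ruled out and not marked in `X`. -/
def endFree (X : ℕ) (b : Bool) (n : ℕ) : Bool := !b && Nat.beq ((X >>> n) % 2) 0

/-- Every column has an end that is neither ruled out nor marked in `X`. -/
def colsOK (X : ℕ) (E : List (Bool × ℕ × Bool × ℕ)) : Bool :=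
  E.all fun t => endFree X t.1 t.2.1 || endFree X t.2.2.1 t.2.2.2

/-- Some column has two ends that are neither ruled out nor marked in `X`. -/
def colsBoth (X : ℕ) (E : List (Bool × ℕ × Bool × ℕ)) : Bool :=
  E.any fun t => endFree X t.1 t.2.1 && endFree X t.2.2.1 t.2.2.2

/-- Whatever choices are added to the marks `X`, one from each list in the remaining rows, either
some column is left without a free end, or no row has both ends marked, or no column has both ends
free. The last argument records whether a row with both ends marked has been met. -/
def search (E : List (Bool × ℕ × Bool × ℕ)) : List (List (ℕ × Bool)) → ℕ → Bool → Bool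
  | [], X, b => !b || !colsBoth X E
  | l :: L, X, b => l.all fun c => !colsOK (X ||| c.1) E || search E L (X ||| c.1) (b || c.2)

/-- `search` for the grid `M` with the paths `r` in its rows and the paths `c` in its columns. -/
def searchGrid (r0 r1 r2 r3 r4 r5 c0 c1 c2 c3 c4 c5 : PathCode) (M : ℕ) : Bool :=
  search (colEnds M 5 4 3 2 1 c0 ++ colEnds M 4 5 3 2 0 c1 ++ colEnds M 3 5 4 1 0 c2 ++
     colEnds M 2 5 1 4 0 c3 ++ colEnds M 1 5 2 3 0 c4 ++ colEnds M 0 4 2 3 1 c5)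
   [rowChoices M 0 1 2 3 4 r0, rowChoices M 1 0 2 3 5 r1, rowChoices M 2 0 1 4 5 r2,
    rowChoices M 3 0 4 1 5 r3, rowChoices M 4 0 3 2 5 r4, rowChoices M 5 1 3 2 4 r5] 0 false

/-- `searchGrid` succeeds for all paths `c` that have the columns of `M` as their edge sets, except
when some facet would have too many vertices. -/
def checkCols (r0 r1 r2 r3 r4 r5 : PathCode) (M : ℕ) : Bool :=
  [0, 1, 2, 3].all fun i0 => [0, 1, 2, 3].all fun i1 =>
  (pathCodes 1 i0 i1).all fun c0 => !Nat.beq c0.bits (gridCol M 5) || [0, 1, 2, 3].all fun i2 =>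
  (pathCodes 1 i0 i2).all fun c1 => !Nat.beq c1.bits (gridCol M 4) ||
  (pathCodes 1 i1 i2).all fun c3 => !Nat.beq c3.bits (gridCol M 2) || [0, 1, 2, 3].all fun i3 =>
  (pathCodes 1 i0 i3).all fun c2 => !Nat.beq c2.bits (gridCol M 3) ||
  (pathCodes 1 i1 i3).all fun c4 => !Nat.beq c4.bits (gridCol M 1) ||
  (pathCodes 1 i2 i3).all fun c5 => !Nat.beq c5.bits (gridCol M 0) ||
   Nat.blt 6 (r0.len + r1.len + r3.len + (eqn i0 3 + eqn i1 3 + eqn i2 3 + eqn i3 3)) ||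
   Nat.blt 6 (r0.len + r2.len + r4.len + (eqn i0 2 + eqn i1 2 + eqn i2 2 + eqn i3 2)) ||
   Nat.blt 6 (r1.len + r2.len + r5.len + (eqn i0 1 + eqn i1 1 + eqn i2 1 + eqn i3 1)) ||
   Nat.blt 6 (r3.len + r4.len + r5.len + (eqn i0 0 + eqn i1 0 + eqn i2 0 + eqn i3 0)) ||
   searchGrid r0 r1 r2 r3 r4 r5 c0 c1 c2 c3 c4 c5 M

/-- There is no admissible grid whose row of the pair `{p, q}` is a path from `j p` to `j q`, where
`j` takes the values `j0`, `j1`, `j2`, `j3`. Rows are listed in an order that lets the bound on the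
number of vertices of a facet discard a partial grid early. -/
def check (j0 j1 j2 j3 : Fin 4) : Bool :=
  (pathCodes 6 j0 j1).all fun r0 => (pathCodes 6 j0 j2).all fun r1 =>
  (pathCodes 6 j1 j2).all fun r3 => Nat.blt 6 (r0.len + r1.len + r3.len) ||
  (pathCodes 6 j0 j3).all fun r2 => (pathCodes 6 j1 j3).all fun r4 =>
  Nat.blt 6 (r0.len + r2.len + r4.len) ||
  (pathCodes 6 j2 j3).all fun r5 =>
  Nat.blt 6 (r1.len + r2.len + r5.len) || Nat.blt 6 (r3.len + r4.len + r5.len) ||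
  !validGrid (gridBits r0.bits r1.bits r2.bits r3.bits r4.bits r5.bits) ||
  checkCols r0 r1 r2 r3 r4 r5 (gridBits r0.bits r1.bits r2.bits r3.bits r4.bits r5.bits)

end PairPaths
end PolytopePaths

namespace PolytopePaths

set_option maxRecDepth 100000 in
theorem check_0000 : check 0 0 0 0 = true := by decide +kernel

set_option maxRecDepth 100000 in
theorem check_0001 : check 0 0 0 1 = true := by decide +kernel

set_option maxRecDepth 100000 in
theorem check_0011 : check 0 0 1 1 = true := by decide +kernel

set_option maxRecDepth 100000 in
theorem check_0012 : check 0 0 1 2 = true := by decide +kernel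

set_option maxRecDepth 100000 in
theorem check_0123 : check 0 1 2 3 = true := by decide +kernel

end PolytopePaths

/-! ### Soundness of the search for grids -/

namespace PolytopePaths

section GridContradiction

/-- What is known about the rows of the grid `G` of the vertices between a minimum and a maximum
that have no constraint in common. The index `p : Fin 4` stands for the neighbour of the minimum
that gives up the constraint `p` in exchange for `j p`, and `X p a k` for an upward edge from this
neighbour to the entry of row `a` and column `k`. -/
structure RowFacts (j : Fin 4 → Fin 4) (G : Fin 6 → Fin 6 → Bool)
    (X : Fin 4 → Fin 6 → Fin 6 → Prop) : Prop where
  /-- Row `a` is a path. -/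
  path : ∀ a, IsPathSet (j (pairFst a)) (j (pairSnd a)) (G a)
  /-- One of the two neighbours of the minimum in row `a`, namely the lower one, ascends inside the
  row, unless both have received the same label. -/
  one_end : ∀ a, j (pairFst a) ≠ j (pairSnd a) →
    (∃ k, j (pairFst a) ∈ pairSet k ∧ G a k = true ∧ X (pairFst a) a k) ∨
    (∃ k, j (pairSnd a) ∈ pairSet k ∧ G a k = true ∧ X (pairSnd a) a k)
  /-- In some row both neighbours of the minimum ascend. -/
  both_ends : ∃ a, j (pairFst a) ≠ j (pairSnd a) ∧
    (∃ k, j (pairFst a) ∈ pairSet k ∧ G a k = true ∧ X (pairFst a) a k) ∧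
    (∃ k, j (pairSnd a) ∈ pairSet k ∧ G a k = true ∧ X (pairSnd a) a k)
  /-- A neighbour of the minimum does not ascend to an entry whose column has just one other entry,
  if that other entry is adjacent to the same neighbour. -/
  not_of_pair : ∀ p a a' k, a' ≠ a → p ∈ pairSet a → p ∈ pairSet a' → G a k = true →
    G a' k = true → (∀ a'', G a'' k = true → a'' = a ∨ a'' = a') → j p ∈ pairSet k → ¬ X p a k

/-- Every binary digit `1` of `m` is at the place of an entry to which some upward edge `X` leads.
-/
def MarksOnly (X : Fin 4 → Fin 6 → Fin 6 → Prop) (m : ℕ) : Prop :=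
  ∀ n, m.testBit n = true → ∃ p, ∃ a k : Fin 6, n = 6 * k + (5 - a) ∧ X p a k

theorem MarksOnly.or {X : Fin 4 → Fin 6 → Fin 6 → Prop} {m m' : ℕ} (h : MarksOnly X m)
    (h' : MarksOnly X m') : MarksOnly X (m ||| m') := by
  intro n hn
  rw [Nat.testBit_or, Bool.or_eq_true] at hn
  exact hn.elim (h n) (h' n)

theorem marksOnly_two_pow {X : Fin 4 → Fin 6 → Fin 6 → Prop} {p : Fin 4} {a k : Fin 6}
    (h : X p a k) : MarksOnly X (2 ^ (6 * (k : ℕ) + (5 - a))) := by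
  intro n hn
  rw [Nat.testBit_two_pow] at hn
  exact ⟨p, a, k, (by simpa using hn : _ = n).symm, h⟩

/-- If each list offers a choice of places that are really marked, and one of them marks both ends
of its row, then `search` fails. -/
theorem search_eq_false {X : Fin 4 → Fin 6 → Fin 6 → Prop} {E : List (Bool × ℕ × Bool × ℕ)}
    (h1 : ∀ m, MarksOnly X m → colsOK m E = true) (h2 : ∀ m, MarksOnly X m → colsBoth m E = true)
    (L : List (List (ℕ × Bool))) (hL : ∀ l ∈ L, ∃ c ∈ l, MarksOnly X c.1) (m : ℕ)
    (hm : MarksOnly X m) (b : Bool)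
    (hb : b = true ∨ ∃ l ∈ L, ∃ c ∈ l, c.2 = true ∧ MarksOnly X c.1) : search E L m b = false := by
  induction L generalizing m b with
  | nil =>
    obtain rfl : b = true := by simpa using hb
    simp [search, h2 m hm]
  | cons l L ih =>
    have hc : ∃ c ∈ l, MarksOnly X c.1 ∧ ((b || c.2) = true ∨
        ∃ l ∈ L, ∃ c ∈ l, c.2 = true ∧ MarksOnly X c.1) := by
      obtain ⟨c, hc1, hc2⟩ := hL l (by simp)
      rcases hb with rfl | ⟨l', hl', c', hc', hc'2, hc'3⟩
      · exact ⟨c, hc1, hc2, .inl rfl⟩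
      · rcases List.mem_cons.1 hl' with rfl | hl'
        · exact ⟨c', hc', hc'3, .inl (by simp [hc'2])⟩
        · exact ⟨c, hc1, hc2, .inr ⟨l', hl', c', hc', hc'2, hc'3⟩⟩
    obtain ⟨c, hc1, hc2, hc3⟩ := hc
    have := ih (fun l' hl' => hL l' (by simp [hl'])) (m ||| c.1) (hm.or hc2) (b || c.2) hc3
    rw [search, List.all_eq_false]
    exact ⟨c, hc1, by simp [h1 _ (hm.or hc2), this]⟩

variable {j i : Fin 4 → Fin 4} {G : Fin 6 → Fin 6 → Bool} {X Y : Fin 4 → Fin 6 → Fin 6 → Prop}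

theorem Encodes.len_eq_zero {h : ℕ} {e f : Fin 4} {g : Fin 6 → Bool} {o : PathCode}
    (ho : Encodes h e f g o) (hg : IsPathSet e f g) : o.len = 0 ↔ e = f := by
  constructor
  · intro h0
    by_contra hne
    obtain ⟨⟨k, -, hk⟩, -⟩ := ho.2.2 hne
    have h1 := ((hk k).1 rfl).1
    rw [ho.2.1] at h0
    have := (Finset.sum_eq_zero_iff.1 h0) k (Finset.mem_univ _)
    simp [h1] at this
  · rintro rfl
    rw [ho.2.1]
    simp [hg.2 rfl]

theorem rowChoices_spec {M : ℕ}
    (hM : ∀ n, M.testBit n = true ↔ ∃ a k : Fin 6, n = 6 * k + (5 - a) ∧ G a k = true)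
    (hG : RowFacts j G X) {a b c b' c' : Fin 6} {o : PathCode}
    (ho : Encodes 6 (j (pairFst a)) (j (pairSnd a)) (G a) o)
    (hb : b ≠ a ∧ c ≠ a ∧ pairFst a ∈ pairSet b ∧ pairFst a ∈ pairSet c)
    (hb' : b' ≠ a ∧ c' ≠ a ∧ pairSnd a ∈ pairSet b' ∧ pairSnd a ∈ pairSet c') :
    (∃ x ∈ rowChoices M a b c b' c' o, MarksOnly X x.1) ∧
    (j (pairFst a) ≠ j (pairSnd a) →
      (∃ k, j (pairFst a) ∈ pairSet k ∧ G a k = true ∧ X (pairFst a) a k) →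
      (∃ k, j (pairSnd a) ∈ pairSet k ∧ G a k = true ∧ X (pairSnd a) a k) →
      ∃ x ∈ rowChoices M a b c b' c' o, x.2 = true ∧ MarksOnly X x.1) := by
  by_cases hj : j (pairFst a) = j (pairSnd a)
  · refine ⟨⟨(0, false), ?_, fun n hn => by simp at hn⟩, fun h => absurd hj h⟩
    simp [rowChoices, (ho.len_eq_zero (hG.path a)).2 hj]
  have hlen : Nat.beq o.len 0 = false := by
    rw [← Bool.not_eq_true, Nat.beq_eq]
    exact fun h => hj ((ho.len_eq_zero (hG.path a)).1 h)
  obtain ⟨⟨k1, hk1, hk1'⟩, ⟨k2, hk2, hk2'⟩⟩ := ho.2.2 hj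
  have H1 : (∃ k, j (pairFst a) ∈ pairSet k ∧ G a k = true ∧ X (pairFst a) a k) →
      colPair M a b c o.fst = false ∧ MarksOnly X (2 ^ (6 * o.fst + (5 - (a : ℕ)))) := by
    rintro ⟨k, h1, h2, h3⟩
    obtain rfl := (hk1' k).2 ⟨h2, h1⟩
    rw [← hk1]
    refine ⟨?_, marksOnly_two_pow h3⟩
    by_contra hcon
    obtain ⟨a', ha', h5, h6, h7⟩ := colPair_iff hM hb.1 hb.2.1 (by simpa using hcon)
    exact hG.not_of_pair (pairFst a) a a' k (by rcases ha' with rfl | rfl; exacts [hb.1, hb.2.1])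
      (by simp [pairSet]) (by rcases ha' with rfl | rfl; exacts [hb.2.2.1, hb.2.2.2]) h5 h6 h7 h1 h3
  have H2 : (∃ k, j (pairSnd a) ∈ pairSet k ∧ G a k = true ∧ X (pairSnd a) a k) →
      colPair M a b' c' o.lst = false ∧ MarksOnly X (2 ^ (6 * o.lst + (5 - (a : ℕ)))) := by
    rintro ⟨k, h1, h2, h3⟩
    obtain rfl := (hk2' k).2 ⟨h2, h1⟩
    rw [← hk2]
    refine ⟨?_, marksOnly_two_pow h3⟩
    by_contra hcon
    obtain ⟨a', ha', h5, h6, h7⟩ := colPair_iff hM hb'.1 hb'.2.1 (by simpa using hcon)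
    exact hG.not_of_pair (pairSnd a) a a' k (by rcases ha' with rfl | rfl; exacts [hb'.1, hb'.2.1])
      (by simp [pairSet]) (by rcases ha' with rfl | rfl; exacts [hb'.2.2.1, hb'.2.2.2]) h5 h6 h7
      h1 h3
  refine ⟨?_, fun _ h1 h2 => ?_⟩
  · rcases hG.one_end a hj with h | h
    · obtain ⟨h3, h4⟩ := H1 h
      exact ⟨(2 ^ (6 * o.fst + (5 - a)), false), by simp [rowChoices, hlen, h3], h4⟩
    · obtain ⟨h3, h4⟩ := H2 h
      exact ⟨(2 ^ (6 * o.lst + (5 - a)), false), by simp [rowChoices, hlen, h3], h4⟩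
  · obtain ⟨h3, h4⟩ := H1 h1
    obtain ⟨h5, h6⟩ := H2 h2
    exact ⟨(2 ^ (6 * o.fst + (5 - a)) ||| 2 ^ (6 * o.lst + (5 - a)), true),
      by simp [rowChoices, hlen, h3, h5], rfl, h4.or h6⟩

theorem colEnds_spec {M : ℕ}
    (hM : ∀ n, M.testBit n = true ↔ ∃ a k : Fin 6, n = 6 * k + (5 - a) ∧ G a k = true)
    (hG : RowFacts i (fun k a => G a.rev k.rev) Y)
    (hXY : ∀ p a k q, X p a k → Y q k.rev a.rev → False)
    {k b c b' c' : Fin 6} {o : PathCode}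
    (ho : Encodes 1 (i (pairFst k.rev)) (i (pairSnd k.rev)) (fun m => G m.rev k) o)
    (hb : b ≠ k ∧ c ≠ k ∧ pairFst k.rev ∈ pairSet b.rev ∧ pairFst k.rev ∈ pairSet c.rev)
    (hb' : b' ≠ k ∧ c' ≠ k ∧ pairSnd k.rev ∈ pairSet b'.rev ∧ pairSnd k.rev ∈ pairSet c'.rev)
    {m : ℕ} (hm : MarksOnly X m) :
    colsOK m (colEnds M k b c b' c' o) = true ∧
    (i (pairFst k.rev) ≠ i (pairSnd k.rev) →
      (∃ a, i (pairFst k.rev) ∈ pairSet a ∧ G a.rev k = true ∧ Y (pairFst k.rev) k.rev a) →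
      (∃ a, i (pairSnd k.rev) ∈ pairSet a ∧ G a.rev k = true ∧ Y (pairSnd k.rev) k.rev a) →
      colsBoth m (colEnds M k b c b' c' o) = true) := by
  have hpath := hG.path k.rev
  simp only [Fin.rev_rev] at hpath
  by_cases hj : i (pairFst k.rev) = i (pairSnd k.rev)
  · refine ⟨?_, fun h => absurd hj h⟩
    simp [colsOK, colEnds, (ho.len_eq_zero hpath).2 hj]
  have hlen : Nat.beq o.len 0 = false := by
    rw [← Bool.not_eq_true, Nat.beq_eq]
    exact fun h => hj ((ho.len_eq_zero hpath).1 h)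
  obtain ⟨⟨k1, hk1, hk1'⟩, ⟨k2, hk2, hk2'⟩⟩ := ho.2.2 hj
  have hfree : ∀ (q : Fin 4) (a : Fin 6), Y q k.rev a →
      Nat.beq ((m >>> (6 * (k : ℕ) + a)) % 2) 0 = true := by
    intro q a hY
    rw [Nat.beq_eq]
    by_contra hne
    obtain ⟨p, a', k', h1, h2⟩ := hm (6 * (k : ℕ) + a) (by
      rw [Nat.testBit_eq_decide_div_mod_eq, ← Nat.shiftRight_eq_div_pow]
      simp only [decide_eq_true_eq]
      have : (m >>> (6 * (k : ℕ) + a)) % 2 ≠ 0 := hne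
      omega)
    have h3 : k' = k := by ext; omega
    have h4 : a = a'.rev := by ext; rw [Fin.val_rev]; omega
    subst h3 h4
    exact hXY p a' k' q h2 hY
  have H : ∀ (q : Fin 4) (b c : Fin 6), b ≠ k → c ≠ k → q ∈ pairSet k.rev → q ∈ pairSet b.rev →
      q ∈ pairSet c.rev → ∀ a, i q ∈ pairSet a → G a.rev k = true → Y q k.rev a →
      endFree m (rowPair M k b c a) (6 * k + a) = true := by
    intro q b c hbk hck hqk hqb hqc a h1 h2 h3
    simp only [endFree, Bool.and_eq_true, Bool.not_eq_true']
    refine ⟨?_, hfree q a h3⟩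
    by_contra hcon
    have ha : (a : ℕ) = 5 - (a.rev : Fin 6) := by rw [Fin.val_rev]; omega
    rw [ha] at hcon
    obtain ⟨k', hk', h5, h6, h7⟩ := rowPair_iff (a := a.rev) hM hbk hck
      (by rwa [Bool.not_eq_false] at hcon)
    refine hG.not_of_pair q k.rev k'.rev a ?_ hqk ?_ ?_ ?_ ?_ h1 h3
    · rcases hk' with rfl | rfl <;> simpa using by assumption
    · rcases hk' with rfl | rfl <;> assumption
    · simpa using h5
    · simpa using h6
    · intro k'' hk''
      rcases h7 k''.rev hk'' with h | h
      · left; rw [← h, Fin.rev_rev]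
      · right; rw [← h, Fin.rev_rev]
  have H1 : (∃ a, i (pairFst k.rev) ∈ pairSet a ∧ G a.rev k = true ∧ Y (pairFst k.rev) k.rev a) →
      endFree m (rowPair M k b c o.fst) (6 * k + o.fst) = true := by
    rintro ⟨a, h1, h2, h3⟩
    obtain rfl := (hk1' a).2 ⟨h2, h1⟩
    rw [← hk1]
    exact H _ b c hb.1 hb.2.1 (by simp [pairSet]) hb.2.2.1 hb.2.2.2 a h1 h2 h3
  have H2 : (∃ a, i (pairSnd k.rev) ∈ pairSet a ∧ G a.rev k = true ∧ Y (pairSnd k.rev) k.rev a) →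
      endFree m (rowPair M k b' c' o.lst) (6 * k + o.lst) = true := by
    rintro ⟨a, h1, h2, h3⟩
    obtain rfl := (hk2' a).2 ⟨h2, h1⟩
    rw [← hk2]
    exact H _ b' c' hb'.1 hb'.2.1 (by simp [pairSet]) hb'.2.2.1 hb'.2.2.2 a h1 h2 h3
  refine ⟨?_, fun _ h1 h2 => ?_⟩
  · have := hG.one_end k.rev hj
    simp only [Fin.rev_rev] at this
    rcases this with h | h
    · simp [colsOK, colEnds, hlen, H1 h]
    · simp [colsOK, colEnds, hlen, H2 h]
  · simp [colsBoth, colEnds, hlen, H1 h1, H2 h2]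

theorem colsOK_append (m : ℕ) (E F : List (Bool × ℕ × Bool × ℕ)) :
    colsOK m (E ++ F) = (colsOK m E && colsOK m F) := List.all_append

theorem colsBoth_append (m : ℕ) (E F : List (Bool × ℕ × Bool × ℕ)) :
    colsBoth m (E ++ F) = (colsBoth m E || colsBoth m F) := List.any_append

theorem searchGrid_eq_false {M : ℕ}
    (hM : ∀ n, M.testBit n = true ↔ ∃ a k : Fin 6, n = 6 * k + (5 - a) ∧ G a k = true)
    (hG : RowFacts j G X) (hG' : RowFacts i (fun k a => G a.rev k.rev) Y)
    (hXY : ∀ p a k q, X p a k → Y q k.rev a.rev → False) {r c : Fin 6 → PathCode}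
    (hr : ∀ a, Encodes 6 (j (pairFst a)) (j (pairSnd a)) (G a) (r a))
    (hc : ∀ k, Encodes 1 (i (pairFst k)) (i (pairSnd k)) (fun m => G m.rev k.rev) (c k)) :
    searchGrid (r 0) (r 1) (r 2) (r 3) (r 4) (r 5) (c 0) (c 1) (c 2) (c 3) (c 4) (c 5) M =
      false := by
  have R0 := rowChoices_spec (a := 0) (b := 1) (c := 2) (b' := 3) (c' := 4) hM hG (hr 0)
    (by decide) (by decide)
  have R1 := rowChoices_spec (a := 1) (b := 0) (c := 2) (b' := 3) (c' := 5) hM hG (hr 1)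
    (by decide) (by decide)
  have R2 := rowChoices_spec (a := 2) (b := 0) (c := 1) (b' := 4) (c' := 5) hM hG (hr 2)
    (by decide) (by decide)
  have R3 := rowChoices_spec (a := 3) (b := 0) (c := 4) (b' := 1) (c' := 5) hM hG (hr 3)
    (by decide) (by decide)
  have R4 := rowChoices_spec (a := 4) (b := 0) (c := 3) (b' := 2) (c' := 5) hM hG (hr 4)
    (by decide) (by decide)
  have R5 := rowChoices_spec (a := 5) (b := 1) (c := 3) (b' := 2) (c' := 4) hM hG (hr 5)
    (by decide) (by decide)
  have C0 := fun m (hm : MarksOnly X m) => colEnds_spec (k := 5) (b := 4) (c := 3) (b' := 2)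
    (c' := 1) hM hG' hXY (hc 0) (by decide) (by decide) hm
  have C1 := fun m (hm : MarksOnly X m) => colEnds_spec (k := 4) (b := 5) (c := 3) (b' := 2)
    (c' := 0) hM hG' hXY (hc 1) (by decide) (by decide) hm
  have C2 := fun m (hm : MarksOnly X m) => colEnds_spec (k := 3) (b := 5) (c := 4) (b' := 1)
    (c' := 0) hM hG' hXY (hc 2) (by decide) (by decide) hm
  have C3 := fun m (hm : MarksOnly X m) => colEnds_spec (k := 2) (b := 5) (c := 1) (b' := 4)
    (c' := 0) hM hG' hXY (hc 3) (by decide) (by decide) hm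
  have C4 := fun m (hm : MarksOnly X m) => colEnds_spec (k := 1) (b := 5) (c := 2) (b' := 3)
    (c' := 0) hM hG' hXY (hc 4) (by decide) (by decide) hm
  have C5 := fun m (hm : MarksOnly X m) => colEnds_spec (k := 0) (b := 4) (c := 2) (b' := 3)
    (c' := 1) hM hG' hXY (hc 5) (by decide) (by decide) hm
  refine search_eq_false (X := X) (fun m hm => ?_) (fun m hm => ?_) _ ?_ 0
    (fun n hn => by simp at hn) false (.inr ?_)
  · simp only [colsOK_append, Bool.and_eq_true]
    exact ⟨⟨⟨⟨⟨(C0 m hm).1, (C1 m hm).1⟩, (C2 m hm).1⟩, (C3 m hm).1⟩, (C4 m hm).1⟩, (C5 m hm).1⟩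
  · simp only [colsBoth_append, Bool.or_eq_true]
    obtain ⟨k, h1, h2, h3⟩ := hG'.both_ends
    fin_cases k
    · exact .inl (.inl (.inl (.inl (.inl ((C0 m hm).2 h1 h2 h3)))))
    · exact .inl (.inl (.inl (.inl (.inr ((C1 m hm).2 h1 h2 h3)))))
    · exact .inl (.inl (.inl (.inr ((C2 m hm).2 h1 h2 h3))))
    · exact .inl (.inl (.inr ((C3 m hm).2 h1 h2 h3)))
    · exact .inl (.inr ((C4 m hm).2 h1 h2 h3))
    · exact .inr ((C5 m hm).2 h1 h2 h3)
  · simp only [List.mem_cons, List.not_mem_nil, or_false, forall_eq_or_imp, forall_eq]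
    exact ⟨R0.1, R1.1, R2.1, R3.1, R4.1, R5.1⟩
  · simp only [List.mem_cons, List.not_mem_nil, or_false, exists_eq_or_imp, exists_eq_left]
    obtain ⟨k, h1, h2, h3⟩ := hG.both_ends
    fin_cases k
    · exact .inl (R0.2 h1 h2 h3)
    · exact .inr (.inl (R1.2 h1 h2 h3))
    · exact .inr (.inr (.inl (R2.2 h1 h2 h3)))
    · exact .inr (.inr (.inr (.inl (R3.2 h1 h2 h3))))
    · exact .inr (.inr (.inr (.inr (.inl (R4.2 h1 h2 h3)))))
    · exact .inr (.inr (.inr (.inr (.inr (R5.2 h1 h2 h3)))))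

/-- A grid with the properties `RowFacts` for its rows and for its columns, in which no entry is at
the same time the upper end of an upward edge `X` and the lower end of an upward edge `Y`, is found
by the exhaustive search. -/
theorem check_eq_false (hG : RowFacts j G X) (hG' : RowFacts i (fun k a => G a.rev k.rev) Y)
    (hXY : ∀ p a k q, X p a k → Y q k.rev a.rev → False)
    (hcount : ∀ d, (∑ a, if d ∈ pairSet a then 0 else ∑ k, if G a k = true then 1 else 0) +
      ∑ b, (if i b = d then 1 else 0) ≤ 6) : check (j 0) (j 1) (j 2) (j 3) = false := by
  choose r hr1 hr using fun a => exists_code (b := 6) (.inr rfl) (hG.path a)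
  choose c hc1 hc using fun k => exists_code (b := 1) (.inl rfl) (hG'.path k)
  have hM := testBit_gridBits (r := fun a => (r a).bits) (fun a n => (hr a).testBit (.inr rfl) n)
  have hcol : ∀ k : Fin 6, (c k).bits = gridCol (gridBits (r 0).bits (r 1).bits (r 2).bits
      (r 3).bits (r 4).bits (r 5).bits) (k.rev : Fin 6) := by
    intro k
    apply Nat.eq_of_testBit_eq
    intro n
    rw [Bool.eq_iff_iff, testBit_gridCol hM, (hc k).testBit (.inl rfl)]
    constructor
    · rintro ⟨a, h1, h2⟩
      exact ⟨a.rev, by rw [Fin.val_rev]; omega, h2⟩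
    · rintro ⟨a, h1, h2⟩
      exact ⟨a.rev, by rw [Fin.val_rev]; omega, by simpa using h2⟩
  have hs := searchGrid_eq_false hM hG hG' hXY hr hc
  generalize hMM : gridBits (r 0).bits (r 1).bits (r 2).bits (r 3).bits (r 4).bits (r 5).bits = M
    at *
  have hv : validGrid M = true := by
    have : ∀ k : Fin 6, Nat.beq ((codeBits >>> gridCol M (k.rev : Fin 6)) % 2) 1 = true :=
      fun k => by rw [← hcol]; exact codeBits_valid _ _ _ (hc1 k)
    simp only [validGrid, List.all_eq_true, List.mem_cons, List.not_mem_nil, or_false,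
      forall_eq_or_imp, forall_eq]
    exact ⟨this 5, this 4, this 3, this 2, this 1, this 0⟩
  have hl : ∀ a, (r a).len = ∑ k, if G a k = true then 1 else 0 := fun a => (hr a).2.1
  have hcount' : ∀ d, (∑ a, if d ∈ pairSet a then 0 else (r a).len) +
      (eqn (i 0) d + eqn (i 1) d + eqn (i 2) d + eqn (i 3) d) ≤ 6 := fun d => by
    have := hcount d
    simp only [← hl] at this
    rwa [Fin.sum_univ_four] at this
  have e : ∀ x : Fin 4, x ∈ [0, 1, 2, 3] := by decide
  by_contra hcon
  rw [Bool.not_eq_false] at hcon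
  have n3 := hcount' 3
  have n2 := hcount' 2
  have n1 := hcount' 1
  have n0 := hcount' 0
  rw [Fin.sum_univ_six] at n0 n1 n2 n3
  simp +decide only [if_true, if_false, add_zero, zero_add] at n0 n1 n2 n3
  have hblt : ∀ x, x ≤ 6 → Nat.blt 6 x = false := fun x hx => by
    rw [← Bool.not_eq_true, Nat.blt_eq]; omega
  have hbeq : ∀ k : Fin 6, Nat.beq (c k).bits (gridCol M (k.rev : Fin 6)) = true := fun k => by
    rw [Nat.beq_eq]; exact hcol k
  simp only [check, List.all_eq_true] at hcon
  have h := hcon (r 0) (hr1 0) (r 1) (hr1 1) (r 3) (hr1 3)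
  rw [hblt _ (by omega), Bool.false_or, List.all_eq_true] at h
  have h := h (r 2) (hr1 2)
  rw [List.all_eq_true] at h
  have h := h (r 4) (hr1 4)
  rw [hblt _ (by omega), Bool.false_or, List.all_eq_true] at h
  have h := h (r 5) (hr1 5)
  rw [hblt _ (by omega), hblt _ (by omega), hMM, hv, Bool.not_true, Bool.false_or, Bool.false_or,
    Bool.false_or] at h
  simp only [checkCols, List.all_eq_true] at h
  have h := h (i 0) (e _) (i 1) (e _) (c 0) (hc1 0)
  rw [show Nat.beq (c 0).bits (gridCol M 5) = true from hbeq 0, Bool.not_true, Bool.false_or,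
    List.all_eq_true] at h
  have h := h (i 2) (e _)
  rw [List.all_eq_true] at h
  have h := h (c 1) (hc1 1)
  rw [show Nat.beq (c 1).bits (gridCol M 4) = true from hbeq 1, Bool.not_true, Bool.false_or,
    List.all_eq_true] at h
  have h := h (c 3) (hc1 3)
  rw [show Nat.beq (c 3).bits (gridCol M 2) = true from hbeq 3, Bool.not_true, Bool.false_or,
    List.all_eq_true] at h
  have h := h (i 3) (e _)
  rw [List.all_eq_true] at h
  have h := h (c 2) (hc1 2)
  rw [show Nat.beq (c 2).bits (gridCol M 3) = true from hbeq 2, Bool.not_true, Bool.false_or,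
    List.all_eq_true] at h
  have h := h (c 4) (hc1 4)
  rw [show Nat.beq (c 4).bits (gridCol M 1) = true from hbeq 4, Bool.not_true, Bool.false_or,
    List.all_eq_true] at h
  have h := h (c 5) (hc1 5)
  rw [show Nat.beq (c 5).bits (gridCol M 0) = true from hbeq 5, Bool.not_true, hblt _ (by omega),
    hblt _ (by omega), hblt _ (by omega), hblt _ (by omega), hs] at h
  simp at h

end GridContradiction
end PolytopePaths

/-! ### The grid of the vertices between a disjoint minimum and maximum -/

namespace PolytopePaths
namespace AbstractObjective

section Adjacency

variable {ι : Type*} [DecidableEq ι] {d : ℕ}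

theorem exists_eq_insert_of_card_inter {B B' : Finset ι} (hB : B.card = d) (hB' : B'.card = d)
    (h : (B ∩ B').card + 1 = d) :
    ∃ C i k, C = B ∩ B' ∧ i ∉ C ∧ k ∉ C ∧ k ≠ i ∧ B = insert i C ∧ B' = insert k C := by
  have h1 : (B \ B').card = 1 := by
    have := Finset.card_sdiff_add_card_inter B B'; omega
  have h2 : (B' \ B).card = 1 := by
    have := Finset.card_sdiff_add_card_inter B' B; rw [Finset.inter_comm] at this; omega
  obtain ⟨i, hi⟩ := Finset.card_eq_one.1 h1
  obtain ⟨k, hk⟩ := Finset.card_eq_one.1 h2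
  have hi' : i ∈ B \ B' := by simp [hi]
  have hk' : k ∈ B' \ B := by simp [hk]
  rw [Finset.mem_sdiff] at hi' hk'
  refine ⟨B ∩ B', i, k, rfl, by simp [hi'], by simp [hk'], ?_, ?_, ?_⟩
  · rintro rfl; exact hi'.2 hk'.1
  · rw [Finset.insert_eq, ← hi, Finset.sdiff_union_inter]
  · rw [Finset.insert_eq, ← hk, Finset.inter_comm, Finset.sdiff_union_inter]

variable {S : AbstractObjective ι d}

theorem step_iff {B B' : Finset ι} :
    S.Step B B' ↔ S.feas B ∧ S.feas B' ∧ (B ∩ B').card + 1 = d ∧ S.val B < S.val B' := by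
  constructor
  · rintro ⟨C, i, k, h1, h2, h3, rfl, rfl, h6, h7, h8⟩
    refine ⟨h6, h7, ?_, h8⟩
    have := S.card_eq h6
    rw [Finset.card_insert_of_notMem h1] at this
    rw [Finset.insert_inter_of_notMem (by simp [h1, h3.symm]),
      Finset.inter_eq_left.2 (Finset.subset_insert _ _), this]
  · rintro ⟨h1, h2, h3, h4⟩
    obtain ⟨C, i, k, -, h5, h6, h7, h8, h9⟩ :=
      exists_eq_insert_of_card_inter (S.card_eq h1) (S.card_eq h2) h3
    exact ⟨C, i, k, h5, h6, h7, h8, h9, h1, h2, h4⟩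

theorem exists_step_ge {A B B' : Finset ι} (hA : A ⊆ B)
    (hA' : A ⊆ B') (hB : S.feas B) (hB' : S.feas B') (hlt : S.val B ≤ S.val B') (hne : B' ≠ B) :
    ∃ Q, A ⊆ Q ∧ S.Step B Q := by
  obtain ⟨C, i, k, h1, h2, h3, h4, h5, h6, h7⟩ := S.exists_step_of_lt hA hA' hB hB' hlt hne
  exact ⟨_, h1.trans (Finset.subset_insert _ _), C, i, k, h2, h3, h4, h5, rfl, hB, h6, h7⟩

/-- A set of `d - 1` labels lies in at most two feasible bases. -/
theorem eq_of_common_subset {C B B' B'' : Finset ι} (hC : C.card + 1 = d) (hB : S.feas B)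
    (hB' : S.feas B') (hB'' : S.feas B'') (h : C ⊆ B) (h' : C ⊆ B') (h'' : C ⊆ B'')
    (hne : B' ≠ B) (hne' : B'' ≠ B) : B' = B'' := by
  have key : ∀ {Q}, S.feas Q → C ⊆ Q → ∃ i, i ∉ C ∧ Q = insert i C := fun {Q} hQ hCQ => by
    obtain ⟨i, hi⟩ := Finset.card_eq_one.1 (show (Q \ C).card = 1 by
      rw [Finset.card_sdiff_of_subset hCQ, S.card_eq hQ]; omega)
    have : i ∈ Q \ C := by simp [hi]
    refine ⟨i, (Finset.mem_sdiff.1 this).2, ?_⟩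
    rw [Finset.insert_eq, ← hi, Finset.sdiff_union_of_subset hCQ]
  obtain ⟨i, hi, rfl⟩ := key hB h
  obtain ⟨k, hk, rfl⟩ := key hB' h'
  obtain ⟨l, hl, rfl⟩ := key hB'' h''
  rw [S.pivot_unique hi hk hl (by rintro rfl; exact hne rfl) (by rintro rfl; exact hne' rfl)
    hB hB' hB'']

/-- A set of labels has no or exactly two one-element extensions to a feasible basis. -/
theorem card_extensions [Fintype ι] (C : Finset ι) :
    (∑ i, open Classical in if i ∉ C ∧ S.feas (insert i C) then 1 else 0) ∈
      ({0, 2} : Finset ℕ) := by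
  classical
  rw [← Finset.card_filter]
  rcases Finset.eq_empty_or_nonempty
    (Finset.univ.filter fun i => i ∉ C ∧ S.feas (insert i C)) with h | ⟨i, hi⟩
  · simp [h]
  · have hi' := (Finset.mem_filter.1 hi).2
    obtain ⟨k, h1, h2, h3⟩ := S.exists_pivot hi'.1 hi'.2
    have : (Finset.univ.filter fun i => i ∉ C ∧ S.feas (insert i C)) = {i, k} := by
      ext l
      simp only [Finset.mem_filter, Finset.mem_univ, true_and, Finset.mem_insert,
        Finset.mem_singleton]
      constructor
      · rintro ⟨h4, h5⟩
        by_cases hli : l = i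
        · exact .inl hli
        · exact .inr (S.pivot_unique hi'.1 h4 h1 hli h2 hi'.2 h5 h3)
      · rintro (rfl | rfl)
        exacts [hi', ⟨h1, h3⟩]
    rw [this, Finset.card_pair h2.symm]
    simp

end Adjacency

section Grid

open Finset

theorem disjSum_inter_disjSum {α β : Type*} [DecidableEq α] [DecidableEq β] (X X' : Finset α)
    (Y Y' : Finset β) : X.disjSum Y ∩ X'.disjSum Y' = (X ∩ X').disjSum (Y ∩ Y') := by
  ext (a | b) <;> simp

/-- A four-dimensional program with eight constraints, the first four of them active at the minimum
and the last four at the maximum, that has no directed path of four edges from the minimum to the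
maximum. The neighbours of the minimum replace a constraint `p` by `j p`, those of the maximum
replace a constraint `b` by `i b`. -/
structure Opposite (S : AbstractObjective (Fin 4 ⊕ Fin 4) 4) (j i : Fin 4 → Fin 4) : Prop where
  isMin : S.IsMin (univ.disjSum ∅)
  isMax : S.IsMax ((∅ : Finset (Fin 4)).disjSum univ)
  feas_low : ∀ p, S.feas ((univ.erase p).disjSum {j p})
  feas_high : ∀ b, S.feas (({i b} : Finset (Fin 4)).disjSum (univ.erase b))
  not_reach : ¬ S.Reach 4 (univ.disjSum ∅) ((∅ : Finset (Fin 4)).disjSum univ)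

/-- The neighbour of the minimum across the edge that releases `p`. -/
def low (j : Fin 4 → Fin 4) (p : Fin 4) : Finset (Fin 4 ⊕ Fin 4) := (univ.erase p).disjSum {j p}

/-- The neighbour of the maximum across the edge that releases `b`. -/
def high (i : Fin 4 → Fin 4) (b : Fin 4) : Finset (Fin 4 ⊕ Fin 4) :=
  ({i b} : Finset (Fin 4)).disjSum (univ.erase b)

/-- The sets of two constraints of the minimum and two of the maximum: all but those of the pair
`a`, and those of the pair `k`. -/
def mid (a k : Fin 6) : Finset (Fin 4 ⊕ Fin 4) := (pairSet a)ᶜ.disjSum (pairSet k)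

open Classical in
/-- The grid of the feasible bases that share two labels with the minimum and two with the maximum.
-/
noncomputable def grid (S : AbstractObjective (Fin 4 ⊕ Fin 4) 4) (a k : Fin 6) : Bool :=
  decide (S.feas (mid a k))

theorem grid_eq_true {S : AbstractObjective (Fin 4 ⊕ Fin 4) 4} {a k : Fin 6} :
    S.grid a k = true ↔ S.feas (mid a k) := by
  classical
  exact decide_eq_true_iff

set_option maxRecDepth 100000 in
theorem row_cases_aux : ∀ (a : Fin 6) (p q : Fin 4), p ≠ q → pairSet a = {p, q} →
    ∀ X Y : Finset (Fin 4), (pairSet a)ᶜ ⊆ X → X.card + Y.card = 4 →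
    (X = univ ∧ Y = ∅) ∨ (∃ y, X = univ.erase p ∧ Y = {y}) ∨ (∃ y, X = univ.erase q ∧ Y = {y}) ∨
      ∃ k, X = (pairSet a)ᶜ ∧ Y = pairSet k := by
  decide +kernel

set_option maxRecDepth 100000 in
theorem low_cases_aux : ∀ (p c : Fin 4) (X Y : Finset (Fin 4)), X.card + Y.card = 4 →
    (univ.erase p ∩ X).card + ({c} ∩ Y).card + 1 = 4 →
    (X = univ ∧ Y = ∅) ∨ (X = univ.erase p ∧ ∃ y, Y = {y} ∧ y ≠ c) ∨
      (Y = {c} ∧ ∃ q, q ≠ p ∧ X = univ.erase q) ∨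
      (∃ a, p ∈ pairSet a ∧ X = (pairSet a)ᶜ) ∧ ∃ k, c ∈ pairSet k ∧ Y = pairSet k := by
  decide +kernel

set_option maxRecDepth 100000 in
theorem col_cases_aux : ∀ (k : Fin 6) (X Y : Finset (Fin 4)), pairSet k ⊆ Y →
    X.card + Y.card = 4 →
    (X = ∅ ∧ Y = univ) ∨ (∃ b x, X = {x} ∧ Y = univ.erase b) ∨
      ∃ a, X = (pairSet a)ᶜ ∧ Y = pairSet k := by
  decide +kernel

/-- The index of the pair `{c, y}`. -/
def pairOf (c y : Fin 4) : Fin 6 :=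
  if c.val + y.val = 1 then 0 else if c.val + y.val = 2 then 1 else if c.val + y.val = 3 then
    (if c = 0 ∨ y = 0 then 2 else 3) else if c.val + y.val = 4 then 4 else 5

theorem card_pairSet_compl (a : Fin 6) : (pairSet a)ᶜ.card = 2 := by revert a; decide

theorem card_pairSet (a : Fin 6) : (pairSet a).card = 2 := by revert a; decide

theorem pairSet_injective : Function.Injective pairSet := by decide

theorem pairSet_compl (a : Fin 6) : (pairSet a)ᶜ = pairSet a.rev := by revert a; decide

theorem low_inter_mid {j : Fin 4 → Fin 4} {p : Fin 4} {a k : Fin 6} (hp : p ∈ pairSet a) :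
    (low j p ∩ mid a k).card = 2 + if j p ∈ pairSet k then 1 else 0 := by
  rw [low, mid, disjSum_inter_disjSum, card_disjSum]
  congr 1
  · revert p a; decide
  · split_ifs with h <;> simp [h]

variable {S : AbstractObjective (Fin 4 ⊕ Fin 4) 4} {j i : Fin 4 → Fin 4}

theorem low_subset {a : Fin 6} {p : Fin 4} (hp : p ∈ pairSet a) :
    (pairSet a)ᶜ.disjSum ∅ ⊆ low j p := by
  refine disjSum_mono (fun x hx => ?_) (empty_subset _)
  rw [mem_erase]
  refine ⟨?_, mem_univ _⟩
  rintro rfl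
  exact (mem_compl.1 hx) hp

theorem mid_subset (a k : Fin 6) : (pairSet a)ᶜ.disjSum ∅ ⊆ mid a k :=
  disjSum_mono le_rfl (empty_subset _)

theorem low_ne {p q : Fin 4} (hpq : p ≠ q) : low j p ≠ low j q := by
  intro h
  have := congrArg Finset.toLeft h
  simp only [low, toLeft_disjSum] at this
  have h1 : q ∈ univ.erase p := by simp [hpq.symm]
  rw [this] at h1
  simp at h1

theorem card_erase_inter_erase : ∀ p q : Fin 4, p ≠ q → (univ.erase p ∩ univ.erase q).card = 2 := by
  decide

namespace Opposite

variable (h : S.Opposite j i)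
include h

theorem low_feas (p : Fin 4) : S.feas (low j p) := h.feas_low p
theorem high_feas (b : Fin 4) : S.feas (high i b) := h.feas_high b

theorem eq_low {p y : Fin 4} (hy : S.feas ((univ.erase p).disjSum {y})) : y = j p := by
  have h1 := S.eq_of_common_subset (C := (univ.erase p).disjSum ∅) (by simp) h.isMin.1 hy
    (h.feas_low p) (disjSum_mono (subset_univ _) le_rfl)
    (disjSum_mono le_rfl (empty_subset _))
    (disjSum_mono le_rfl (empty_subset _))
    (fun h => by simpa [-disjSum_empty, -empty_disjSum] using congrArg Finset.toRight h)
    (fun h => by simpa [-disjSum_empty, -empty_disjSum] using congrArg Finset.toRight h)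
  simpa [-disjSum_empty, -empty_disjSum] using congrArg Finset.toRight h1

theorem eq_high {b x : Fin 4} (hx : S.feas (({x} : Finset (Fin 4)).disjSum (univ.erase b))) :
    x = i b := by
  have h1 := S.eq_of_common_subset (C := (∅ : Finset (Fin 4)).disjSum (univ.erase b)) (by simp)
    h.isMax.1 hx (h.feas_high b) (disjSum_mono le_rfl (subset_univ _))
    (disjSum_mono (empty_subset _) le_rfl)
    (disjSum_mono (empty_subset _) le_rfl)
    (fun h => by simpa [-disjSum_empty, -empty_disjSum] using congrArg Finset.toLeft h)
    (fun h => by simpa [-disjSum_empty, -empty_disjSum] using congrArg Finset.toLeft h)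
  simpa [-disjSum_empty, -empty_disjSum] using congrArg Finset.toLeft h1

theorem step_low (p : Fin 4) : S.Step (univ.disjSum ∅) (low j p) := by
  rw [step_iff]
  refine ⟨h.isMin.1, h.low_feas p, ?_, h.isMin.2 _ (h.low_feas p) fun h => ?_⟩
  · rw [low, disjSum_inter_disjSum, card_disjSum]; simp
  · simpa [low, -disjSum_empty, -empty_disjSum] using congrArg Finset.toRight h

theorem step_high (b : Fin 4) : S.Step (high i b) ((∅ : Finset (Fin 4)).disjSum univ) := by
  rw [step_iff]
  refine ⟨h.high_feas b, h.isMax.1, ?_, h.isMax.2 _ (h.high_feas b) fun h => ?_⟩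
  · rw [high, disjSum_inter_disjSum, card_disjSum]; simp
  · simpa [high, -disjSum_empty, -empty_disjSum] using congrArg Finset.toLeft h

theorem not_two_steps {p a k b} (h1 : S.Step (low j p) (mid a k))
    (h2 : S.Step (mid a k) (high i b)) :
    False :=
  h.not_reach ⟨_, h.step_low p, _, h1, _, h2, _, h.step_high b, rfl⟩

/-- The vertices of the polygon of the two constraints of the minimum outside the pair `a`. -/
theorem row_cases {a : Fin 6} {p q : Fin 4} (hpq : p ≠ q) (ha : pairSet a = {p, q})
    {B : Finset (Fin 4 ⊕ Fin 4)} (hB : S.feas B) (hB' : (pairSet a)ᶜ.disjSum ∅ ⊆ B) :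
    B = univ.disjSum ∅ ∨ B = low j p ∨ B = low j q ∨ ∃ k, B = mid a k := by
  have h1 := S.card_eq hB
  rw [← toLeft_disjSum_toRight (u := B), card_disjSum] at h1
  rw [← toLeft_disjSum_toRight (u := B)] at hB' hB ⊢
  rcases row_cases_aux a p q hpq ha _ _
      (by simpa [-disjSum_empty, -empty_disjSum] using toLeft_monotone hB') h1 with
    ⟨h2, h3⟩ | ⟨y, h2, h3⟩ | ⟨y, h2, h3⟩ | ⟨k, h2, h3⟩
  · rw [h2, h3]; exact .inl rfl
  · rw [h2, h3] at hB ⊢; rw [h.eq_low hB]; exact .inr (.inl rfl)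
  · rw [h2, h3] at hB ⊢; rw [h.eq_low hB]; exact .inr (.inr (.inl rfl))
  · rw [h2, h3]; exact .inr (.inr (.inr ⟨k, rfl⟩))

/-- The vertices of the polygon of the two constraints of the maximum in the pair `k`. -/
theorem col_cases {k : Fin 6} {B : Finset (Fin 4 ⊕ Fin 4)} (hB : S.feas B)
    (hB' : (∅ : Finset (Fin 4)).disjSum (pairSet k) ⊆ B) :
    B = (∅ : Finset (Fin 4)).disjSum univ ∨ (∃ b, B = high i b) ∨ ∃ a, B = mid a k := by
  have h1 := S.card_eq hB
  rw [← toLeft_disjSum_toRight (u := B), card_disjSum] at h1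
  rw [← toLeft_disjSum_toRight (u := B)] at hB' hB ⊢
  rcases col_cases_aux k _ _
      (by simpa [-disjSum_empty, -empty_disjSum] using toRight_monotone hB') h1 with
    ⟨h2, h3⟩ | ⟨b, x, h2, h3⟩ | ⟨a, h2, h3⟩
  · rw [h2, h3]; exact .inl rfl
  · rw [h2, h3] at hB ⊢; rw [h.eq_high hB]; exact .inr (.inl ⟨b, rfl⟩)
  · rw [h2, h3]; exact .inr (.inr ⟨a, rfl⟩)

/-- The lower of two neighbours of the source climbs inside their common polygon. -/
theorem exists_step_mid {a : Fin 6} {p q : Fin 4} (hpq : p ≠ q) (ha : pairSet a = {p, q})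
    (hj : j p ≠ j q) (hle : S.val (low j p) ≤ S.val (low j q)) :
    ∃ k, j p ∈ pairSet k ∧ S.grid a k = true ∧ S.Step (low j p) (mid a k) := by
  have hp : p ∈ pairSet a := by simp [ha]
  have hq : q ∈ pairSet a := by simp [ha]
  obtain ⟨Q, hQ, hstep⟩ := S.exists_step_ge (low_subset hp) (low_subset hq) (h.low_feas p)
    (h.low_feas q) hle (low_ne hpq.symm)
  rcases h.row_cases hpq ha hstep.feas_right hQ with rfl | rfl | rfl | ⟨k, rfl⟩
  · exact absurd hstep.lt (h.step_low p).lt.not_gt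
  · exact absurd hstep.lt (lt_irrefl _)
  · have h1 := (step_iff.1 hstep).2.2.1
    rw [low, low, disjSum_inter_disjSum, card_disjSum,
      singleton_inter_of_notMem (by simpa using hj)] at h1
    rw [card_erase_inter_erase p q hpq] at h1
    simp at h1
  · refine ⟨k, ?_, grid_eq_true.2 hstep.feas_right, hstep⟩
    by_contra hk
    have h1 := (step_iff.1 hstep).2.2.1
    rw [low_inter_mid hp, if_neg hk] at h1
    omega

/-- If two neighbours of the minimum have received the same label, their polygon is the triangle
that they form with the minimum: a vertex of the polygon outside this triangle would have no edge
to it. -/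
theorem grid_eq_false_of_le {a : Fin 6} {p q : Fin 4} (hpq : p ≠ q) (ha : pairSet a = {p, q})
    (hj : j p = j q) (hle : S.val (low j q) ≤ S.val (low j p)) (k : Fin 6) :
    S.grid a k = false := by
  by_contra hk
  rw [Bool.not_eq_false, grid_eq_true] at hk
  have hp : p ∈ pairSet a := by simp [ha]
  have hq : q ∈ pairSet a := by simp [ha]
  -- no feasible entry of the row contains the common label
  have hno : ∀ k, S.feas (mid a k) → j p ∉ pairSet k := fun k hk hjk => by
    have := S.eq_of_common_subset (C := (pairSet a)ᶜ.disjSum {j p})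
      (by rw [card_disjSum, card_pairSet_compl]; rfl) hk
      (h.low_feas p) (h.low_feas q) (disjSum_mono le_rfl (by simpa using hjk)) ?_ ?_ ?_ ?_
    · exact low_ne hpq this
    · have := low_subset (j := j) hp
      exact disjSum_mono
        (by simpa [low, -disjSum_empty, -empty_disjSum] using toLeft_monotone this) le_rfl
    · have := low_subset (j := j) hq
      exact disjSum_mono
        (by simpa [low, -disjSum_empty, -empty_disjSum] using toLeft_monotone this) (by rw [hj])
    · intro h1
      simpa [low, mid, card_pairSet, -disjSum_empty, -empty_disjSum] using
        congrArg (fun s => s.toRight.card) h1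
    · intro h1
      simpa [low, mid, card_pairSet, -disjSum_empty, -empty_disjSum] using
        congrArg (fun s => s.toRight.card) h1
  have hfin : {k | S.feas (mid a k)}.Finite := Set.toFinite _
  obtain ⟨m, hm, hmax⟩ := hfin.exists_maximalFor (fun k => S.val (mid a k)) _ ⟨k, hk⟩
  have hlow_ne : ∀ p', mid a m ≠ low j p' := fun p' h1 => by
    simpa [low, mid, card_pairSet, -disjSum_empty, -empty_disjSum] using
      congrArg (fun s => s.toRight.card) h1
  have hstep_no : ∀ p' k', p' ∈ pairSet a → j p' = j p → S.feas (mid a k') →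
      (low j p' ∩ mid a k').card + 1 ≠ 4 := fun p' k' hp' hjp' hk' h1 => by
    rw [low_inter_mid hp', if_neg (by rw [hjp']; exact hno k' hk')] at h1
    omega
  rcases le_total (S.val (mid a m)) (S.val (low j p)) with hle' | hle'
  · obtain ⟨Q, hQ, hstep⟩ := S.exists_step_ge (mid_subset a m) (low_subset hp) hm
      (h.low_feas p) hle' (hlow_ne p).symm
    rcases h.row_cases hpq ha hstep.feas_right hQ with rfl | rfl | rfl | ⟨k', rfl⟩
    · refine absurd hstep.lt (h.isMin.2 _ hm fun h1 => ?_).not_gt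
      simpa [mid, card_pairSet, -disjSum_empty, -empty_disjSum] using
        congrArg (fun s => s.toRight.card) h1
    · exact hstep_no p m hp rfl hm (by rw [inter_comm]; exact (step_iff.1 hstep).2.2.1)
    · exact hstep_no q m hq hj.symm hm (by rw [inter_comm]; exact (step_iff.1 hstep).2.2.1)
    · exact absurd (hmax hstep.feas_right hstep.lt.le) hstep.lt.not_ge
  · obtain ⟨Q, hQ, hstep⟩ := S.exists_step_ge (low_subset hp) (mid_subset a m) (h.low_feas p)
      hm hle' (hlow_ne p)
    rcases h.row_cases hpq ha hstep.feas_right hQ with rfl | rfl | rfl | ⟨k', rfl⟩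
    · exact absurd hstep.lt (h.step_low p).lt.not_gt
    · exact absurd hstep.lt (lt_irrefl _)
    · exact absurd hstep.lt hle.not_gt
    · exact hstep_no p k' hp rfl hstep.feas_right (step_iff.1 hstep).2.2.1

theorem grid_eq_false {a : Fin 6} {p q : Fin 4} (hpq : p ≠ q) (ha : pairSet a = {p, q})
    (hj : j p = j q) (k : Fin 6) : S.grid a k = false := by
  rcases le_total (S.val (low j q)) (S.val (low j p)) with hle | hle
  · exact h.grid_eq_false_of_le hpq ha hj hle k
  · exact h.grid_eq_false_of_le hpq.symm (by rw [ha, pair_comm]) hj.symm hle k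

/-- The entries of row `a` are the vertices, other than the minimum and its two neighbours, of a
polygon. Its sides other than the two at the minimum are constraints of the maximum, and each of
these contains two of its vertices or none. -/
theorem path (a : Fin 6) : IsPathSet (j (pairFst a)) (j (pairSnd a)) (S.grid a) := by
  have hpq : pairFst a ≠ pairSnd a := by revert a; decide
  refine ⟨fun c => ?_, fun hj k => h.grid_eq_false hpq rfl hj k⟩
  have h1 := S.card_extensions ((pairSet a)ᶜ.disjSum {c})
  convert h1 using 1
  rw [Fintype.sum_sum_type]
  have e1 : ∀ x : Fin 4, insert (Sum.inl x) ((pairSet a)ᶜ.disjSum {c}) =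
      (insert x (pairSet a)ᶜ).disjSum ({c} : Finset (Fin 4)) := fun x => by
    ext (y | y) <;> simp
  have e2 : ∀ x : Fin 4, insert (Sum.inr x) ((pairSet a)ᶜ.disjSum {c}) =
      (pairSet a)ᶜ.disjSum ({c, x} : Finset (Fin 4)) := fun x => by
    ext (y | y) <;> simp [or_comm]
  have e3 : ∀ (a : Fin 6) (p q : Fin 4), p ≠ q → pairSet a = {p, q} →
      insert p (pairSet a)ᶜ = univ.erase q := by decide
  have e4 : ∀ p q : Fin 4, p ≠ q → pairSet a = {p, q} →
      (S.feas ((insert p (pairSet a)ᶜ).disjSum {c}) ↔ c = j q) := fun p q hpq ha => by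
    rw [e3 a p q hpq ha]
    exact ⟨fun h1 => h.eq_low h1, fun h1 => by rw [h1]; exact h.low_feas q⟩
  have e5 := e4 _ _ hpq rfl
  have e6 := e4 _ _ hpq.symm (pair_comm _ _)
  have e7 : ∀ x, (x ∈ pairSet a ∧ S.feas ((insert x (pairSet a)ᶜ).disjSum {c})) ↔
      (x = pairFst a ∧ c = j (pairSnd a)) ∨ (x = pairSnd a ∧ c = j (pairFst a)) := fun x => by
    constructor
    · rintro ⟨h1, h2⟩
      simp only [pairSet, mem_insert, mem_singleton] at h1
      rcases h1 with rfl | rfl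
      · exact .inl ⟨rfl, e5.1 h2⟩
      · exact .inr ⟨rfl, e6.1 h2⟩
    · rintro (⟨rfl, h1⟩ | ⟨rfl, h1⟩)
      · exact ⟨by simp [pairSet], e5.2 h1⟩
      · exact ⟨by simp [pairSet], e6.2 h1⟩
  -- the half-edges at `j (pairFst a)` and `j (pairSnd a)` are the two neighbours of the minimum
  have L : ∀ (a : Fin 6) (P Q : Prop) [Decidable P] [Decidable Q],
      (∑ x, if (x = pairFst a ∧ Q) ∨ (x = pairSnd a ∧ P) then 1 else 0) =
      ((if P then 1 else 0) + if Q then 1 else 0 : ℕ) := fun a P Q _ _ => by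
    by_cases hP : P <;> by_cases hQ : Q <;> simp only [hP, hQ, and_true, and_false, or_false,
      false_or, if_true, if_false] <;> revert a <;> decide
  have R : ∀ (φ : Finset (Fin 4) → Prop) [DecidablePred φ],
      (∑ k, if c ∈ pairSet k ∧ φ (pairSet k) then 1 else 0) =
        ∑ y, if y ≠ c ∧ φ {c, y} then 1 else 0 := fun φ _ => by
    have q : ∀ c y, y ≠ c → ({c, y} : Finset (Fin 4)) = pairSet (pairOf c y) := by decide
    have q' : ∀ c k, (∃ y, y ≠ c ∧ pairOf c y = k) ↔ c ∈ pairSet k := by decide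
    have q'' : ∀ c y y', y ≠ c → y' ≠ c → pairOf c y = pairOf c y' → y = y' := by decide
    rw [← card_filter, ← card_filter]
    symm
    refine card_bij (fun y _ => pairOf c y) ?_ ?_ ?_
    · intro y hy
      obtain ⟨h1, h2⟩ := (mem_filter.1 hy).2
      exact mem_filter.2 ⟨mem_univ _, (q' c _).1 ⟨y, h1, rfl⟩, by rwa [← q c y h1]⟩
    · intro y hy y' hy'
      exact q'' c y y' (mem_filter.1 hy).2.1 (mem_filter.1 hy').2.1
    · intro k hk
      obtain ⟨h1, h2⟩ := (mem_filter.1 hk).2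
      obtain ⟨y, hy, rfl⟩ := (q' c k).2 h1
      exact ⟨y, mem_filter.2 ⟨mem_univ _, hy, by rwa [q c y hy]⟩, rfl⟩
  classical
  refine congrArg₂ (· + ·) ?_ ?_
  · rw [← L a (c = j (pairFst a)) (c = j (pairSnd a))]
    refine sum_congr rfl fun x _ => if_congr ?_ rfl rfl
    rw [← e7, e1, inl_mem_disjSum, mem_compl, not_not]
  · refine Eq.trans ?_ ((R (fun Y => S.feas ((pairSet a)ᶜ.disjSum Y))).trans ?_)
    · exact sum_congr rfl fun k _ => if_congr (and_congr_right fun _ => grid_eq_true) rfl rfl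
    · refine sum_congr rfl fun x _ => if_congr ?_ rfl rfl
      rw [e2, inr_mem_disjSum, mem_singleton]

end Opposite

end Grid

end AbstractObjective
end PolytopePaths

/-! ### Short paths in four-dimensional programs with eight constraints -/

namespace PolytopePaths
namespace AbstractObjective

section GridFacts

open Finset

variable {S : AbstractObjective (Fin 4 ⊕ Fin 4) 4} {j i : Fin 4 → Fin 4}

theorem low_ne_isMax (p : Fin 4) : low j p ≠ (∅ : Finset (Fin 4)).disjSum univ := fun h => by
  simpa [low, -disjSum_empty, -empty_disjSum] using congrArg (fun s => s.toRight.card) h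

theorem mid_ne_isMax (a k : Fin 6) : mid a k ≠ (∅ : Finset (Fin 4)).disjSum univ := fun h => by
  simpa [mid, card_pairSet, -disjSum_empty, -empty_disjSum] using
    congrArg (fun s => s.toRight.card) h

namespace Opposite

/-- The highest neighbour of the minimum, from `p` say, ascends to an entry of a row; the other
neighbour of the minimum in this row is lower, and ascends inside the row as well. -/
theorem exists_both_ends (h : S.Opposite j i) : ∃ p q a, p ≠ q ∧ pairSet a = {p, q} ∧ j p ≠ j q ∧
    (∃ k, j p ∈ pairSet k ∧ S.grid a k = true ∧ S.Step (low j p) (mid a k)) ∧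
    (∃ k, j q ∈ pairSet k ∧ S.grid a k = true ∧ S.Step (low j q) (mid a k)) := by
  obtain ⟨p, hp⟩ := Finite.exists_max fun p => S.val (low j p)
  obtain ⟨Q, hQ⟩ := h.isMax.exists_step (h.low_feas p) (low_ne_isMax p)
  have hf := hQ.feas_right
  have h1 := S.card_eq hf
  have h2 := (step_iff.1 hQ).2.2.1
  rw [← toLeft_disjSum_toRight (u := Q)] at hQ hf h1 h2
  rw [low, disjSum_inter_disjSum, card_disjSum] at h2
  rw [card_disjSum] at h1
  rcases low_cases_aux p (j p) _ _ h1 h2 with ⟨h3, h4⟩ | ⟨h3, y, h4, h5⟩ | ⟨h4, q, h5, h3⟩ |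
    ⟨⟨a, h5, h3⟩, k, h6, h4⟩ <;> rw [h3, h4] at hQ hf
  · exact absurd hQ.lt (h.step_low p).lt.not_gt
  · exact absurd (h.eq_low hf) h5
  · have := h.eq_low hf
    rw [this] at hQ
    exact absurd hQ.lt (hp q).not_gt
  · have : ∀ (a : Fin 6) (p : Fin 4), p ∈ pairSet a → ∃ q, p ≠ q ∧ pairSet a = {p, q} := by decide
    obtain ⟨q, hpq, ha⟩ := this a p h5
    have hj : j p ≠ j q := fun hj => by
      have := h.grid_eq_false hpq ha hj k
      rw [← Bool.not_eq_true, grid_eq_true] at this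
      exact this hf
    exact ⟨p, q, a, hpq, ha, hj, ⟨k, h6, grid_eq_true.2 hf, hQ⟩,
      h.exists_step_mid hpq.symm (by rw [ha, pair_comm]) hj.symm (hp q)⟩

/-- Let a column have only the entries `a` and `a'`, both adjacent to the neighbour `low j p` of
the minimum, which is lower than `a`. The higher one of the two entries ascends inside the polygon
of the column, hence to a neighbour of the maximum, and this completes a path of four edges. -/
theorem not_step_of_pair (h : S.Opposite j i) {p : Fin 4} {a a' k : Fin 6} (hne : a' ≠ a)
    (hp : p ∈ pairSet a) (hp' : p ∈ pairSet a') (ha : S.grid a k = true) (ha' : S.grid a' k = true)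
    (honly : ∀ a'', S.grid a'' k = true → a'' = a ∨ a'' = a') (hj : j p ∈ pairSet k)
    (hstep : S.Step (low j p) (mid a k)) : False := by
  rw [grid_eq_true] at ha ha'
  obtain ⟨c, hc, hpc, hval, hmax⟩ : ∃ c, (c = a ∨ c = a') ∧ p ∈ pairSet c ∧
      S.val (mid a k) ≤ S.val (mid c k) ∧
      ∀ a'', S.grid a'' k = true → S.val (mid a'' k) ≤ S.val (mid c k) := by
    rcases le_total (S.val (mid a k)) (S.val (mid a' k)) with hle | hle
    · exact ⟨a', .inr rfl, hp', hle, fun a'' h1 => by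
        rcases honly a'' h1 with rfl | rfl <;> simp [hle]⟩
    · exact ⟨a, .inl rfl, hp, le_rfl, fun a'' h1 => by
        rcases honly a'' h1 with rfl | rfl <;> simp [hle]⟩
  have hcf : S.feas (mid c k) := by rcases hc with rfl | rfl <;> assumption
  have h1 : S.Step (low j p) (mid c k) := by
    rw [step_iff]
    exact ⟨h.low_feas p, hcf, by rw [low_inter_mid hpc, if_pos hj], hstep.lt.trans_le hval⟩
  obtain ⟨Q, hQ, h2⟩ := S.exists_step_ge (A := (∅ : Finset (Fin 4)).disjSum (pairSet k))
    (disjSum_mono (empty_subset _) le_rfl) (disjSum_mono (empty_subset _) (subset_univ _)) hcf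
    h.isMax.1 (h.isMax.2 _ hcf (mid_ne_isMax _ _)).le (mid_ne_isMax _ _).symm
  rcases h.col_cases h2.feas_right hQ with rfl | ⟨b, rfl⟩ | ⟨a'', rfl⟩
  · have h3 := (step_iff.1 h2).2.2.1
    rw [disjSum_inter_disjSum, card_disjSum, inter_univ, card_pairSet] at h3
    simp at h3
  · exact h.not_two_steps h1 h2
  · exact absurd h2.lt (hmax a'' (grid_eq_true.2 h2.feas_right)).not_gt

theorem rowFacts (h : S.Opposite j i) :
    RowFacts j S.grid fun p a k => S.Step (low j p) (mid a k) where
  path := h.path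
  one_end a hj := by
    have hpq : pairFst a ≠ pairSnd a := fun h => hj (congrArg j h)
    rcases le_total (S.val (low j (pairFst a))) (S.val (low j (pairSnd a))) with hle | hle
    · exact .inl (h.exists_step_mid hpq rfl hj hle)
    · exact .inr (h.exists_step_mid hpq.symm (pair_comm _ _) hj.symm hle)
  both_ends := by
    obtain ⟨p, q, a, hpq, ha, hj, h1, h2⟩ := h.exists_both_ends
    have : ∀ (a : Fin 6) (p q : Fin 4), p ≠ q → pairSet a = {p, q} →
        (p = pairFst a ∧ q = pairSnd a) ∨ (q = pairFst a ∧ p = pairSnd a) := by decide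
    rcases this a p q hpq ha with ⟨rfl, rfl⟩ | ⟨rfl, rfl⟩
    · exact ⟨a, hj, h1, h2⟩
    · exact ⟨a, hj.symm, h2, h1⟩
  not_of_pair p a a' k hne hp hp' ha ha' honly hj hstep :=
    h.not_step_of_pair hne hp hp' ha ha' honly hj hstep

end Opposite

/-- The program with the opposite objective, the minimum and the maximum exchanged. -/
def dual (S : AbstractObjective (Fin 4 ⊕ Fin 4) 4) : AbstractObjective (Fin 4 ⊕ Fin 4) 4 :=
  S.neg.comap (Equiv.sumComm _ _)

theorem map_sumComm_disjSum (X Y : Finset (Fin 4)) :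
    (X.disjSum Y).map (Equiv.sumComm (Fin 4) (Fin 4)).toEmbedding = Y.disjSum X := by
  ext (x | x) <;> simp

theorem dual_feas {X Y : Finset (Fin 4)} : S.dual.feas (X.disjSum Y) ↔ S.feas (Y.disjSum X) := by
  rw [← map_sumComm_disjSum X Y]; rfl

theorem dual_step {X Y X' Y' : Finset (Fin 4)} :
    S.dual.Step (X.disjSum Y) (X'.disjSum Y') ↔ S.Step (Y'.disjSum X') (Y.disjSum X) := by
  rw [step_iff, step_iff, dual_feas, dual_feas, disjSum_inter_disjSum, disjSum_inter_disjSum,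
    card_disjSum, card_disjSum]
  have : ∀ X Y : Finset (Fin 4), S.dual.val (X.disjSum Y) = - S.val (Y.disjSum X) := fun X Y => by
    rw [← map_sumComm_disjSum X Y]; rfl
  rw [this, this, neg_lt_neg_iff, inter_comm Y', inter_comm X', add_comm (X ∩ X').card]
  tauto

theorem dual_reach {n : ℕ} {X Y X' Y' : Finset (Fin 4)} :
    S.dual.Reach n (X.disjSum Y) (X'.disjSum Y') → S.Reach n (Y'.disjSum X') (Y.disjSum X) := by
  intro h
  induction n generalizing X Y with
  | zero =>
    have h : X.disjSum Y = X'.disjSum Y' := h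
    have h1 := congrArg Finset.toLeft h
    have h2 := congrArg Finset.toRight h
    simp only [toLeft_disjSum, toRight_disjSum] at h1 h2
    subst h1 h2; rfl
  | succ n ih =>
    obtain ⟨R, h1, h2⟩ := h
    rw [← toLeft_disjSum_toRight (u := R)] at h1 h2
    exact (ih h2).snoc (dual_step.1 h1)

theorem dual_grid (a k : Fin 6) : S.dual.grid k a = S.grid a.rev k.rev := by
  rw [Bool.eq_iff_iff, grid_eq_true, grid_eq_true, mid, mid, dual_feas, pairSet_compl,
    pairSet_compl,
    Fin.rev_rev]

theorem Opposite.dual (h : S.Opposite j i) : S.dual.Opposite i j where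
  isMin := h.isMax.neg.comap _ (map_sumComm_disjSum _ _)
  isMax := h.isMin.neg.comap _ (map_sumComm_disjSum _ _)
  feas_low b := dual_feas.2 (h.feas_high b)
  feas_high p := dual_feas.2 (h.feas_low p)
  not_reach h1 := h.not_reach (dual_reach h1)

theorem Opposite.rowFacts_dual (h : S.Opposite j i) :
    RowFacts i (fun k a => S.grid a.rev k.rev)
      fun b k a => S.Step (mid a.rev k.rev) (high i b) := by
  have e1 : (fun k a => S.grid a.rev k.rev) = S.dual.grid := by
    funext k a; exact (dual_grid a k).symm
  have e2 : (fun b k a => S.Step (mid a.rev k.rev) (high i b)) =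
      fun b k a => S.dual.Step (low i b) (mid k a) := by
    funext b k a
    simp only [mid, high, low, dual_step, pairSet_compl, Fin.rev_rev]
  rw [e1, e2]
  exact h.dual.rowFacts

/-- The facet of the constraint `d` of the minimum has at most ten vertices. Among them are the
minimum, three of its neighbours, the entries of the rows of the pairs without `d`, and the
neighbours `high i b` of the maximum with `i b = d`. -/
theorem Opposite.count (h : S.Opposite j i) (d : Fin 4) :
    (∑ a, if d ∈ pairSet a then 0 else ∑ k, if S.grid a k = true then 1 else 0) +
      ∑ b, (if i b = d then 1 else 0) ≤ 6 := by
  classical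
  obtain ⟨t, ht⟩ := (S.link (Sum.inl d)).exists_isMax (h.isMin.link (c := Sum.inl d) (by simp)).1
  have h10 := card_feas_le_ten (U := univ.erase (Sum.inl d))
    (fun B hB => fun x hx => mem_erase.2 ⟨by rintro rfl; exact hB.1 hx, mem_univ _⟩)
    (by simp) (h.isMin.link (c := Sum.inl d) (by simp)) ht
  let F1 : Finset (Finset (Fin 4 ⊕ Fin 4)) := {univ.disjSum ∅}
  let F2 := (univ.erase d).image (low j)
  let T := (univ : Finset (Fin 6 × Fin 6)).filter fun x => d ∉ pairSet x.1 ∧ S.grid x.1 x.2 = true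
  let F3 := T.image fun x => mid x.1 x.2
  let F4 := (univ.filter fun b => i b = d).image (high i)
  have c1 : ∀ B ∈ F1, B.toLeft.card = 4 := by simp [F1, -disjSum_empty, -empty_disjSum]
  have c2 : ∀ B ∈ F2, B.toLeft.card = 3 := by simp [F2, low]
  have c3 : ∀ B ∈ F3, B.toLeft.card = 2 := by
    intro B hB
    obtain ⟨x, -, rfl⟩ := mem_image.1 hB
    simp only [mid, toLeft_disjSum, card_pairSet_compl]
  have c4 : ∀ B ∈ F4, B.toLeft.card = 1 := by simp [F4, high]
  have d1 : Disjoint F1 F2 := disjoint_left.2 fun B h1 h2 => by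
    have := c1 B h1; have := c2 B h2; omega
  have d2 : Disjoint (F1 ∪ F2) F3 := disjoint_left.2 fun B h1 h2 => by
    have := c3 B h2
    rcases mem_union.1 h1 with h1 | h1
    · have := c1 B h1; omega
    · have := c2 B h1; omega
  have d3 : Disjoint (F1 ∪ F2 ∪ F3) F4 := disjoint_left.2 fun B h1 h2 => by
    have := c4 B h2
    rcases mem_union.1 h1 with h1 | h1
    · rcases mem_union.1 h1 with h1 | h1
      · have := c1 B h1; omega
      · have := c2 B h1; omega
    · have := c3 B h1; omega
  have n2 : F2.card = 3 := by
    rw [card_image_of_injOn]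
    · simp
    · intro p _ q _ hpq
      by_contra hne
      exact low_ne hne hpq
  have n3 : F3.card = ∑ a, if d ∈ pairSet a then 0 else ∑ k,
      if S.grid a k = true then 1 else 0 := by
    rw [card_image_of_injective]
    · rw [card_filter, Fintype.sum_prod_type]
      refine sum_congr rfl fun a _ => ?_
      split_ifs with hd
      · simp [hd]
      · simp [hd]
    · rintro ⟨a, k⟩ ⟨a', k'⟩ h1
      have h2 := congrArg Finset.toLeft h1
      have h3 := congrArg Finset.toRight h1
      simp only [mid, toLeft_disjSum, toRight_disjSum, compl_inj_iff] at h2 h3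
      rw [pairSet_injective h2, pairSet_injective h3]
  have n4 : F4.card = ∑ b, (if i b = d then 1 else 0) := by
    rw [card_image_of_injective, card_filter]
    intro b b' h1
    have h3 := congrArg Finset.toRight h1
    simp only [high, toRight_disjSum] at h3
    by_contra hne
    have : b' ∈ univ.erase b := by simp [Ne.symm hne]
    rw [h3] at this; simp at this
  have hF : ∀ B ∈ F1 ∪ F2 ∪ F3 ∪ F4, S.feas B ∧ Sum.inl d ∈ B := by
    intro B hB
    simp only [mem_union] at hB
    rcases hB with ((hB | hB) | hB) | hB
    · obtain rfl := mem_singleton.1 hB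
      exact ⟨h.isMin.1, by simp⟩
    · obtain ⟨p, hp, rfl⟩ := mem_image.1 hB
      exact ⟨h.low_feas p, by simpa [low, eq_comm] using hp⟩
    · obtain ⟨x, hx, rfl⟩ := mem_image.1 hB
      have hx := (mem_filter.1 hx).2
      exact ⟨grid_eq_true.1 hx.2, by simpa [mid] using hx.1⟩
    · obtain ⟨b, hb, rfl⟩ := mem_image.1 hB
      exact ⟨h.high_feas b, by simpa [high, eq_comm] using hb⟩
  have hle := h10 ((F1 ∪ F2 ∪ F3 ∪ F4).image fun B => B.erase (Sum.inl d)) (by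
    intro B hB
    obtain ⟨B', hB', rfl⟩ := mem_image.1 hB
    obtain ⟨h1, h2⟩ := hF B' hB'
    exact ⟨by simp, by rwa [insert_erase h2]⟩)
  have hinj : Set.InjOn (fun B : Finset (Fin 4 ⊕ Fin 4) => B.erase (Sum.inl d))
      (F1 ∪ F2 ∪ F3 ∪ F4 : Finset _) := by
    intro B hB B' hB' heq
    have heq : B.erase (Sum.inl d) = B'.erase (Sum.inl d) := heq
    have e1 := insert_erase (hF B hB).2
    have e2 := insert_erase (hF B' hB').2
    rw [← e1, heq, e2]
  rw [card_image_of_injOn hinj, card_union_of_disjoint d3, card_union_of_disjoint d2,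
    card_union_of_disjoint d1, n2, n3, n4, card_singleton] at hle
  omega

/-- No entry can be reached from a neighbour of the minimum and have an edge to a neighbour of the
maximum, so the grid is found by the exhaustive search. -/
theorem Opposite.not_check (h : S.Opposite j i) : check (j 0) (j 1) (j 2) (j 3) = false :=
  check_eq_false h.rowFacts h.rowFacts_dual
    (fun p a k q h1 h2 => h.not_two_steps h1 (by simpa using h2)) h.count

set_option maxRecDepth 100000 in
/-- Up to a permutation of the arguments, a map from `Fin 4` has one of five kernels, one for each
partition of the number four. -/
theorem exists_perm_eq_iff : ∀ j0 j1 j2 j3 : Fin 4, ∃ σ : Equiv.Perm (Fin 4),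
    ∃ c ∈ ([![0, 0, 0, 0], ![0, 0, 0, 1], ![0, 0, 1, 1], ![0, 0, 1, 2], ![0, 1, 2, 3]] :
      List (Fin 4 → Fin 4)),
    ∀ p q, ![j0, j1, j2, j3] (σ p) = ![j0, j1, j2, j3] (σ q) ↔ c p = c q := by
  decide +kernel

theorem exists_canonical (j : Fin 4 → Fin 4) : ∃ σ τ : Equiv.Perm (Fin 4), ∃ j' : Fin 4 → Fin 4,
    (∀ p, j (σ p) = τ (j' p)) ∧ check (j' 0) (j' 1) (j' 2) (j' 3) = true := by
  classical
  have hj : j = ![j 0, j 1, j 2, j 3] := by ext k; fin_cases k <;> rfl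
  obtain ⟨σ, c, hc, h⟩ := exists_perm_eq_iff (j 0) (j 1) (j 2) (j 3)
  rw [← hj] at h
  -- `c p ↦ j (σ p)` is a bijection of the ranges, and extends to a permutation
  choose r hr using fun x : {x // x ∈ Set.range c} => x.2
  choose r' hr' using fun x : {x // x ∈ Set.range (j ∘ σ)} => x.2
  let e : {x // x ∈ Set.range c} ≃ {x // x ∈ Set.range (j ∘ σ)} :=
    { toFun := fun x => ⟨j (σ (r x)), r x, rfl⟩
      invFun := fun x => ⟨c (r' x), r' x, rfl⟩
      left_inv := fun x => Subtype.ext (by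
        rw [← hr x]
        exact (h _ _).1 (hr' ⟨j (σ (r x)), r x, rfl⟩))
      right_inv := fun x => Subtype.ext (by
        rw [← hr' x]
        exact (h _ _).2 (hr ⟨c (r' x), r' x, rfl⟩)) }
  refine ⟨σ, e.extendSubtype, c, fun p => ?_, ?_⟩
  · rw [e.extendSubtype_apply_of_mem _ ⟨p, rfl⟩]
    exact ((h _ _).2 (hr ⟨c p, p, rfl⟩)).symm
  · simp only [List.mem_cons, List.not_mem_nil, or_false] at hc
    rcases hc with rfl | rfl | rfl | rfl | rfl
    exacts [check_0000, check_0001, check_0011, check_0012, check_0123]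

/-- Relabelling the constraints of the minimum and those of the maximum. -/
theorem Opposite.comap (h : S.Opposite j i) (σ τ : Equiv.Perm (Fin 4)) {j' i' : Fin 4 → Fin 4}
    (hj : ∀ p, j (σ p) = τ (j' p)) (hi : ∀ b, i (τ b) = σ (i' b)) :
    (AbstractObjective.comap S (Equiv.sumCongr σ τ)).Opposite j' i' := by
  have key : ∀ X Y : Finset (Fin 4), (X.disjSum Y).map (Equiv.sumCongr σ τ).toEmbedding =
      (X.map σ.toEmbedding).disjSum (Y.map τ.toEmbedding) := fun X Y => by
    ext (x | x) <;> simp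
  have huniv : ∀ ρ : Equiv.Perm (Fin 4), univ.map ρ.toEmbedding = univ := fun ρ => by simp
  refine ⟨h.isMin.comap _ ?_, h.isMax.comap _ ?_, fun p => ?_, fun b => ?_, fun h1 => ?_⟩
  · rw [key, huniv, map_empty]
  · rw [key, huniv, map_empty]
  · change S.feas (map _ _)
    rw [key, map_erase, huniv, map_singleton]
    have := h.low_feas (σ p)
    rw [low, hj] at this
    exact this
  · change S.feas (map _ _)
    rw [key, map_erase, huniv, map_singleton]
    have := h.high_feas (τ b)
    rw [high, hi] at this
    exact this
  · have := h1.of_comap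
    rw [key, key, huniv, huniv, map_empty, map_empty] at this
    exact h.not_reach this

theorem not_opposite (h : S.Opposite j i) : False := by
  obtain ⟨σ, τ, j', hj, hc⟩ := exists_canonical j
  have := (h.comap σ τ (i' := fun b => σ.symm (i (τ b))) hj (by simp)).not_check
  rw [hc] at this
  exact Bool.noConfusion this

end GridFacts

section ShortPaths

variable {ι : Type*} [DecidableEq ι]

theorem reach_four_of_opposite {S : AbstractObjective (Fin 4 ⊕ Fin 4) 4}
    (hs : S.IsMin (Finset.univ.disjSum ∅))
    (ht : S.IsMax ((∅ : Finset (Fin 4)).disjSum Finset.univ)) :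
    S.Reach 4 (Finset.univ.disjSum ∅) ((∅ : Finset (Fin 4)).disjSum Finset.univ) := by
  by_contra hcon
  have h1 : ∀ p, ∃ y, S.feas ((Finset.univ.erase p).disjSum {y}) := fun p => by
    obtain ⟨k, hk, h⟩ := hs.exists_nbr (i := Sum.inl p) (by simp)
    rcases k with k | y
    · simp at hk
    · refine ⟨y, ?_⟩
      convert h.feas_right
      ext (a | a) <;> simp
  have h2 : ∀ b, ∃ x, S.feas (({x} : Finset (Fin 4)).disjSum (Finset.univ.erase b)) := fun b => by
    obtain ⟨k, hk, h⟩ := ht.exists_nbr (i := Sum.inr b) (by simp)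
    rcases k with x | k
    · refine ⟨x, ?_⟩
      convert h.feas_left
      ext (a | a) <;> simp
    · simp at hk
  choose j hj using h1
  choose i hi using h2
  exact not_opposite (j := j) (i := i) ⟨hs, ht, hj, hi, hcon⟩

theorem exists_reach_of_rank_four_of_disjoint [Fintype ι] (hcard : Fintype.card ι ≤ 8)
    {S : AbstractObjective ι 4} {s t : Finset ι} (hs : S.IsMin s) (ht : S.IsMax t)
    (hst : Disjoint s t) : ∃ n ≤ 4, S.Reach n s t := by
  classical
  have hsc := S.card_eq hs.1
  have htc := S.card_eq ht.1
  have hu : s ∪ t = Finset.univ := by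
    apply Finset.eq_univ_of_card
    have := Finset.card_le_univ (s ∪ t)
    rw [Finset.card_union_of_disjoint hst] at this ⊢
    omega
  let es := s.equivFinOfCardEq hsc
  let et := t.equivFinOfCardEq htc
  let f : Fin 4 ⊕ Fin 4 → ι := Sum.elim (fun p => (es.symm p : ι)) (fun p => (et.symm p : ι))
  have hf : Function.Bijective f := by
    constructor
    · rintro (a | a) (b | b) hab
      · have : es.symm a = es.symm b := Subtype.ext hab
        simpa using this
      · exact absurd (es.symm a).2 (fun h => Finset.disjoint_left.1 hst h
          (by have : (es.symm a : ι) = et.symm b := hab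
              rw [this]; exact (et.symm b).2))
      · exact absurd (es.symm b).2 (fun h => Finset.disjoint_left.1 hst h
          (by have : (et.symm a : ι) = es.symm b := hab
              rw [← this]; exact (et.symm a).2))
      · have : et.symm a = et.symm b := Subtype.ext hab
        simpa using this
    · intro x
      have : x ∈ s ∪ t := by rw [hu]; simp
      rcases Finset.mem_union.1 this with h | h
      · exact ⟨Sum.inl (es ⟨x, h⟩), by simp [f]⟩
      · exact ⟨Sum.inr (et ⟨x, h⟩), by simp [f]⟩
  let e : Fin 4 ⊕ Fin 4 ≃ ι := Equiv.ofBijective f hf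
  have h1 : (Finset.univ.disjSum ∅).map e.toEmbedding = s := by
    apply Finset.eq_of_subset_of_card_le
    · intro x hx
      obtain ⟨a | a, ha, rfl⟩ := Finset.mem_map.1 hx
      · exact (es.symm a).2
      · simp at ha
    · simp [hsc]
  have h2 : ((∅ : Finset (Fin 4)).disjSum Finset.univ).map e.toEmbedding = t := by
    apply Finset.eq_of_subset_of_card_le
    · intro x hx
      obtain ⟨a | a, ha, rfl⟩ := Finset.mem_map.1 hx
      · simp at ha
      · exact (et.symm a).2
    · simp [htc]
  have := (reach_four_of_opposite (hs.comap e h1) (ht.comap e h2)).of_comap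
  rw [h1, h2] at this
  exact ⟨4, le_rfl, this⟩

theorem subset_erase_of_link {d : ℕ} {S : AbstractObjective ι (d + 1)} {U : Finset ι}
    (hU : ∀ B, S.feas B → B ⊆ U) (c : ι) (B : Finset ι) (hB : (S.link c).feas B) :
    B ⊆ U.erase c := fun x hx => Finset.mem_erase.2
  ⟨by rintro rfl; exact hB.1 hx, hU _ hB.2 (Finset.mem_insert_of_mem hx)⟩

theorem exists_reach_of_link {d : ℕ} {S : AbstractObjective ι (d + 1)} {s t : Finset ι} {c : ι}
    (hcs : c ∈ s) (hct : c ∈ t)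
    (h : ∃ n ≤ 4, (S.link c).Reach n (s.erase c) (t.erase c)) : ∃ n ≤ 4, S.Reach n s t := by
  obtain ⟨n, hn, h⟩ := h
  have := h.of_link
  rw [Finset.insert_erase hcs, Finset.insert_erase hct] at this
  exact ⟨n, hn, this⟩

/-- In a four-dimensional program with at most eight constraints there is a directed path of at
most four edges from the minimum to the maximum. As long as they have a constraint `c` in common,
the program can be replaced by the one on the facet of `c`, which has one dimension and one
constraint less. -/
theorem exists_reach_le_four [Fintype ι] (hcard : Fintype.card ι ≤ 8)
    {S : AbstractObjective ι 4} {s t : Finset ι} (hs : S.IsMin s) (ht : S.IsMax t) :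
    ∃ n ≤ 4, S.Reach n s t := by
  by_cases hst : Disjoint s t
  · exact exists_reach_of_rank_four_of_disjoint hcard hs ht hst
  obtain ⟨c, hcs, hct⟩ := Finset.not_disjoint_iff.1 hst
  refine exists_reach_of_link hcs hct ?_
  have hs := hs.link hcs
  have ht := ht.link hct
  have hU := subset_erase_of_link (S := S) (fun B _ => Finset.subset_univ B) c
  have hcard : (Finset.univ.erase c).card ≤ 7 := by
    rw [Finset.card_erase_of_mem (Finset.mem_univ c), Finset.card_univ]; omega
  generalize S.link c = S, s.erase c = s, t.erase c = t, Finset.univ.erase c = U at *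
  clear! c
  by_cases hst : Disjoint s t
  · exact exists_reach_of_rank_three hU hcard hs ht hst
  obtain ⟨c, hcs, hct⟩ := Finset.not_disjoint_iff.1 hst
  refine exists_reach_of_link hcs hct ?_
  have hcard : (U.erase c).card ≤ 6 := by
    rw [Finset.card_erase_of_mem (hU s hs.1 hcs)]; omega
  have hs := hs.link hcs
  have ht := ht.link hct
  have hU := subset_erase_of_link hU c
  generalize S.link c = S, s.erase c = s, t.erase c = t, U.erase c = U at *
  clear! c
  by_cases hst : Disjoint s t
  · exact exists_reach_of_rank_two hU hcard hs ht hst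
  obtain ⟨c, hcs, hct⟩ := Finset.not_disjoint_iff.1 hst
  refine exists_reach_of_link hcs hct ?_
  have hs := hs.link hcs
  have ht := ht.link hct
  by_cases hst : Disjoint (s.erase c) (t.erase c)
  · exact ⟨1, by norm_num, reach_one_of_rank_one hs ht hst⟩
  obtain ⟨a, has, hat⟩ := Finset.not_disjoint_iff.1 hst
  refine exists_reach_of_link has hat ⟨0, by norm_num, ?_⟩
  have h1 := Finset.card_eq_zero.1 ((link (link S c) a).card_eq (hs.link has).1)
  have h2 := Finset.card_eq_zero.1 ((link (link S c) a).card_eq (ht.link hat).1)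
  exact h1.trans h2.symm

end ShortPaths

end AbstractObjective
end PolytopePaths

/-! ### Simple linear programs -/

namespace PolytopePaths

section Polyhedra

open Module

variable {W ι : Type*} [AddCommGroup W] [Module ℝ W]

/-- The polyhedron given by the inequalities `0 ≤ a i x + b i`. -/
def polyhedron (a : ι → Dual ℝ W) (b : ι → ℝ) : Set W := {x | ∀ i, 0 ≤ a i x + b i}

/-- A point of the polyhedron that is determined by its active constraints, that is, a vertex. -/
def IsBasic (a : ι → Dual ℝ W) (b : ι → ℝ) (x : W) : Prop :=
  x ∈ polyhedron a b ∧ ∀ u, (∀ i, a i x + b i = 0 → a i u = 0) → u = 0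

/-- The linear forms `a` are nonnegative in no direction, so that their polyhedra are bounded. -/
def NoRay (a : ι → Dual ℝ W) : Prop := ∀ u, (∀ i, 0 ≤ a i u) → u = 0

variable {a : ι → Dual ℝ W} {b : ι → ℝ}

/-- Moving along `u` until a constraint that decreases along `u` becomes active. -/
theorem exists_move [Finite ι] {x u : W} (hx : x ∈ polyhedron a b) (hu : ∃ i, a i u < 0) :
    ∃ τ : ℝ, 0 ≤ τ ∧ x + τ • u ∈ polyhedron a b ∧
      ∃ k, a k u < 0 ∧ a k (x + τ • u) + b k = 0 := by
  have hfin : {i | a i u < 0}.Finite := Set.toFinite _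
  obtain ⟨k, hk, hmin⟩ := hfin.exists_minimalFor (fun i => (a i x + b i) / -(a i u)) _ hu
  have hk : a k u < 0 := hk
  have hτ : 0 ≤ (a k x + b k) / -(a k u) := div_nonneg (hx k) (by linarith)
  refine ⟨(a k x + b k) / -(a k u), hτ, fun i => ?_, k, hk, ?_⟩
  · rw [map_add, map_smul, smul_eq_mul]
    have h0 := hx i
    by_cases hi : a i u < 0
    · have h1 : (a k x + b k) / -(a k u) ≤ (a i x + b i) / -(a i u) := by
        by_contra! h
        exact h.not_ge (hmin hi h.le)
      rw [le_div_iff₀ (by linarith)] at h1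
      linarith
    · have := mul_nonneg hτ (not_lt.1 hi)
      linarith
  · rw [map_add, map_smul, smul_eq_mul]
    have : (a k x + b k) / -(a k u) * a k u = -(a k x + b k) := by
      rw [div_neg, neg_mul, div_mul_cancel₀ _ hk.ne]
    rw [this]; ring

/-- Every point can be moved to a basic one without increasing a given functional. -/
theorem exists_isBasic [Finite ι] (ha : NoRay a) (g : Dual ℝ W) {x : W}
    (hx : x ∈ polyhedron a b) : ∃ q, IsBasic a b q ∧ g q ≤ g x := by
  -- induction on the number of inactive constraints: move within the active ones until a new one
  -- is hit
  obtain ⟨n, hn⟩ : ∃ n, {i | a i x + b i ≠ 0}.ncard = n := ⟨_, rfl⟩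
  induction n using Nat.strong_induction_on generalizing x with
  | _ n ih =>
    by_cases hb : IsBasic a b x
    · exact ⟨x, hb, le_rfl⟩
    simp only [IsBasic, hx, true_and, not_forall] at hb
    obtain ⟨v, hv, hv0⟩ := hb
    obtain ⟨u, hu, hu0, hgu⟩ : ∃ u, (∀ i, a i x + b i = 0 → a i u = 0) ∧ u ≠ 0 ∧ g u ≤ 0 := by
      rcases le_total (g v) 0 with h | h
      · exact ⟨v, hv, hv0, h⟩
      · exact ⟨-v, fun i hi => by simp [hv i hi], by simpa using hv0, by simpa using h⟩
    have hex : ∃ i, a i u < 0 := by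
      by_contra! h
      exact hu0 (ha u h)
    obtain ⟨τ, hτ, hmem, k, hk, hk'⟩ := exists_move hx hex
    have hlt : {i | a i (x + τ • u) + b i ≠ 0}.ncard < n := by
      rw [← hn]
      refine Set.ncard_lt_ncard ⟨fun i hi h0 => hi ?_, fun hsub => ?_⟩ (Set.toFinite _)
      · rw [map_add, map_smul, hu i h0, smul_zero, add_zero, h0]
      · exact hsub (show k ∈ {i | a i x + b i ≠ 0} from fun h0 => hk.ne (hu k h0)) hk'
    obtain ⟨q, hq, hgq⟩ := ih _ hlt hmem rfl
    refine ⟨q, hq, hgq.trans ?_⟩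
    rw [map_add, map_smul, smul_eq_mul]
    nlinarith

theorem IsBasic.eq_of_active {x y : W} (hx : IsBasic a b x)
    (h : ∀ i, a i x + b i = 0 → a i y + b i = 0) : y = x :=
  sub_eq_zero.1 (hx.2 _ fun i hi => by rw [map_sub]; linarith [h i hi])

theorem finite_isBasic [Finite ι] : {x | IsBasic a b x}.Finite := by
  refine Set.Finite.of_finite_image (f := fun x => {i | a i x + b i = 0}) (Set.toFinite _) ?_
  intro x hx y _ hxy
  exact (hx.eq_of_active fun i hi => (Set.ext_iff.1 hxy i).1 hi).symm

end Polyhedra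

section SimplePolyhedra

open Module

variable {W ι : Type*} [AddCommGroup W] [Module ℝ W] [FiniteDimensional ℝ W] [DecidableEq ι]
  {a : ι → Dual ℝ W} {b : ι → ℝ} {B : Finset ι}

omit [FiniteDimensional ℝ W] [DecidableEq ι] in
theorem exists_dual_vector (h : LinearIndepOn ℝ a (B : Set ι)) {i : ι} (hi : i ∈ B) :
    ∃ u, a i u = 1 ∧ ∀ k ∈ B, k ≠ i → a k u = 0 := by
  by_contra! hcon
  refine h.notMem_span (Finset.mem_coe.2 hi) ?_
  have h1 : a i ∈ Submodule.span ℝ (Set.range fun k : {k // k ∈ B ∧ k ≠ i} => a k) := by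
    have : Finite {k // k ∈ B ∧ k ≠ i} :=
      Finite.of_injective (fun k => (⟨k.1, k.2.1⟩ : B)) fun k l h => by
        simpa [Subtype.ext_iff] using h
    apply mem_span_of_iInf_ker_le_ker
    intro u hu
    simp only [Submodule.mem_iInf, LinearMap.mem_ker, Subtype.forall] at hu
    rw [LinearMap.mem_ker]
    by_contra hne
    obtain ⟨k, h1, h2, h3⟩ := hcon ((a i u)⁻¹ • u) (by simp [hne])
    exact h3 (by rw [map_smul, hu k ⟨h1, h2⟩, smul_zero])
  convert h1 using 2
  ext x
  simp [and_assoc]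

omit [DecidableEq ι] in
theorem eq_zero_of_card (h : LinearIndepOn ℝ a (B : Set ι)) (hB : B.card = finrank ℝ W) {u : W}
    (hu : ∀ i ∈ B, a i u = 0) : u = 0 := by
  have hspan := LinearIndependent.span_eq_top_of_card_eq_finrank' h
    (by rw [Subspace.dual_finrank_eq]; simpa using hB)
  rw [← Module.forall_dual_apply_eq_zero_iff ℝ]
  intro g
  have hg : g ∈ Submodule.span ℝ (Set.range fun i : (B : Set ι) => a i) := by
    rw [hspan]; trivial
  induction hg using Submodule.span_induction with
  | mem x hx => obtain ⟨i, rfl⟩ := hx; exact hu i i.2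
  | zero => simp
  | add x y _ _ hx hy => simp [hx, hy]
  | smul c x _ hx => simp [hx]

omit [DecidableEq ι] in
theorem card_le_finrank (h : LinearIndepOn ℝ a (B : Set ι)) : B.card ≤ finrank ℝ W := by
  rw [← Subspace.dual_finrank_eq]
  simpa using LinearIndependent.fintype_card_le_finrank h

/-- The linear program of `f` on the polyhedron of `a` and `b` is bounded and nondegenerate: the
active constraints are independent at every point, and `f` is not constant along any line that is
cut out by constraints `C` and meets some further constraint `i` in a point. -/
structure IsSimpleProgram (a : ι → Dual ℝ W) (b : ι → ℝ) (f : Dual ℝ W) : Prop where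
  noRay : NoRay a
  linearIndepOn : ∀ p ∈ polyhedron a b, LinearIndepOn ℝ a {i | a i p + b i = 0}
  apply_ne_zero : ∀ (C : Finset ι) (i : ι), (∀ u, (∀ c ∈ insert i C, a c u = 0) → u = 0) →
    ∀ u, u ≠ 0 → (∀ c ∈ C, a c u = 0) → f u ≠ 0

/-- The point `p` of the polyhedron has the set `B` of active constraints, and `B` has as many
elements as the dimension. -/
def IsBasisAt (a : ι → Dual ℝ W) (b : ι → ℝ) (B : Finset ι) (p : W) : Prop :=
  B.card = finrank ℝ W ∧ p ∈ polyhedron a b ∧ ∀ i, a i p + b i = 0 ↔ i ∈ B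

variable {f : Dual ℝ W} {p q : W}

namespace IsBasisAt

omit [FiniteDimensional ℝ W] [DecidableEq ι] in
theorem pos (hB : IsBasisAt a b B p) {i : ι} (hi : i ∉ B) : 0 < a i p + b i :=
  lt_of_le_of_ne (hB.2.1 i) fun h => hi ((hB.2.2 i).1 h.symm)

omit [FiniteDimensional ℝ W] in
theorem linearIndepOn (h : IsSimpleProgram a b f) (hB : IsBasisAt a b B p) :
    LinearIndepOn ℝ a (B : Set ι) := by
  have := h.linearIndepOn p hB.2.1
  rwa [show {i | a i p + b i = 0} = (B : Set ι) from Set.ext hB.2.2] at this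

theorem eq_zero (h : IsSimpleProgram a b f) (hB : IsBasisAt a b B p) {u : W}
    (hu : ∀ i ∈ B, a i u = 0) : u = 0 := eq_zero_of_card (hB.linearIndepOn h) hB.1 hu

theorem unique (h : IsSimpleProgram a b f) (hp : IsBasisAt a b B p) (hq : IsBasisAt a b B q) :
    p = q := by
  rw [← sub_eq_zero]
  refine hp.eq_zero h fun i hi => ?_
  rw [map_sub]
  linarith [(hp.2.2 i).2 hi, (hq.2.2 i).2 hi]

/-- The edge out of a vertex along which the constraint `i` is released ends at a vertex. -/
theorem exists_pivot [Finite ι] (h : IsSimpleProgram a b f) {C : Finset ι} {i : ι} (hi : i ∉ C)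
    (hp : IsBasisAt a b (insert i C) p) {u : W} (hiu : a i u = 1) (hu : ∀ c ∈ C, a c u = 0) :
    ∃ τ : ℝ, 0 < τ ∧ ∃ k, k ∉ C ∧ k ≠ i ∧ IsBasisAt a b (insert k C) (p + τ • u) := by
  have hneg : ∃ k, a k (u) < 0 := by
    by_contra! hcon
    have := h.noRay u hcon
    simp [this] at hiu
  obtain ⟨τ, hτ, hmem, k, hk, hk'⟩ := exists_move hp.2.1 hneg
  have hkC : k ∉ C := fun hkC => hk.ne (hu k hkC)
  have hki : k ≠ i := by rintro rfl; linarith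
  have hτ0 : τ ≠ 0 := by
    rintro rfl
    rw [zero_smul, add_zero] at hk'
    have := (hp.2.2 k).1 hk'
    simp [hkC, hki] at this
  have hcard : (insert k C).card = finrank ℝ W := by
    rw [← hp.1, Finset.card_insert_of_notMem hkC, Finset.card_insert_of_notMem hi]
  refine ⟨τ, lt_of_le_of_ne hτ hτ0.symm, k, hkC, hki, hcard, hmem, fun l => ?_⟩
  have hact : ∀ l ∈ insert k C, a l (p + τ • u) + b l = 0 := by
    intro l hl
    rcases Finset.mem_insert.1 hl with rfl | hl
    · exact hk'
    · rw [map_add, map_smul, hu l hl, smul_zero, add_zero]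
      exact (hp.2.2 l).2 (Finset.mem_insert_of_mem hl)
  refine ⟨fun hl => ?_, hact l⟩
  by_contra hlC
  have hle : (insert l (insert k C)).card ≤ finrank ℝ W := by
    refine card_le_finrank (a := a) ((h.linearIndepOn _ hmem).mono fun x hx => ?_)
    rcases Finset.mem_insert.1 (Finset.mem_coe.1 hx) with rfl | hx
    · exact hl
    · exact hact x hx
  rw [Finset.card_insert_of_notMem hlC, hcard] at hle
  omega

omit [FiniteDimensional ℝ W] in
theorem exists_edge_vector (h : IsSimpleProgram a b f) (hp : IsBasisAt a b B p) {i : ι}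
    (hi : i ∈ B) : ∃ u, a i u = 1 ∧ ∀ k ∈ B, k ≠ i → a k u = 0 :=
  exists_dual_vector (hp.linearIndepOn h) hi

/-- The neighbour of `p` across the edge that releases `i` lies in the direction `u` of this edge.
-/
theorem exists_eq_add_smul (h : IsSimpleProgram a b f) {C : Finset ι} {i k : ι} (hi : i ∉ C)
    (hki : k ≠ i) (hp : IsBasisAt a b (insert i C) p)
    (hq : IsBasisAt a b (insert k C) q) {u : W} (hiu : a i u = 1) (hu : ∀ c ∈ C, a c u = 0) :
    ∃ τ : ℝ, 0 < τ ∧ q = p + τ • u := by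
  refine ⟨a i q + b i, hq.pos (by simp [hi, hki.symm]), ?_⟩
  rw [← sub_eq_zero]
  refine hp.eq_zero h fun c hc => ?_
  have h0 := (hp.2.2 c).2 hc
  rw [map_sub, map_add, map_smul, smul_eq_mul]
  rcases Finset.mem_insert.1 hc with rfl | hc
  · rw [hiu]; linarith
  · have := (hq.2.2 c).2 (Finset.mem_insert_of_mem hc)
    rw [hu c hc]; linarith

theorem pivot_unique (h : IsSimpleProgram a b f) {C : Finset ι} {i k l : ι} (hi : i ∉ C)
    (hk : k ∉ C) (hki : k ≠ i) (hli : l ≠ i) {r : W}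
    (hp : IsBasisAt a b (insert i C) p) (hq : IsBasisAt a b (insert k C) q)
    (hr : IsBasisAt a b (insert l C) r) : k = l := by
  obtain ⟨u, hiu, hu⟩ := hp.exists_edge_vector h (Finset.mem_insert_self i C)
  have hu' : ∀ c ∈ C, a c u = 0 := fun c hc => hu c (Finset.mem_insert_of_mem hc)
    (by rintro rfl; exact hi hc)
  obtain ⟨τ, hτ, rfl⟩ := hp.exists_eq_add_smul h hi hki hq hiu hu'
  obtain ⟨σ, hσ, rfl⟩ := hp.exists_eq_add_smul h hi hli hr hiu hu'
  have key : ∀ m : ι, m ∉ C → m ≠ i → ∀ τ σ : ℝ, 0 < τ → 0 < σ → a m (p + τ • u) + b m = 0 →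
      0 ≤ a m (p + σ • u) + b m → σ ≤ τ := by
    intro m hm hmi τ σ hτ hσ h1 h2
    have h3 : 0 < a m p + b m := hp.pos (by simp [hm, hmi])
    rw [map_add, map_smul, smul_eq_mul] at h1 h2
    by_contra! hlt
    nlinarith
  by_cases hlC : l ∈ C
  · -- then the last basis would be too small
    have h1 := hr.1
    have h2 := hq.1
    rw [Finset.insert_eq_self.2 hlC] at h1
    rw [Finset.card_insert_of_notMem hk] at h2
    omega
  · have h1 := key k hk hki τ σ hτ hσ ((hq.2.2 k).2 (Finset.mem_insert_self _ _)) (hr.2.1 k)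
    have h2 := key l hlC hli σ τ hσ hτ ((hr.2.2 l).2 (Finset.mem_insert_self _ _)) (hq.2.1 l)
    obtain rfl := le_antisymm h1 h2
    have h3 := (hr.2.2 k).1 ((hq.2.2 k).2 (Finset.mem_insert_self _ _))
    rcases Finset.mem_insert.1 h3 with h3 | h3
    · exact h3
    · exact absurd h3 hk

theorem apply_ne (h : IsSimpleProgram a b f) {C : Finset ι} {i k : ι} (hi : i ∉ C)
    (hki : k ≠ i) (hp : IsBasisAt a b (insert i C) p)
    (hq : IsBasisAt a b (insert k C) q) : f q ≠ f p := by
  obtain ⟨u, hiu, hu⟩ := hp.exists_edge_vector h (Finset.mem_insert_self i C)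
  have hu' : ∀ c ∈ C, a c u = 0 := fun c hc => hu c (Finset.mem_insert_of_mem hc)
    (by rintro rfl; exact hi hc)
  obtain ⟨τ, hτ, rfl⟩ := hp.exists_eq_add_smul h hi hki hq hiu hu'
  have h0 : u ≠ 0 := by rintro rfl; simp at hiu
  have h1 := h.apply_ne_zero C i (fun v hv => hp.eq_zero h hv) u h0 hu'
  rw [map_add, map_smul, smul_eq_mul]
  simp [hτ.ne', h1]

/-- A vertex of the face of `A` from which the objective decreases along all edges of the face is
the only maximum of the face, because the face lies in the cone spanned by these edges. -/
theorem apply_le [Finite ι] (h : IsSimpleProgram a b f) {A : Finset ι} (hA : A ⊆ B)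
    (hp : IsBasisAt a b B p) (hq : q ∈ polyhedron a b) (hqA : ∀ i ∈ A, a i q + b i = 0)
    (hmax : ∀ C i k r, A ⊆ C → i ∉ C → k ∉ C → k ≠ i → B = insert i C →
      IsBasisAt a b (insert k C) r → f r < f p) :
    f q ≤ f p ∧ (f q = f p → q = p) := by
  choose! u hu hu' using fun i (hi : i ∈ B) => hp.exists_edge_vector h hi
  have hsum : q - p = ∑ i ∈ B, (a i q + b i) • u i := by
    rw [← sub_eq_zero]
    refine hp.eq_zero h fun i hi => ?_
    rw [map_sub, map_sum, Finset.sum_eq_single_of_mem i hi]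
    · rw [map_smul, hu i hi, map_sub, smul_eq_mul]
      linarith [(hp.2.2 i).2 hi]
    · intro k hk hki
      rw [map_smul, hu' k hk i hi hki.symm, smul_zero]
  have hneg : ∀ i ∈ B, i ∉ A → f (u i) < 0 := by
    intro i hi hiA
    have hB : insert i (B.erase i) = B := Finset.insert_erase hi
    have hp' := hp
    rw [← hB] at hp'
    obtain ⟨τ, hτ, k, hk, hki, hr⟩ := hp'.exists_pivot h (Finset.notMem_erase i B) (hu i hi)
      (fun c hc => hu' i hi c (Finset.mem_of_mem_erase hc) (Finset.ne_of_mem_erase hc))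
    have := hmax _ i k _ (fun x hx => Finset.mem_erase.2 ⟨by rintro rfl; exact hiA hx, hA hx⟩)
      (Finset.notMem_erase i B) hk hki hB.symm hr
    rw [map_add, map_smul, smul_eq_mul] at this
    by_contra! hge
    have := mul_nonneg hτ.le hge
    linarith
  have hterm : ∀ i ∈ B, (a i q + b i) * f (u i) ≤ 0 := by
    intro i hi
    by_cases hiA : i ∈ A
    · rw [hqA i hiA, zero_mul]
    · exact mul_nonpos_of_nonneg_of_nonpos (hq i) (hneg i hi hiA).le
  have hf : f q - f p = ∑ i ∈ B, (a i q + b i) * f (u i) := by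
    rw [← map_sub, hsum, map_sum]; simp
  have hle := Finset.sum_nonpos hterm
  refine ⟨by linarith, fun heq => ?_⟩
  rw [heq, sub_self, eq_comm, Finset.sum_eq_zero_iff_of_nonpos hterm] at hf
  rw [← sub_eq_zero, hsum]
  refine Finset.sum_eq_zero fun i hi => ?_
  by_cases hiA : i ∈ A
  · rw [hqA i hiA, zero_smul]
  · rcases mul_eq_zero.1 (hf i hi) with h0 | h0
    · rw [h0, zero_smul]
    · exact absurd h0 (hneg i hi hiA).ne

omit [FiniteDimensional ℝ W] [DecidableEq ι] in
theorem basis_unique (hp : IsBasisAt a b B p) {B' : Finset ι} (hq : IsBasisAt a b B' p) :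
    B = B' := by
  ext i; rw [← hp.2.2, hq.2.2]

end IsBasisAt

omit [FiniteDimensional ℝ W] in
theorem IsSimpleProgram.neg (h : IsSimpleProgram a b f) : IsSimpleProgram a b (-f) :=
  ⟨h.1, h.2, fun C i h1 u h2 h3 => by simpa using h.3 C i h1 u h2 h3⟩

open Classical in
/-- The vertex of a feasible basis (`0` if the basis is not feasible). -/
noncomputable def basisPoint (a : ι → Dual ℝ W) (b : ι → ℝ) (B : Finset ι) : W :=
  if h : ∃ p, IsBasisAt a b B p then h.choose else 0

omit [FiniteDimensional ℝ W] [DecidableEq ι] in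
theorem isBasisAt_basisPoint (h : ∃ p, IsBasisAt a b B p) : IsBasisAt a b B (basisPoint a b B) := by
  rw [basisPoint, dif_pos h]; exact h.choose_spec

/-- The bases of a nondegenerate program, with the values of its objective. -/
noncomputable def IsSimpleProgram.toAbstractObjective [Finite ι] (h : IsSimpleProgram a b f)
    {d : ℕ} (hd : finrank ℝ W = d) : AbstractObjective ι d where
  feas B := ∃ p, IsBasisAt a b B p
  val B := f (basisPoint a b B)
  card_eq := fun ⟨_, hp⟩ => hp.1.trans hd
  exists_pivot := fun {C i} hi ⟨p, hp⟩ => by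
    obtain ⟨u, hiu, hu⟩ := hp.exists_edge_vector h (Finset.mem_insert_self i C)
    obtain ⟨τ, -, k, hk, hki, hr⟩ := hp.exists_pivot h hi hiu fun c hc =>
      hu c (Finset.mem_insert_of_mem hc) (by rintro rfl; exact hi hc)
    exact ⟨k, hk, hki, _, hr⟩
  pivot_unique hi hk _ hki hli := fun ⟨_, hp⟩ ⟨_, hq⟩ ⟨_, hr⟩ =>
    hp.pivot_unique h hi hk hki hli hq hr
  val_ne hi _ hki hp hq :=
    (isBasisAt_basisPoint hp).apply_ne h hi hki (isBasisAt_basisPoint hq)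
  lt_of_localMax {A B B'} hA hA' hB hB' hne hmax := by
    have hp := isBasisAt_basisPoint hB
    have hq := isBasisAt_basisPoint hB'
    obtain ⟨h1, h2⟩ := hp.apply_le h hA hq.2.1 (fun i hi => (hq.2.2 i).2 (hA' hi))
      fun C i k r h1 h2 h3 h4 h5 h6 => by
        rw [← (isBasisAt_basisPoint ⟨r, h6⟩).unique h h6]
        exact hmax C i k h1 h2 h3 h4 h5 ⟨r, h6⟩
    refine lt_of_le_of_ne h1 fun heq => hne ?_
    exact hq.basis_unique (h2 heq ▸ hp)
  lt_of_localMin {A B B'} hA hA' hB hB' hne hmin := by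
    have hp := isBasisAt_basisPoint hB
    have hq := isBasisAt_basisPoint hB'
    obtain ⟨h1, h2⟩ := hp.apply_le h.neg hA hq.2.1 (fun i hi => (hq.2.2 i).2 (hA' hi))
      fun C i k r h1 h2 h3 h4 h5 h6 => by
        rw [← (isBasisAt_basisPoint ⟨r, h6⟩).unique h h6]
        exact neg_lt_neg (hmin C i k h1 h2 h3 h4 h5 ⟨r, h6⟩)
    simp only [LinearMap.neg_apply, neg_le_neg_iff, neg_inj] at h1 h2
    refine lt_of_le_of_ne h1 fun heq => hne ?_
    exact hq.basis_unique (h2 heq.symm ▸ hp)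

end SimplePolyhedra
end PolytopePaths

/-! ### Perturbation to a nondegenerate program -/

namespace PolytopePaths

section Perturbation

open Module Filter Topology

theorem eventually_nonneg_imp {g : ℝ → ℝ} (hg : Continuous g) :
    ∀ᶠ δ in 𝓝[>] (0 : ℝ), 0 ≤ g δ → 0 ≤ g 0 := by
  by_cases h : 0 ≤ g 0
  · exact Eventually.of_forall fun _ _ => h
  · filter_upwards [nhdsWithin_le_nhds (hg.continuousAt.eventually_lt_const (not_le.1 h))] with δ hδ
    intro h1
    exact absurd h1 (not_le.2 hδ)

theorem eventually_eval_ne_zero {p : Polynomial ℝ} (hp : p ≠ 0) :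
    ∀ᶠ δ in 𝓝[>] (0 : ℝ), p.eval δ ≠ 0 := by
  have hfin : {x | p.IsRoot x}.Finite := Polynomial.finite_setOfPred_isRoot hp
  have h1 : ({x | p.IsRoot x} \ {0})ᶜ ∈ 𝓝 (0 : ℝ) :=
    (hfin.subset Set.sdiff_subset).isClosed.isOpen_compl.mem_nhds (by simp)
  filter_upwards [nhdsWithin_le_nhds h1, self_mem_nhdsWithin] with δ h2 h3 h4
  exact h2 ⟨h4, (Set.mem_Ioi.1 h3).ne'⟩

variable {W ι : Type*} [AddCommGroup W] [Module ℝ W] {a : ι → Dual ℝ W} {b : ι → ℝ}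
  {f : Dual ℝ W} {e : ι → ℕ}

/-- Two vertices such that the constraints active at both leave only the line through them free. -/
structure IsBasicEdge (a : ι → Dual ℝ W) (b : ι → ℝ) (x y : W) : Prop where
  ne : x ≠ y
  left : IsBasic a b x
  right : IsBasic a b y
  exists_smul : ∀ u, (∀ i, a i x + b i = 0 → a i y + b i = 0 → a i u = 0) →
    ∃ τ : ℝ, u = τ • (y - x)

/-- The constants of the inequalities, increased by distinct powers of a small number. -/
def perturbedConst (b : ι → ℝ) (e : ι → ℕ) (δ : ℝ) (i : ι) : ℝ := b i + δ ^ e i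

/-- The objective, changed by a combination of the constraints with distinct powers of a small
number. -/
noncomputable def perturbedObj [Fintype ι] (a : ι → Dual ℝ W) (f : Dual ℝ W) (e : ι → ℕ) (δ : ℝ) :
    Dual ℝ W := f + ∑ i, δ ^ e i • a i

theorem perturbedConst_zero (he : ∀ i, e i ≠ 0) (i : ι) : perturbedConst b e 0 i = b i := by
  simp [perturbedConst, he]

theorem perturbedObj_zero [Fintype ι] (he : ∀ i, e i ≠ 0) : perturbedObj a f e 0 = f := by
  simp [perturbedObj, he]

theorem polyhedron_subset_perturbed {δ : ℝ} (hδ : 0 ≤ δ) :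
    polyhedron a b ⊆ polyhedron a (perturbedConst b e δ) := fun x hx i => by
  have := hx i
  have := pow_nonneg hδ (e i)
  simp only [perturbedConst]
  linarith

/-- The point where the constraints `B` with constants `c` are active, provided that `u` is dual to
these constraints. -/
noncomputable def solution (c : ι → ℝ) (u : ι → W) (B : Finset ι) : W := ∑ i ∈ B, -(c i) • u i

theorem apply_solution {c : ι → ℝ} {u : ι → W} {B : Finset ι}
    (hu : ∀ i ∈ B, a i (u i) = 1 ∧ ∀ k ∈ B, k ≠ i → a k (u i) = 0) {i : ι} (hi : i ∈ B) :
    a i (solution c u B) + c i = 0 := by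
  rw [solution, map_sum, Finset.sum_eq_single_of_mem i hi]
  · rw [map_smul, (hu i hi).1]; simp
  · intro k hk hki
    rw [map_smul, (hu k hk).2 i hi hki.symm, smul_zero]

theorem continuous_solution (g : Dual ℝ W) (u : ι → W) (B : Finset ι) :
    Continuous fun δ : ℝ => g (solution (perturbedConst b e δ) u B) := by
  simp only [solution, map_sum, map_smul, perturbedConst, smul_eq_mul]
  fun_prop

variable [Fintype ι]

theorem sum_monomial_ne_zero (he : Function.Injective e) (he0 : ∀ i, e i ≠ 0) {c : ι → ℝ} (r : ℝ)
    {i : ι} (hc : c i ≠ 0) :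
    Polynomial.C r + ∑ i, Polynomial.monomial (e i) (c i) ≠ 0 := by
  intro h
  have := congrArg (fun p => Polynomial.coeff p (e i)) h
  simp only [Polynomial.coeff_add, Polynomial.finsetSum_coeff, Polynomial.coeff_monomial,
    Polynomial.coeff_zero, Polynomial.coeff_C, if_neg (he0 i), zero_add] at this
  rw [Finset.sum_eq_single i] at this
  · exact hc (by simpa using this)
  · intro k _ hk
    exact if_neg fun h => hk (he h)
  · simp

/-- After a small perturbation, active constraints are independent: a linear relation between
constraints that are active together would be a zero of a nonzero polynomial. -/
theorem eventually_linearIndepOn (he : Function.Injective e) (he0 : ∀ i, e i ≠ 0) :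
    ∀ᶠ δ in 𝓝[>] (0 : ℝ), ∀ p ∈ polyhedron a (perturbedConst b e δ),
      LinearIndepOn ℝ a {i | a i p + perturbedConst b e δ i = 0} := by
  classical
  have key : ∀ D : Set ι, ¬ LinearIndepOn ℝ a D → ∀ᶠ δ in 𝓝[>] (0 : ℝ),
      ∀ p, ¬ ∀ i ∈ D, a i p + perturbedConst b e δ i = 0 := by
    intro D hD
    rw [LinearIndepOn, Fintype.not_linearIndependent_iff] at hD
    obtain ⟨c, hc, i, hi⟩ := hD
    let c' : ι → ℝ := fun k => if h : k ∈ D then c ⟨k, h⟩ else 0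
    have hc' : ∀ k : D, c' k = c k := fun k => by simp [c']
    have hpoly := sum_monomial_ne_zero he he0 (c := c') (∑ k : D, c k * b k)
      (i := i) (by rw [hc']; exact hi)
    filter_upwards [eventually_eval_ne_zero hpoly] with δ hδ p hp
    apply hδ
    have h1 : ∑ k : D, c k * (a k p + perturbedConst b e δ k) = 0 :=
      Finset.sum_eq_zero fun k _ => by rw [hp k k.2, mul_zero]
    have h2 : ∑ k : D, c k * a k p = 0 := by
      have := LinearMap.congr_fun hc p
      simpa using this
    simp only [mul_add, perturbedConst, Finset.sum_add_distrib, h2, zero_add] at h1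
    simp only [Polynomial.eval_add, Polynomial.eval_C, Polynomial.eval_finsetSum,
      Polynomial.eval_monomial]
    rw [← h1]
    congr 1
    rw [← Finset.sum_subset (Finset.subset_univ D.toFinset)]
    · rw [Finset.sum_subtype D.toFinset (p := (· ∈ D)) (by simp) fun k => c' k * δ ^ e k]
      exact Finset.sum_congr rfl fun k _ => congrArg (· * δ ^ e k) (hc' k)
    · intro k _ hk
      simp [c', show k ∉ D by simpa using hk]
  have := (Set.toFinite {D : Set ι | ¬ LinearIndepOn ℝ a D}).eventually_all.2 key
  filter_upwards [this] with δ hδ p _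
  by_contra hcon
  exact hδ _ hcon p fun i hi => hi

/-- After a small perturbation, the objective is not constant on any line cut out by constraints:
its value on a direction of the line is a polynomial in the perturbation, and it is not zero
because some constraint is not constant on the line. -/
theorem eventually_apply_ne_zero [DecidableEq ι] (ha : NoRay a) (he : Function.Injective e)
    (he0 : ∀ i, e i ≠ 0) :
    ∀ᶠ δ in 𝓝[>] (0 : ℝ), ∀ (C : Finset ι) (i : ι),
      (∀ u, (∀ c ∈ insert i C, a c u = 0) → u = 0) →
      ∀ u, u ≠ 0 → (∀ c ∈ C, a c u = 0) → perturbedObj a f e δ u ≠ 0 := by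
  rw [eventually_all]
  intro C
  rw [eventually_all]
  intro i
  by_cases hker : ∀ u, (∀ c ∈ insert i C, a c u = 0) → u = 0
  swap
  · exact Eventually.of_forall fun _ h => absurd h hker
  by_cases hex : ∃ v, v ≠ 0 ∧ ∀ c ∈ C, a c v = 0
  swap
  · exact Eventually.of_forall fun _ _ u h1 h2 => absurd ⟨u, h1, h2⟩ hex
  obtain ⟨v, hv, hvC⟩ := hex
  obtain ⟨k, hk⟩ : ∃ k, a k v ≠ 0 := by
    by_contra! h
    exact hv (ha v fun i => (h i).ge)
  have hiv : a i v ≠ 0 := fun h => hv (hker v fun c hc => by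
    rcases Finset.mem_insert.1 hc with rfl | hc
    exacts [h, hvC c hc])
  filter_upwards [eventually_eval_ne_zero (sum_monomial_ne_zero he he0
      (c := fun k => a k v) (f v) hk)]
    with δ hδ _ u hu huC h0
  have huv : u = (a i u / a i v) • v := by
    rw [← sub_eq_zero]
    refine hker _ fun c hc => ?_
    rw [map_sub, map_smul, smul_eq_mul]
    rcases Finset.mem_insert.1 hc with rfl | hc
    · field_simp; simp
    · rw [huC c hc, hvC c hc]; simp
  have hne : a i u / a i v ≠ 0 := by
    intro h
    rw [h, zero_smul] at huv
    exact hu huv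
  rw [huv, map_smul, smul_eq_mul, mul_eq_zero, or_iff_right hne] at h0
  apply hδ
  simp only [Polynomial.eval_add, Polynomial.eval_C, Polynomial.eval_finsetSum,
      Polynomial.eval_monomial]
  rw [← h0, perturbedObj]
  simp [mul_comm]

theorem eventually_isSimpleProgram [DecidableEq ι] (ha : NoRay a) (he : Function.Injective e)
    (he0 : ∀ i, e i ≠ 0) : ∀ᶠ δ in 𝓝[>] (0 : ℝ),
      IsSimpleProgram a (perturbedConst b e δ) (perturbedObj a f e δ) := by
  filter_upwards [eventually_linearIndepOn (a := a) (b := b) he he0,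
    eventually_apply_ne_zero (f := f) ha he he0] with δ h1 h2
  exact ⟨ha, h1, h2⟩

theorem continuous_perturbedObj_solution (u : ι → W) (B : Finset ι) :
    Continuous fun δ : ℝ => perturbedObj a f e δ (solution (perturbedConst b e δ) u B) := by
  simp only [perturbedObj, LinearMap.add_apply, LinearMap.sum_apply, LinearMap.smul_apply,
    smul_eq_mul]
  exact (continuous_solution f u B).add <| continuous_finsetSum _ fun i _ =>
    (continuous_id.pow _).mul (continuous_solution (a i) u B)

theorem continuous_perturbedObj (x : W) : Continuous fun δ : ℝ => perturbedObj a f e δ x := by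
  simp only [perturbedObj, LinearMap.add_apply, LinearMap.sum_apply, LinearMap.smul_apply,
    smul_eq_mul]
  fun_prop

end Perturbation

section PerturbedPath

open Module Filter Topology

variable {W ι : Type*} [AddCommGroup W] [Module ℝ W] [FiniteDimensional ℝ W]
  {a : ι → Dual ℝ W} {b : ι → ℝ} {f : Dual ℝ W}

theorem IsSimpleProgram.exists_isBasisAt [Fintype ι] [DecidableEq ι] (h : IsSimpleProgram a b f)
    {x : W} (hx : x ∈ polyhedron a b) : ∃ B p, IsBasisAt a b B p := by
  classical
  obtain ⟨q, hq, -⟩ := exists_isBasic h.noRay f hx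
  refine ⟨Finset.univ.filter fun i => a i q + b i = 0, q, le_antisymm ?_ ?_, hq.1, by simp⟩
  · refine card_le_finrank (a := a) ?_
    simpa using h.linearIndepOn q hq.1
  · let L : W →ₗ[ℝ] (Finset.univ.filter fun i => a i q + b i = 0) → ℝ := LinearMap.pi fun i => a i
    have hL : Function.Injective L := by
      rw [injective_iff_map_eq_zero]
      intro u hu
      exact hq.2 u fun i hi => congrFun hu ⟨i, by simpa using hi⟩
    have := LinearMap.finrank_le_finrank_of_injective hL
    rwa [Module.finrank_fintype_fun_eq_card, Fintype.card_coe] at this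

/-- In a bounded polyhedron of dimension four with at most eight constraints, there is a walk of at
most four steps along edges on which `f` does not decrease (some steps may stay in place) from the
unique minimum of `f` to the unique maximum. It is the limit of a directed path of a perturbed
program: a basis that is feasible for a small perturbation is feasible without it, and an edge
between two such bases becomes an edge or a point. -/
theorem exists_short_walk [Fintype ι] [DecidableEq ι] (hcard : Fintype.card ι ≤ 8)
    (hW : finrank ℝ W = 4)
    (ha : NoRay a) {s t : W} (hs : s ∈ polyhedron a b) (ht : t ∈ polyhedron a b)
    (hsmin : ∀ x ∈ polyhedron a b, f x ≤ f s → x = s)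
    (htmax : ∀ x ∈ polyhedron a b, f t ≤ f x → x = t) :
    ∃ n ≤ 4, ∃ v : ℕ → W, v 0 = s ∧ v n = t ∧ ∀ m < n,
      v m = v (m + 1) ∨ (IsBasicEdge a b (v m) (v (m + 1)) ∧ f (v m) ≤ f (v (m + 1))) := by
  let e : ι → ℕ := fun i => Fintype.equivFin ι i + 1
  have he : Function.Injective e := fun i k h => by
    simpa [e, Fin.val_inj] using h
  have he0 : ∀ i, e i ≠ 0 := fun i => Nat.succ_ne_zero _
  choose! U hU using fun (B : Finset ι) (hB : LinearIndepOn ℝ a (B : Set ι)) (i : ι) (hi : i ∈ B) =>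
    exists_dual_vector hB hi
  -- the vertex of the basis `B` after the perturbation `δ`
  let x : Finset ι → ℝ → W := fun B δ => solution (perturbedConst b e δ) (U B) B
  let c := perturbedConst b e
  let g := perturbedObj a f e
  have hc0 : ∀ i, c 0 i = b i := perturbedConst_zero he0
  have hg0 : g 0 = f := perturbedObj_zero he0
  -- a perturbation so small that none of finitely many inequalities holds after it without holding
  -- before
  obtain ⟨δ, hδ0, hprog, h1, h2, h3, h4⟩ : ∃ δ : ℝ, 0 < δ ∧ IsSimpleProgram a (c δ) (g δ) ∧
      (∀ B i, 0 ≤ a i (x B δ) + c δ i → 0 ≤ a i (x B 0) + c 0 i) ∧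
      (∀ B, 0 ≤ g δ s - g δ (x B δ) → 0 ≤ g 0 s - g 0 (x B 0)) ∧
      (∀ B, 0 ≤ g δ (x B δ) - g δ t → 0 ≤ g 0 (x B 0) - g 0 t) ∧
      (∀ B B', 0 ≤ g δ (x B' δ) - g δ (x B δ) → 0 ≤ g 0 (x B' 0) - g 0 (x B 0)) := by
    have E1 : ∀ᶠ δ in 𝓝[>] (0 : ℝ), 0 < δ := self_mem_nhdsWithin
    have E2 := eventually_isSimpleProgram (b := b) (f := f) ha he he0
    have E3 : ∀ᶠ δ in 𝓝[>] (0 : ℝ), ∀ B i, 0 ≤ a i (x B δ) + c δ i → 0 ≤ a i (x B 0) + c 0 i :=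
      eventually_all.2 fun B => eventually_all.2 fun i =>
        eventually_nonneg_imp (g := fun δ => a i (x B δ) + c δ i) <|
        (continuous_solution (a i) (U B) B).add (by simp only [c, perturbedConst]; fun_prop)
    have E4 : ∀ᶠ δ in 𝓝[>] (0 : ℝ), ∀ B, 0 ≤ g δ s - g δ (x B δ) → 0 ≤ g 0 s - g 0 (x B 0) :=
      eventually_all.2 fun B => eventually_nonneg_imp (g := fun δ => g δ s - g δ (x B δ)) <|
        (continuous_perturbedObj s).sub (continuous_perturbedObj_solution (U B) B)
    have E5 : ∀ᶠ δ in 𝓝[>] (0 : ℝ), ∀ B, 0 ≤ g δ (x B δ) - g δ t → 0 ≤ g 0 (x B 0) - g 0 t :=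
      eventually_all.2 fun B => eventually_nonneg_imp (g := fun δ => g δ (x B δ) - g δ t) <|
        (continuous_perturbedObj_solution (U B) B).sub (continuous_perturbedObj t)
    have E6 : ∀ᶠ δ in 𝓝[>] (0 : ℝ), ∀ B B', 0 ≤ g δ (x B' δ) - g δ (x B δ) →
        0 ≤ g 0 (x B' 0) - g 0 (x B 0) :=
      eventually_all.2 fun B => eventually_all.2 fun B' =>
        eventually_nonneg_imp (g := fun δ => g δ (x B' δ) - g δ (x B δ)) <|
        (continuous_perturbedObj_solution (U B') B').sub (continuous_perturbedObj_solution (U B) B)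
    exact (E1.and (E2.and (E3.and (E4.and (E5.and E6))))).exists
  simp only [hc0, hg0, sub_nonneg] at h1 h2 h3 h4
  have hact : ∀ B : Finset ι, LinearIndepOn ℝ a (B : Set ι) → ∀ δ, ∀ i ∈ B,
      a i (x B δ) + c δ i = 0 :=
    fun B hB δ i hi => apply_solution (hU B hB) hi
  -- facts on the bases that are feasible after the perturbation
  have hbasis : ∀ B p, IsBasisAt a (c δ) B p → p = x B δ := fun B p hp => by
    rw [← sub_eq_zero]
    refine hp.eq_zero hprog fun i hi => ?_
    rw [map_sub]
    linarith [hact B (hp.linearIndepOn hprog) δ i hi, (hp.2.2 i).2 hi]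
  have hker : ∀ B p, IsBasisAt a (c δ) B p → ∀ u, (∀ i ∈ B, a i u = 0) → u = 0 :=
    fun B p hp u hu => hp.eq_zero hprog hu
  have hact0 : ∀ B p, IsBasisAt a (c δ) B p → ∀ i ∈ B, a i (x B 0) + b i = 0 :=
      fun B p hp i hi => by
    rw [← hc0]; exact hact B (hp.linearIndepOn hprog) 0 i hi
  have hmem : ∀ B p, IsBasisAt a (c δ) B p → x B 0 ∈ polyhedron a b := fun B p hp i =>
    h1 B i (hbasis B p hp ▸ hp.2.1 i)
  have hbasic : ∀ B p, IsBasisAt a (c δ) B p → IsBasic a b (x B 0) := fun B p hp =>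
    ⟨hmem B p hp, fun u hu => hker B p hp u fun i hi => hu i (hact0 B p hp i hi)⟩
  let S := hprog.toAbstractObjective hW
  have hval : ∀ B, S.feas B → S.val B = g δ (x B δ) := fun B hB =>
    congrArg (g δ) (hbasis B _ (isBasisAt_basisPoint hB))
  have hsδ : s ∈ polyhedron a (c δ) := polyhedron_subset_perturbed hδ0.le hs
  have htδ : t ∈ polyhedron a (c δ) := polyhedron_subset_perturbed hδ0.le ht
  obtain ⟨B, hB⟩ := hprog.exists_isBasisAt hsδ
  obtain ⟨T, hT⟩ := S.exists_isMax hB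
  obtain ⟨R, hR⟩ : ∃ R, S.IsMin R := by
    obtain ⟨R, hR⟩ := S.neg.exists_isMax hB
    have := hR.neg
    exact ⟨R, this.1, fun B h1 h2 => by simpa [AbstractObjective.neg] using this.2 B h1 h2⟩
  have hRs : x R 0 = s := by
    obtain ⟨p, hp⟩ := hR.1
    refine hsmin _ (hmem R p hp) (h2 R ?_)
    have := (hp.apply_le hprog.neg (Finset.empty_subset R) hsδ (by simp)
      fun C i k r _ h5 h6 h7 h8 h9 => ?_).1
    · rw [hbasis R p hp] at this
      simpa using this
    · have h10 := hR.2 (insert k C) ⟨r, h9⟩ (by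
        rintro rfl
        have : i ∈ insert k C := by rw [h8]; simp
        simp [h5, h7.symm] at this)
      rw [hval R hR.1, hval _ ⟨r, h9⟩] at h10
      rw [hbasis _ r h9, hbasis R p hp]
      simpa using h10
  have hTt : x T 0 = t := by
    obtain ⟨p, hp⟩ := hT.1
    refine htmax _ (hmem T p hp) (h3 T ?_)
    have := (hp.apply_le hprog (Finset.empty_subset T) htδ (by simp)
      fun C i k r _ h5 h6 h7 h8 h9 => ?_).1
    · rwa [hbasis T p hp] at this
    · have h10 := hT.2 (insert k C) ⟨r, h9⟩ (by
        rintro rfl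
        have : i ∈ insert k C := by rw [h8]; simp
        simp [h5, h7.symm] at this)
      rw [hval T hT.1, hval _ ⟨r, h9⟩] at h10
      rwa [hbasis _ r h9, hbasis T p hp]
  have hstep : ∀ P Q, S.Step P Q → x P 0 = x Q 0 ∨
      (IsBasicEdge a b (x P 0) (x Q 0) ∧ f (x P 0) ≤ f (x Q 0)) := by
    rintro P Q ⟨C, i, k, hi, hk, hki, rfl, rfl, hP, hQ, hlt⟩
    rw [or_iff_not_imp_left]
    intro hne
    have hP' := hP
    have hQ' := hQ
    obtain ⟨p, hp⟩ := hP'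
    obtain ⟨q, hq⟩ := hQ'
    rw [hval _ hP, hval _ hQ] at hlt
    refine ⟨⟨hne, hbasic _ p hp, hbasic _ q hq, fun u hu => ?_⟩, h4 _ _ hlt.le⟩
    set X := x (insert i C) 0
    set Y := x (insert k C) 0
    have hXC : ∀ c ∈ C, a c X + b c = 0 := fun c hc =>
      hact0 _ p hp c (Finset.mem_insert_of_mem hc)
    have hYC : ∀ c ∈ C, a c Y + b c = 0 := fun c hc =>
      hact0 _ q hq c (Finset.mem_insert_of_mem hc)
    have hne' : a i (Y - X) ≠ 0 := fun h0 => hne (sub_eq_zero.1 (hker _ p hp _ fun c hc => by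
      rcases Finset.mem_insert.1 hc with rfl | hc
      · exact h0
      · rw [map_sub]; linarith [hXC c hc, hYC c hc])).symm
    refine ⟨a i u / a i (Y - X), ?_⟩
    rw [← sub_eq_zero]
    refine hker _ p hp _ fun c hc => ?_
    rw [map_sub, map_smul, smul_eq_mul]
    rcases Finset.mem_insert.1 hc with rfl | hc
    · rw [div_mul_cancel₀ _ hne', sub_self]
    · have h0 : a c (Y - X) = 0 := by rw [map_sub]; linarith [hXC c hc, hYC c hc]
      rw [hu c (hXC c hc) (hYC c hc), h0, mul_zero, sub_zero]
  obtain ⟨n, hn, hreach⟩ := AbstractObjective.exists_reach_le_four hcard hR hT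
  refine ⟨n, hn, ?_⟩
  rw [← hRs, ← hTt]
  clear hn hRs hR
  induction n generalizing R with
  | zero => exact ⟨fun _ => x R 0, rfl, by rw [show R = T from hreach], by simp⟩
  | succ n ih =>
    obtain ⟨Q, hRQ, hQT⟩ := hreach
    obtain ⟨v, hv0, hvn, hv⟩ := ih Q hQT
    refine ⟨fun m => if m = 0 then x R 0 else v (m - 1), by simp, by simpa using hvn, ?_⟩
    intro m hm
    rcases m with _ | m
    · simpa [hv0] using hstep R Q hRQ
    · simpa using hv m (by omega)

end PerturbedPath
end PolytopePaths

/-! ### Edges and sources of a polytope given by inequalities -/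

namespace PolytopePaths

section Representation

open Module

variable {E : Type*} [NormedAddCommGroup E] [NormedSpace ℝ E]
  {P : Set E} {c : E} {W : Submodule ℝ E} {ι : Type*} {a : ι → Dual ℝ W} {b : ι → ℝ}

theorem IsBasicEdge.symm {V : Type*} [AddCommGroup V] [Module ℝ V] {a : ι → Dual ℝ V} {x y : V}
    (h : IsBasicEdge a b x y) : IsBasicEdge a b y x :=
  ⟨h.ne.symm, h.right, h.left, fun u hu => by
    obtain ⟨τ, hτ⟩ := h.exists_smul u fun i h1 h2 => hu i h2 h1
    exact ⟨-τ, by rw [hτ, neg_smul, ← smul_neg, neg_sub]⟩⟩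

theorem exists_continuous_extension [FiniteDimensional ℝ E] (g : Dual ℝ W) :
    ∃ l : E →L[ℝ] ℝ, ∀ w : W, l w = g w := by
  obtain ⟨l, hl⟩ := LinearMap.exists_extend g
  exact ⟨LinearMap.toContinuousLinearMap l, fun w => LinearMap.congr_fun hl w⟩

/-- The points where the constraints `T` are active form a face, exposed by the sum of the
negatives of these constraints. -/
theorem isExposed_active [FiniteDimensional ℝ E]
    (hP : P = (fun w : W => c + (w : E)) '' polyhedron a b) (T : Finset ι) :
    IsExposed ℝ P ((fun w : W => c + (w : E)) ''
      {w | w ∈ polyhedron a b ∧ ∀ i ∈ T, a i w + b i = 0}) := by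
  rintro ⟨_, x, ⟨hx, hxT⟩, rfl⟩
  obtain ⟨l, hl⟩ := exists_continuous_extension (-∑ i ∈ T, a i)
  have hl' : ∀ w : W, l (c + w) = l c - ∑ i ∈ T, (a i w + b i) + ∑ i ∈ T, b i := fun w => by
    rw [map_add, hl, LinearMap.neg_apply, LinearMap.sum_apply, Finset.sum_add_distrib]
    ring
  have hx0 : ∑ i ∈ T, (a i x + b i) = 0 := Finset.sum_eq_zero hxT
  refine ⟨l, ?_⟩
  ext z
  simp only [Set.mem_image, Set.mem_ofPred_eq, hP, forall_exists_index, and_imp,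
    forall_apply_eq_imp_iff₂]
  constructor
  · rintro ⟨w, ⟨hw, hwT⟩, rfl⟩
    refine ⟨⟨w, hw, rfl⟩, fun y hy => ?_⟩
    rw [hl', hl', Finset.sum_eq_zero hwT]
    have := Finset.sum_nonneg fun i (_ : i ∈ T) => hy i
    linarith
  · rintro ⟨⟨w, hw, rfl⟩, hmax⟩
    refine ⟨w, ⟨hw, ?_⟩, rfl⟩
    have h1 := hmax x hx
    rw [hl', hl', hx0] at h1
    have h2 := Finset.sum_nonneg fun i (_ : i ∈ T) => hw i
    exact (Finset.sum_eq_zero_iff_of_nonneg fun i _ => hw i).1 (by linarith)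

theorem IsBasic.mem_vertices [FiniteDimensional ℝ E] [Finite ι]
    (hP : P = (fun w : W => c + (w : E)) '' polyhedron a b) {x : W} (hx : IsBasic a b x) :
    c + (x : E) ∈ vertices P := by
  classical
  have := Fintype.ofFinite ι
  rw [vertices, mem_exposedPoints_iff_exposed_singleton]
  have hexp := isExposed_active hP (Finset.univ.filter fun i => a i x + b i = 0)
  have hset : (fun w : W => c + (w : E)) '' {w | w ∈ polyhedron a b ∧
      ∀ i ∈ Finset.univ.filter fun i => a i x + b i = 0, a i w + b i = 0} = {c + (x : E)} := ?_
  · rwa [hset] at hexp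
  refine Set.Subset.antisymm ?_ ?_
  rotate_left
  · rintro _ rfl
    exact ⟨x, ⟨hx.1, by simp⟩, rfl⟩
  · rintro _ ⟨w, ⟨-, hw⟩, rfl⟩
    rw [hx.eq_of_active fun i hi => hw i (by simpa using hi)]
    rfl

theorem IsBasicEdge.isEdge [FiniteDimensional ℝ E] [Finite ι]
    (hP : P = (fun w : W => c + (w : E)) '' polyhedron a b) {x y : W} (h : IsBasicEdge a b x y) :
    IsEdge P (c + x) (c + y) := by
  classical
  have := Fintype.ofFinite ι
  refine ⟨fun heq => h.ne (Subtype.ext (add_left_cancel heq)), h.left.mem_vertices hP,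
    h.right.mem_vertices hP, ?_⟩
  have hexp := isExposed_active hP
    (Finset.univ.filter fun i => a i x + b i = 0 ∧ a i y + b i = 0)
  convert hexp using 1
  rw [segment_eq_image']
  -- a constraint active at one end only bounds the line at this end
  have key : ∀ x y : W, IsBasicEdge a b x y → ∀ τ : ℝ, x + τ • (y - x) ∈ polyhedron a b →
      0 ≤ τ := by
    intro x y h τ hτ
    obtain ⟨i, hi, hne⟩ : ∃ i, a i x + b i = 0 ∧ a i (y - x) ≠ 0 := by
      by_contra! hcon
      exact h.ne (sub_eq_zero.1 (h.left.2 _ hcon)).symm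
    have h1 := h.right.1 i
    have h2 := hτ i
    rw [map_sub] at hne
    rw [map_add, map_smul, map_sub, smul_eq_mul] at h2
    have h3 : 0 < a i y - a i x := lt_of_le_of_ne (by linarith) hne.symm
    by_contra! hneg
    nlinarith
  refine Set.Subset.antisymm ?_ ?_
  · rintro _ ⟨θ, hθ, rfl⟩
    refine ⟨x + θ • (y - x), ⟨fun i => ?_, fun i hi => ?_⟩, ?_⟩
    · have h1 := h.left.1 i
      have h2 := h.right.1 i
      rw [map_add, map_smul, map_sub, smul_eq_mul]
      nlinarith [mul_nonneg hθ.1 h2, mul_nonneg (sub_nonneg.2 hθ.2) h1]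
    · have h1 := (Finset.mem_filter.1 hi).2
      rw [map_add, map_smul, map_sub, smul_eq_mul, show a i y = a i x by linarith [h1.1, h1.2]]
      linarith [h1.1]
    · simp [add_assoc]
  · rintro _ ⟨w, ⟨hw, hact⟩, rfl⟩
    obtain ⟨τ, hτ⟩ := h.exists_smul (w - x) fun i h1 h2 => by
      have := hact i (by simp [h1, h2])
      rw [map_sub]; linarith
    obtain rfl : w = x + τ • (y - x) := by rw [← hτ]; abel
    refine ⟨τ, ⟨key x y h τ hw, ?_⟩, by simp [add_assoc]⟩
    have := key y x h.symm (1 - τ) (by convert hw using 1; module)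
    linarith

/-- On an edge, an admissible functional takes different values at the ends. -/
theorem IsAdmissible.apply_ne {f : E →ₗ[ℝ] ℝ} (hf : IsAdmissible P f) {x y : E}
    (h : IsEdge P x y) : f x ≠ f y := by
  intro heq
  refine hf x y h ⟨f x, fun z hz => ?_⟩
  rw [segment_eq_image'] at hz
  obtain ⟨θ, -, rfl⟩ := hz
  simp [heq]

theorem IsEdge.symm {x y : E} (h : IsEdge P x y) : IsEdge P y x :=
  ⟨h.1.symm, h.2.2.1, h.2.1, segment_symm ℝ x y ▸ h.2.2.2⟩

/-- A vertex is determined by its active constraints: otherwise it could be moved in two opposite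
directions. -/
theorem isBasic_of_mem_vertices [Finite ι] (ha : NoRay a)
    (hP : P = (fun w : W => c + (w : E)) '' polyhedron a b) {x : W}
    (hx : c + (x : E) ∈ vertices P) :
    IsBasic a b x := by
  obtain ⟨hxP, l, hl⟩ := hx
  have hmem : ∀ w ∈ polyhedron a b, c + (w : E) ∈ P := fun w hw => by
    rw [hP]; exact ⟨w, hw, rfl⟩
  have hxp : x ∈ polyhedron a b := by
    rw [hP] at hxP
    obtain ⟨w, hw, heq⟩ := hxP
    rwa [← (Subtype.ext (add_left_cancel heq) : w = x)]
  refine ⟨hxp, fun u hu => ?_⟩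
  by_contra hu0
  have key : ∀ u : W, (∀ i, a i x + b i = 0 → a i u = 0) → u ≠ 0 →
      ∃ τ : ℝ, 0 < τ ∧ x + τ • u ∈ polyhedron a b := by
    intro u hu hu0
    obtain ⟨τ, hτ, hmem, k, hk, hk'⟩ := exists_move hxp (u := u) (by
      by_contra! h
      exact hu0 (ha u h))
    refine ⟨τ, lt_of_le_of_ne hτ ?_, hmem⟩
    rintro rfl
    rw [zero_smul, add_zero] at hk'
    exact hk.ne (hu k hk')
  obtain ⟨τ, hτ, h1⟩ := key u hu hu0
  obtain ⟨σ, hσ, h2⟩ := key (-u) (fun i hi => by simp [hu i hi]) (by simpa using hu0)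
  have h3 := hl _ (hmem _ h1)
  have h4 := (hl _ (hmem _ h2)).1
  simp only [Submodule.coe_add, Submodule.coe_smul, Submodule.coe_neg, map_add, map_smul, map_neg,
    smul_eq_mul] at h3 h4
  have h5 : l (u : E) = 0 := by
    have h6 : τ * l (u : E) ≤ 0 := by linarith [h3.1]
    have h7 : 0 ≤ σ * l (u : E) := by linarith
    exact le_antisymm (nonpos_of_mul_nonpos_right h6 hτ) (nonneg_of_mul_nonneg_right h7 hσ)
  have h8 := h3.2 (by rw [h5]; simp)
  rw [add_right_inj, add_eq_left, smul_eq_zero] at h8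
  rcases h8 with h8 | h8
  · exact hτ.ne' h8
  · exact hu0 (by simpa using h8)

/-- An edge along which `f` does not increase leaves every vertex that is not the only minimum. Its
direction is a vertex of a bounded slice of the cone of the directions that point into the
polyhedron. -/
theorem exists_isBasicEdge_of_le {V : Type*} [AddCommGroup V] [Module ℝ V] [Finite ι]
    {a : ι → Dual ℝ V} (ha : NoRay a) {x y : V} (f : Dual ℝ V) (hx : IsBasic a b x)
    (hy : y ∈ polyhedron a b) (hne : y ≠ x) (hle : f y ≤ f x) :
    ∃ z, IsBasicEdge a b x z ∧ f z ≤ f x := by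
  classical
  have := Fintype.ofFinite ι
  let T : Finset ι := Finset.univ.filter fun i => a i x + b i = 0
  have hT : ∀ i, i ∈ T ↔ a i x + b i = 0 := by simp [T]
  let h : Dual ℝ V := ∑ i ∈ T, a i
  have hpos : ∀ u, (∀ i ∈ T, 0 ≤ a i u) → h u ≤ 0 → u = 0 := by
    intro u hu hle
    refine hx.2 u fun i hi => ?_
    have h1 : h u = ∑ i ∈ T, a i u := by simp [h]
    rw [h1] at hle
    exact (Finset.sum_eq_zero_iff_of_nonneg hu).1 (le_antisymm hle (Finset.sum_nonneg hu)) i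
      ((hT i).2 hi)
  -- the slice `h = 1` of the cone
  let a' : T ⊕ Bool → Dual ℝ V := Sum.elim (fun i => a i) fun s => if s then h else -h
  let b' : T ⊕ Bool → ℝ := Sum.elim (fun _ => 0) fun s => if s then -1 else 1
  have ha' : NoRay a' := fun u hu => hpos u (fun i hi => hu (Sum.inl ⟨i, hi⟩)) (by
    simpa [a'] using hu (Sum.inr false))
  have hw : ∀ i ∈ T, 0 ≤ a i (y - x) := fun i hi => by
    rw [map_sub]; linarith [hy i, (hT i).1 hi]
  have hh : 0 < h (y - x) := by
    by_contra! hcon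
    exact hne (sub_eq_zero.1 (hpos _ hw hcon))
  have hmem : (h (y - x))⁻¹ • (y - x) ∈ polyhedron a' b' := by
    rintro (i | s)
    · simpa [a', b'] using mul_nonneg (inv_nonneg.2 hh.le) (hw i i.2)
    · cases s <;> simp only [a', b', Sum.elim_inr, if_true, if_false, map_smul, smul_eq_mul,
        LinearMap.neg_apply, Bool.false_eq_true, mul_neg, inv_mul_cancel₀ hh.ne'] <;> norm_num
  obtain ⟨u, hu, hfu⟩ := exists_isBasic ha' f hmem
  have hfu0 : f u ≤ 0 := by
    refine hfu.trans ?_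
    rw [map_smul, smul_eq_mul]
    exact mul_nonpos_of_nonneg_of_nonpos (inv_nonneg.2 hh.le) (by rw [map_sub]; linarith)
  have huT : ∀ i ∈ T, 0 ≤ a i u := fun i hi => by simpa [a', b'] using hu.1 (Sum.inl ⟨i, hi⟩)
  have hu1 : h u = 1 := by
    have h1 := hu.1 (Sum.inr true)
    have h2 := hu.1 (Sum.inr false)
    simp only [a', b', Sum.elim_inr, if_true, if_false, LinearMap.neg_apply,
      Bool.false_eq_true] at h1 h2
    linarith
  have hker : ∀ v, (∀ i ∈ T, a i u = 0 → a i v = 0) → v = h v • u := by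
    intro v hv
    rw [← sub_eq_zero]
    refine hu.2 _ ?_
    rintro (i | s) hi
    · have hi : a i u = 0 := by simpa [a', b'] using hi
      change a i (v - h v • u) = 0
      rw [map_sub, map_smul, hv i i.2 hi, hi]
      simp
    · have : h (v - h v • u) = 0 := by rw [map_sub, map_smul, hu1]; simp
      cases s <;> simp [a', this]
  have hu0 : u ≠ 0 := by rintro rfl; simp at hu1
  obtain ⟨τ, hτ, hz, k, hk, hk'⟩ := exists_move hx.1 (u := u) (by
    by_contra! hcon
    exact hu0 (ha u hcon))
  have hτ0 : τ ≠ 0 := by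
    rintro rfl
    rw [zero_smul, add_zero] at hk'
    exact (huT k ((hT k).2 hk')).not_gt hk
  have hact : ∀ i ∈ T, a i u = 0 → a i (x + τ • u) + b i = 0 := fun i hi h0 => by
    rw [map_add, map_smul, h0, smul_zero, add_zero]; exact (hT i).1 hi
  refine ⟨x + τ • u, ⟨?_, hx, ⟨hz, fun v hv => ?_⟩, fun v hv => ?_⟩, ?_⟩
  · simp [hτ0, hu0]
  · have h1 := hker v fun i hi h0 => hv i (hact i hi h0)
    have h2 := hv k hk'
    rw [h1, map_smul, smul_eq_mul, mul_eq_zero, or_iff_left hk.ne] at h2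
    rw [h1, h2, zero_smul]
  · have h1 := hker v fun i hi h0 => hv i ((hT i).1 hi) (hact i hi h0)
    exact ⟨h v / τ, by rw [add_sub_cancel_left, smul_smul, div_mul_cancel₀ _ hτ0]; exact h1⟩
  · rw [map_add, map_smul, smul_eq_mul]
    have := mul_nonpos_of_nonneg_of_nonpos hτ hfu0
    linarith

/-- A source is the only minimum of an admissible functional. -/
theorem IsSource.exists_isMin [FiniteDimensional ℝ E] [Finite ι] (ha : NoRay a)
    (hP : P = (fun w : W => c + (w : E)) '' polyhedron a b) {f : E →ₗ[ℝ] ℝ}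
    (hf : IsAdmissible P f) {s : E} (hs : IsSource P f s) :
    ∃ x : W, s = c + x ∧ x ∈ polyhedron a b ∧ ∀ y ∈ polyhedron a b,
      f.domRestrict W y ≤ f.domRestrict W x → y = x := by
  have hsP : s ∈ P := hs.1.1
  rw [hP] at hsP
  obtain ⟨x, hx, rfl⟩ := hsP
  refine ⟨x, rfl, hx, fun y hy hle => ?_⟩
  by_contra hne
  obtain ⟨z, hz, hzx⟩ := exists_isBasicEdge_of_le ha (f.domRestrict W)
    (isBasic_of_mem_vertices ha hP hs.1) hy hne hle
  have hedge := hz.isEdge hP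
  refine hs.2 _ ⟨hedge.symm, lt_of_le_of_ne ?_ (hf.apply_ne hedge).symm⟩
  simpa using hzx

theorem IsAdmissible.neg {f : E →ₗ[ℝ] ℝ} (hf : IsAdmissible P f) : IsAdmissible P (-f) :=
  fun x y h ⟨r, hr⟩ => hf x y h ⟨-r, fun z hz => by rw [← hr z hz]; simp⟩

theorem IsSink.neg {f : E →ₗ[ℝ] ℝ} {t : E} (ht : IsSink P f t) : IsSource P (-f) t :=
  ⟨ht.1, fun x hx => ht.2 x ⟨hx.1.symm, by simpa using hx.2⟩⟩

theorem HasDirectedPath.cons {f : E →ₗ[ℝ] ℝ} {x y z : E} {k : ℕ} (h : IsArc P f x y)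
    (hyz : HasDirectedPath P f y z k) : HasDirectedPath P f x z (k + 1) := by
  obtain ⟨v, hv0, hvk, hv⟩ := hyz
  refine ⟨Fin.cons x v, rfl, ?_, fun i => ?_⟩
  · rw [← Fin.succ_last, Fin.cons_succ, hvk]
  · refine Fin.cases ?_ (fun i => ?_) i
    · simpa [hv0] using h
    · simpa [← Fin.succ_castSucc] using hv i

/-- Steps that stay in place can be left out of a walk. -/
theorem exists_hasDirectedPath {f : E →ₗ[ℝ] ℝ} {n : ℕ} {v : ℕ → E}
    (h : ∀ m < n, v m = v (m + 1) ∨ IsArc P f (v m) (v (m + 1))) :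
    ∃ k ≤ n, HasDirectedPath P f (v 0) (v n) k := by
  induction n generalizing v with
  | zero => exact ⟨0, le_rfl, fun _ => v 0, rfl, rfl, fun i => i.elim0⟩
  | succ n ih =>
    obtain ⟨k, hk, hp⟩ := ih (v := fun m => v (m + 1)) fun m hm => h (m + 1) (by omega)
    rcases h 0 (by omega) with h0 | h0
    · exact ⟨k, by omega, by rw [h0]; exact hp⟩
    · exact ⟨k + 1, by omega, hp.cons h0⟩

theorem directedDist_le {f : E →ₗ[ℝ] ℝ} {s t : E} {k n : ℕ} (hkn : k ≤ n)
    (h : HasDirectedPath P f s t k) : directedDist P f s t ≤ n :=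
  have hmem : (k : ℕ∞) ∈ {l : ℕ∞ | ∃ k : ℕ, l = (k : ℕ∞) ∧ HasDirectedPath P f s t k} := ⟨k, rfl, h⟩
  (sInf_le hmem).trans (by exact_mod_cast hkn)

theorem directedDist_le_four_of_polyhedron [FiniteDimensional ℝ E] [Fintype ι]
    (hcard : Fintype.card ι ≤ 8)
    (hW : finrank ℝ W = 4) (ha : NoRay a)
    (hP : P = (fun w : W => c + (w : E)) '' polyhedron a b) {f : E →ₗ[ℝ] ℝ}
    (hf : IsAdmissible P f) {s t : E} (hs : IsSource P f s) (ht : IsSink P f t) :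
    directedDist P f s t ≤ 4 := by
  classical
  obtain ⟨x, rfl, hx, hxmin⟩ := hs.exists_isMin ha hP hf
  obtain ⟨y, rfl, hy, hymax⟩ := ht.neg.exists_isMin ha hP hf.neg
  obtain ⟨n, hn, v, rfl, rfl, hv⟩ := exists_short_walk (f := f.domRestrict W) hcard hW ha hx hy
    hxmin
    fun z hz hle => hymax z hz (by simpa using hle)
  obtain ⟨k, hk, hp⟩ := exists_hasDirectedPath (P := P) (f := f) (n := n)
    (v := fun m => c + (v m : E)) fun m hm => by
      rcases hv m hm with h | ⟨h, hle⟩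
      · exact .inl (by rw [h])
      · have hedge := h.isEdge hP
        exact .inr ⟨hedge, lt_of_le_of_ne (by simpa using hle) (hf.apply_ne hedge)⟩
  exact directedDist_le (hk.trans hn) hp

end Representation
end PolytopePaths

/-! ### A polytope is cut out by its facets -/

namespace PolytopePaths

section PolarDual

open Module

universe u

variable {E : Type u} [NormedAddCommGroup E] [NormedSpace ℝ E]

/-- Evaluation at the points `v s`, as linear forms on the dual space. With constants `1` they
define the polar body of these points, up to sign. -/
noncomputable abbrev evalForms {W κ : Type*} [AddCommGroup W] [Module ℝ W] (v : κ → W) :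
    κ → Dual ℝ (Dual ℝ W) := fun s => Dual.eval ℝ W (v s)

theorem exists_center {S : Finset E} (hS : S.Nonempty) :
    ∃ c ∈ convexHull ℝ (S : Set E), ∑ s ∈ S, (s - c) = 0 := by
  have hcard : (S.card : ℝ) ≠ 0 := by exact_mod_cast hS.card_ne_zero
  refine ⟨∑ s ∈ S, (S.card : ℝ)⁻¹ • s, ?_, ?_⟩
  · refine (convex_convexHull ℝ _).sum_mem (fun _ _ => by positivity) ?_ fun s hs =>
      subset_convexHull ℝ _ hs
    rw [Finset.sum_const, nsmul_eq_mul, mul_inv_cancel₀ hcard]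
  · rw [Finset.sum_sub_distrib, Finset.sum_const, ← Finset.smul_sum, ← Nat.cast_smul_eq_nsmul ℝ,
      smul_smul, mul_inv_cancel₀ hcard, one_smul, sub_self]

variable {S : Finset E} {c : E}

/-- A linear form that vanishes on the points of `S`, as seen from `c`, vanishes on the direction
space. -/
theorem eq_zero_of_apply_eq_zero (hc : c ∈ convexHull ℝ (S : Set E))
    (g : Dual ℝ (vectorSpan ℝ (convexHull ℝ (S : Set E))))
    (hg : ∀ s (hs : s ∈ S), g ⟨s - c, vsub_mem_vectorSpan ℝ (subset_convexHull ℝ _ hs) hc⟩ = 0) :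
    g = 0 := by
  obtain ⟨l, hl⟩ := LinearMap.exists_extend g
  have hl' : ∀ w : vectorSpan ℝ (convexHull ℝ (S : Set E)), l (w : E) = g w :=
    fun w => LinearMap.congr_fun hl w
  have h1 : convexHull ℝ (S : Set E) ⊆ {x | l x = l c} := by
    refine convexHull_min (fun s hs => ?_) (convex_hyperplane l.isLinear _)
    have := hg s hs
    rw [← hl', map_sub] at this
    exact sub_eq_zero.1 this
  have h2 : vectorSpan ℝ (convexHull ℝ (S : Set E)) ≤ LinearMap.ker l := by
    rw [vectorSpan_def, Submodule.span_le]
    rintro _ ⟨x, hx, y, hy, rfl⟩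
    change l (x - y) = 0
    rw [map_sub, h1 hx, h1 hy, sub_self]
  ext w
  rw [← hl']
  exact h2 w.2

/-- The points of `S` as seen from the centre `c`, in the direction space. -/
def relVec (hc : c ∈ convexHull ℝ (S : Set E)) (s : S) : vectorSpan ℝ (convexHull ℝ (S : Set E)) :=
  ⟨s - c, vsub_mem_vectorSpan ℝ (subset_convexHull ℝ _ s.2) hc⟩

theorem sum_relVec (hc : c ∈ convexHull ℝ (S : Set E)) (h0 : ∑ s ∈ S, (s - c) = 0) :
    ∑ s, relVec hc s = 0 := by
  apply Subtype.ext
  rw [Submodule.coe_sum]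
  exact (Finset.sum_coe_sort S fun s => s - c).trans h0

/-- The polar body is bounded. -/
theorem noRay_evalForms (hc : c ∈ convexHull ℝ (S : Set E)) (h0 : ∑ s ∈ S, (s - c) = 0) :
    NoRay (evalForms (relVec hc)) := by
  intro g hg
  have h1 : ∑ s, g (relVec hc s) = 0 := by rw [← map_sum, sum_relVec hc h0, map_zero]
  have h2 := (Finset.sum_eq_zero_iff_of_nonneg fun s _ => hg s).1 h1
  exact eq_zero_of_apply_eq_zero hc g fun s hs => h2 ⟨s, hs⟩ (Finset.mem_univ _)

/-- The vertices of the polar body `{g | ∀ s ∈ S, 0 ≤ g (s - c) + 1}`. They correspond to the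
facets of the convex hull of `S`. -/
abbrev PolarVertex (hc : c ∈ convexHull ℝ (S : Set E)) : Type u :=
  {g : Dual ℝ (vectorSpan ℝ (convexHull ℝ (S : Set E))) // IsBasic (evalForms (relVec hc)) 1 g}

instance (hc : c ∈ convexHull ℝ (S : Set E)) : Finite (PolarVertex hc) :=
  finite_isBasic.to_subtype

/-- The vertices of the polar body, as a family of linear forms. -/
abbrev polarForm (hc : c ∈ convexHull ℝ (S : Set E)) (g : PolarVertex hc) :
    Dual ℝ (vectorSpan ℝ (convexHull ℝ (S : Set E))) := g.1

/-- The vertices of the polar body span it in the sense that no direction is nonnegative for all of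
them: every linear form is, up to a positive factor, in the polar body, and its value is bounded
below by that of a vertex. -/
theorem noRay_polarForm (hc : c ∈ convexHull ℝ (S : Set E)) (h0 : ∑ s ∈ S, (s - c) = 0) :
    NoRay (polarForm hc) := by
  intro u hu
  rw [← Module.forall_dual_apply_eq_zero_iff ℝ]
  intro φ
  have key : ∀ φ : Dual ℝ (vectorSpan ℝ (convexHull ℝ (S : Set E))), 0 ≤ φ u := by
    intro φ
    by_contra! hneg
    have hpos : (0 : ℝ) < 1 + ∑ s, |φ (relVec hc s)| := by positivity
    obtain ⟨q, hq, hle⟩ := exists_isBasic (b := 1) (noRay_evalForms hc h0) (Dual.eval ℝ _ u)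
      (x := (1 + ∑ s, |φ (relVec hc s)|)⁻¹ • φ) (fun s => by
        have h1 : |φ (relVec hc s)| ≤ ∑ s, |φ (relVec hc s)| :=
          Finset.single_le_sum (f := fun s => |φ (relVec hc s)|) (fun _ _ => abs_nonneg _)
            (Finset.mem_univ s)
        have h2 := neg_abs_le (φ (relVec hc s))
        have h3 : -1 ≤ (1 + ∑ s, |φ (relVec hc s)|)⁻¹ * φ (relVec hc s) := by
          rw [← div_eq_inv_mul, le_div_iff₀ hpos]
          linarith
        simp only [Dual.eval_apply, LinearMap.smul_apply, smul_eq_mul, Pi.one_apply]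
        linarith)
    have h4 := hu ⟨q, hq⟩
    simp only [Dual.eval_apply, LinearMap.smul_apply, smul_eq_mul] at hle
    have h5 := mul_neg_of_pos_of_neg (inv_pos.2 hpos) hneg
    have h6 : 0 ≤ q u := h4
    linarith
  have h1 := key φ
  have h2 := key (-φ)
  rw [LinearMap.neg_apply] at h2
  linarith

/-- The vertices of the polar body cut out the convex hull: a linear form that separates a point
from the hull can be replaced by a vertex of the polar body. -/
theorem convexHull_eq_polar (hc : c ∈ convexHull ℝ (S : Set E)) (h0 : ∑ s ∈ S, (s - c) = 0) :
    convexHull ℝ (S : Set E) = (fun w : vectorSpan ℝ (convexHull ℝ (S : Set E)) => c + (w : E)) ''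
      polyhedron (polarForm hc) 1 := by
  refine Set.Subset.antisymm (fun x hx => ?_) ?_
  · refine ⟨⟨x - c, vsub_mem_vectorSpan ℝ hx hc⟩, fun g => ?_, by simp⟩
    obtain ⟨l, hl⟩ := LinearMap.exists_extend g.1
    have hl' : ∀ w : vectorSpan ℝ (convexHull ℝ (S : Set E)), l (w : E) = g.1 w :=
      fun w => LinearMap.congr_fun hl w
    have h1 : convexHull ℝ (S : Set E) ⊆ {x | l c - 1 ≤ l x} := by
      refine convexHull_min (fun s hs => ?_) (convex_halfSpace_ge l.isLinear _)
      have h2 := g.2.1 ⟨s, hs⟩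
      simp only [Dual.eval_apply, Pi.one_apply] at h2
      rw [← hl'] at h2
      have h3 : l (s - c) = l s - l c := map_sub _ _ _
      change l c - 1 ≤ l s
      change 0 ≤ l (s - c) + 1 at h2
      linarith
    have h4 := h1 hx
    change 0 ≤ g.1 _ + 1
    rw [← hl', map_sub]
    have h4 : l c - 1 ≤ l x := h4
    linarith
  · rintro _ ⟨w, hw, rfl⟩
    by_contra hcon
    obtain ⟨l, r, h1, h2⟩ := geometric_hahn_banach_point_closed (convex_convexHull ℝ (S : Set E))
      (S.finite_toSet.isClosed_convexHull ℝ) hcon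
    rw [map_add] at h1
    -- the separating functional, restricted and normalised to lie in the polar body
    let g : Dual ℝ (vectorSpan ℝ (convexHull ℝ (S : Set E))) :=
      (l : E →ₗ[ℝ] ℝ).domRestrict _
    have hg : ∀ s, r - l c < g (relVec hc s) := fun s => by
      have h3 := h2 s (subset_convexHull ℝ _ s.2)
      change r - l c < l (s - c)
      rw [map_sub]; linarith
    have hneg : r - l c < 0 := by
      have h3 := h2 c hc
      linarith
    set μ := -(r - l c) with hμ
    have hμ0 : 0 < μ := by linarith
    obtain ⟨q, hq, hle⟩ := exists_isBasic (b := 1) (noRay_evalForms hc h0) (Dual.eval ℝ _ w)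
      (x := μ⁻¹ • g) (fun s => by
        have h3 : -1 ≤ μ⁻¹ * g (relVec hc s) := by
          rw [← div_eq_inv_mul, le_div_iff₀ hμ0]
          linarith [hg s]
        simp only [Dual.eval_apply, LinearMap.smul_apply, smul_eq_mul, Pi.one_apply]
        linarith)
    simp only [Dual.eval_apply, LinearMap.smul_apply, smul_eq_mul] at hle
    have h4 : 0 ≤ q w + 1 := hw ⟨q, hq⟩
    have h5 : μ⁻¹ * g w < -1 := by
      rw [← div_eq_inv_mul, div_lt_iff₀ hμ0]
      change l w < _
      linarith
    linarith

/-- The face of the convex hull where the inequality of the vertex `g` of the polar body is an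
equality. -/
def polarFacet (hc : c ∈ convexHull ℝ (S : Set E)) (g : PolarVertex hc) : Set E :=
  (fun w : vectorSpan ℝ (convexHull ℝ (S : Set E)) => c + (w : E)) ''
      {w | w ∈ polyhedron (polarForm hc) 1 ∧ g.1 w + 1 = 0}

theorem mem_polarFacet (hc : c ∈ convexHull ℝ (S : Set E)) (h0 : ∑ s ∈ S, (s - c) = 0)
    {g : PolarVertex hc} {s : S} : (s : E) ∈ polarFacet hc g ↔ g.1 (relVec hc s) + 1 = 0 := by
  have hs : (s : E) = c + (relVec hc s : E) := by simp [relVec]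
  constructor
  · rintro ⟨w, ⟨-, hw⟩, heq⟩
    have : w = relVec hc s := by
      rw [hs] at heq
      exact Subtype.ext (add_left_cancel heq)
    rwa [← this]
  · intro h
    refine ⟨relVec hc s, ⟨?_, h⟩, hs.symm⟩
    have h1 : (s : E) ∈ convexHull ℝ (S : Set E) := subset_convexHull ℝ _ s.2
    rw [convexHull_eq_polar hc h0] at h1
    obtain ⟨w, hw, heq⟩ := h1
    have : w = relVec hc s := by
      rw [hs] at heq
      exact Subtype.ext (add_left_cancel heq)
    rwa [← this]

theorem polarFacet_injective (hc : c ∈ convexHull ℝ (S : Set E)) (h0 : ∑ s ∈ S, (s - c) = 0) :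
    Function.Injective (polarFacet hc) := by
  intro g g' h
  apply Subtype.ext
  refine (g.2.eq_of_active fun s hs => ?_).symm
  have h1 : g.1 (relVec hc s) + 1 = 0 := hs
  rw [← mem_polarFacet hc h0, h, mem_polarFacet hc h0] at h1
  exact h1

theorem polarFacet_mem_facets [FiniteDimensional ℝ E] (hc : c ∈ convexHull ℝ (S : Set E))
    (h0 : ∑ s ∈ S, (s - c) = 0) {k : ℕ} (hdim : HasDim (convexHull ℝ (S : Set E)) (k + 1))
    (g : PolarVertex hc) : polarFacet hc g ∈ facets (convexHull ℝ (S : Set E)) := by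
  refine ⟨?_, k, ?_, hdim⟩
  · have := isExposed_active (convexHull_eq_polar hc h0) {g}
    simpa [polarFacet] using this
  -- the active points of `S` span the direction space
  have hspan : ∀ φ : Dual ℝ (vectorSpan ℝ (convexHull ℝ (S : Set E))),
      (∀ s : S, (s : E) ∈ polarFacet hc g → φ (relVec hc s) = 0) → φ = 0 := fun φ hφ =>
    g.2.2 φ fun s hs => hφ s ((mem_polarFacet hc h0).2 hs)
  obtain ⟨s0, hs0⟩ : ∃ s : S, (s : E) ∈ polarFacet hc g := by
    by_contra! hcon
    have h1 : ∀ φ : Dual ℝ (vectorSpan ℝ (convexHull ℝ (S : Set E))), φ = 0 := fun φ =>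
      hspan φ fun s hs => absurd hs (hcon s)
    have h2 : finrank ℝ (Dual ℝ (vectorSpan ℝ (convexHull ℝ (S : Set E)))) = 0 := by
      have : Subsingleton (Dual ℝ (vectorSpan ℝ (convexHull ℝ (S : Set E)))) :=
        ⟨fun φ ψ => by rw [h1 φ, h1 ψ]⟩
      exact finrank_zero_of_subsingleton
    rw [Subspace.dual_finrank_eq, hdim.2] at h2
    omega
  refine ⟨⟨_, hs0⟩, ?_⟩
  set F := polarFacet hc g with hF
  apply le_antisymm
  · have hle : vectorSpan ℝ F ≤ (LinearMap.ker g.1).map (Submodule.subtype _) := by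
      rw [vectorSpan_def, Submodule.span_le]
      rintro _ ⟨_, ⟨w, ⟨-, hw⟩, rfl⟩, _, ⟨w', ⟨-, hw'⟩, rfl⟩, rfl⟩
      refine ⟨w - w', ?_, by simp⟩
      change g.1 (w - w') = 0
      rw [map_sub]; linarith
    have hg0 : g.1 ≠ 0 := by
      intro h
      have := (mem_polarFacet hc h0).1 hs0
      rw [h] at this
      simp at this
    have h1 := (Submodule.finrank_mono hle).trans (Submodule.finrank_map_le _ _)
    have h2 := Module.Dual.finrank_ker_add_one_of_ne_zero hg0
    rw [hdim.2] at h2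
    omega
  · have hle : vectorSpan ℝ (convexHull ℝ (S : Set E)) ≤
        vectorSpan ℝ F ⊔ Submodule.span ℝ {(s0 : E) - c} := by
      intro x hx
      by_contra hcon
      obtain ⟨φ, hφ, hφ0⟩ := Submodule.exists_le_ker_of_notMem hcon
      have h1 : φ.domRestrict (vectorSpan ℝ (convexHull ℝ (S : Set E))) = 0 := by
        refine hspan _ fun s hs => ?_
        change φ (s - c) = 0
        have h2 : φ (s - s0) = 0 := hφ0 (Submodule.mem_sup_left (vsub_mem_vectorSpan ℝ hs hs0))
        have h3 : φ (s0 - c) = 0 := hφ0 (Submodule.mem_sup_right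
          (Submodule.mem_span_singleton_self _))
        rw [map_sub] at h2 h3 ⊢
        linarith
      exact hφ (LinearMap.congr_fun h1 ⟨x, hx⟩)
    have h1 := Submodule.finrank_mono hle
    have h2 := Submodule.finrank_add_le_finrank_add_finrank (vectorSpan ℝ F)
      (Submodule.span ℝ {(s0 : E) - c})
    have h3 : finrank ℝ (Submodule.span ℝ {(s0 : E) - c}) ≤ 1 := by
      simpa using finrank_span_le_card (R := ℝ) {(s0 : E) - c}
    rw [hdim.2] at h1
    omega

/-- A polytope with at most `n` facets is cut out by `n` inequalities. -/
theorem exists_polyhedron_of_facets [FiniteDimensional ℝ E] {P : Set E} {k n : ℕ}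
    (hP : IsPolytope P)
    (hdim : HasDim P (k + 1)) (hn : (facets P).encard ≤ n) :
    ∃ (c : E) (ι : Type u) (_ : Fintype ι) (a : ι → Dual ℝ (vectorSpan ℝ P)),
      Fintype.card ι ≤ n ∧ NoRay a ∧
      P = (fun w : vectorSpan ℝ P => c + (w : E)) '' polyhedron a 1 := by
  obtain ⟨S, hS, rfl⟩ := hP
  obtain ⟨c, hc, h0⟩ := exists_center hS
  have := Fintype.ofFinite (PolarVertex hc)
  refine ⟨c, PolarVertex hc, this, polarForm hc, ?_, noRay_polarForm hc h0,
    convexHull_eq_polar hc h0⟩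
  have h1 : (Set.range (polarFacet hc)).encard ≤ n :=
    (Set.encard_le_encard (Set.range_subset_iff.2 (polarFacet_mem_facets hc h0 hdim))).trans hn
  rw [← Set.image_univ, (polarFacet_injective hc h0).encard_image, Set.encard_univ] at h1
  simpa using h1

theorem directedDist_le_four [FiniteDimensional ℝ E] {P : Set E} (hP : IsPolytope P)
    (hdim : HasDim P 4) (hn : (facets P).encard = 8) {f : E →ₗ[ℝ] ℝ} (hf : IsAdmissible P f)
    {s t : E} (hs : IsSource P f s) (ht : IsSink P f t) : directedDist P f s t ≤ 4 := by
  obtain ⟨c, ι, _, a, hcard, ha, hrep⟩ := exists_polyhedron_of_facets (n := 8) hP hdim hn.le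
  exact directedDist_le_four_of_polyhedron hcard hdim.2 ha hrep hf hs ht

end PolarDual
end PolytopePaths

/-! ### The four-dimensional cube -/

namespace PolytopePaths

section Cube

open Module

/-- The cube `[0, 1]⁴`. -/
def cube : Set (Fin 4 → ℝ) := Set.pi Set.univ fun _ => Set.Icc 0 1

/-- The sum of the coordinates. -/
noncomputable def coordSum : (Fin 4 → ℝ) →ₗ[ℝ] ℝ := ∑ i, LinearMap.proj i

theorem coordSum_apply (x : Fin 4 → ℝ) : coordSum x = ∑ i, x i := by simp [coordSum]

theorem mem_cube {x : Fin 4 → ℝ} : x ∈ cube ↔ ∀ i, 0 ≤ x i ∧ x i ≤ 1 := by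
  simp only [cube, Set.mem_pi, Set.mem_univ, forall_const, Set.mem_Icc]

theorem isPolytope_cube : IsPolytope cube := by
  have hfin : (Set.pi Set.univ fun _ : Fin 4 => ({0, 1} : Set ℝ)).Finite :=
    Set.Finite.pi fun _ => Set.toFinite _
  refine ⟨hfin.toFinset, ⟨0, by simp [Set.mem_pi]⟩, ?_⟩
  rw [Set.Finite.coe_toFinset, convexHull_pi, cube]
  congr 1
  ext i : 1
  rw [convexHull_pair, segment_eq_Icc zero_le_one]

theorem zero_mem_cube : (0 : Fin 4 → ℝ) ∈ cube := mem_cube.2 fun i => by simp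

theorem one_mem_cube : (1 : Fin 4 → ℝ) ∈ cube := mem_cube.2 fun i => by simp

theorem update_mem_cube {x : Fin 4 → ℝ} (hx : x ∈ cube) (i : Fin 4) {r : ℝ} (h0 : 0 ≤ r)
    (h1 : r ≤ 1) : Function.update x i r ∈ cube := by
  rw [mem_cube] at hx ⊢
  intro k
  by_cases h : k = i
  · subst h; simpa using ⟨h0, h1⟩
  · simpa [h] using hx k

theorem update_sub_update (x : Fin 4 → ℝ) (i : Fin 4) :
    Function.update x i 1 - Function.update x i 0 = Pi.single i 1 := by
  ext k
  by_cases h : k = i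
  · subst h; simp
  · simp [h]

theorem hasDim_cube : HasDim cube 4 := by
  refine ⟨⟨0, zero_mem_cube⟩, ?_⟩
  have : vectorSpan ℝ cube = ⊤ := by
    rw [eq_top_iff, ← (Pi.basisFun ℝ (Fin 4)).span_eq, Submodule.span_le]
    rintro _ ⟨i, rfl⟩
    rw [Pi.basisFun_apply, ← update_sub_update 0 i]
    exact vsub_mem_vectorSpan ℝ (update_mem_cube zero_mem_cube i zero_le_one le_rfl)
      (update_mem_cube zero_mem_cube i le_rfl zero_le_one)
  rw [this, finrank_top]
  simp

/-- The facet of the cube where a given coordinate is `0` or `1`. -/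
def cubeFacet (x : Fin 4 × Bool) : Set (Fin 4 → ℝ) :=
  {y | y ∈ cube ∧ y x.1 = if x.2 then 1 else 0}

theorem cubeFacet_injective : Function.Injective cubeFacet := by
  rintro ⟨i, s⟩ ⟨k, r⟩ h
  have hik : i = k := by
    by_contra hne
    have h1 : Function.update (fun _ => if s then 1 else 0) k (if r then 0 else 1) ∈
        cubeFacet (i, s) := by
      refine ⟨update_mem_cube (mem_cube.2 fun _ => ?_) k ?_ ?_, ?_⟩
      · cases s <;> simp
      · cases r <;> simp
      · cases r <;> simp
      · simp [hne]
    rw [h] at h1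
    have h2 := h1.2
    cases r <;> simp at h2
  subst hik
  have h1 : (fun _ => if s then 1 else 0) ∈ cubeFacet (i, s) :=
    ⟨mem_cube.2 fun _ => by cases s <;> simp, rfl⟩
  rw [h] at h1
  have h2 := h1.2
  cases s <;> cases r <;> simp at h2 ⊢

theorem finrank_ker_proj (i : Fin 4) :
    finrank ℝ (LinearMap.ker (LinearMap.proj i : (Fin 4 → ℝ) →ₗ[ℝ] ℝ)) = 3 := by
  have h : (LinearMap.proj i : Dual ℝ (Fin 4 → ℝ)) ≠ 0 := fun h => by
    have := LinearMap.congr_fun h (Pi.single i 1)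
    simp at this
  have := Module.Dual.finrank_ker_add_one_of_ne_zero h
  simp only [finrank_fintype_fun_eq_card, Fintype.card_fin] at this
  omega

theorem hasDim_cubeFacet (x : Fin 4 × Bool) : HasDim (cubeFacet x) 3 := by
  obtain ⟨i, s⟩ := x
  have hmem : (fun _ => if s then 1 else 0) ∈ cubeFacet (i, s) :=
    ⟨mem_cube.2 fun _ => by cases s <;> simp, rfl⟩
  refine ⟨⟨_, hmem⟩, ?_⟩
  rw [show vectorSpan ℝ (cubeFacet (i, s)) = LinearMap.ker (LinearMap.proj i) from
    le_antisymm ?_ ?_, finrank_ker_proj]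
  · rw [vectorSpan_def, Submodule.span_le]
    rintro _ ⟨y, hy, z, hz, rfl⟩
    change y i - z i = 0
    rw [hy.2, hz.2, sub_self]
  · intro x hx
    rw [pi_eq_sum_univ' x]
    refine Submodule.sum_mem _ fun k _ => ?_
    by_cases hki : k = i
    · subst hki
      rw [show x k = 0 from hx, zero_smul]
      exact zero_mem _
    · refine Submodule.smul_mem _ _ ?_
      rw [← update_sub_update (fun _ => if s then 1 else 0) k]
      exact vsub_mem_vectorSpan ℝ
        ⟨update_mem_cube hmem.1 k zero_le_one le_rfl, by simp [Ne.symm hki]⟩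
        ⟨update_mem_cube hmem.1 k le_rfl zero_le_one, by simp [Ne.symm hki]⟩

theorem isExposed_cubeFacet (x : Fin 4 × Bool) : IsExposed ℝ cube (cubeFacet x) := by
  obtain ⟨i, s⟩ := x
  intro _
  refine ⟨(if s then 1 else -1 : ℝ) • ContinuousLinearMap.proj i, ?_⟩
  ext y
  simp only [cubeFacet, Set.mem_ofPred_eq, and_congr_right_iff]
  intro hy
  constructor
  · intro h z hz
    have := mem_cube.1 hz i
    cases s
    · simp at h ⊢; linarith
    · simp at h ⊢; linarith
  · intro h
    have h1 := mem_cube.1 hy i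
    cases s
    · have := h 0 zero_mem_cube
      simp at this ⊢; linarith
    · have := h 1 one_mem_cube
      simp at this ⊢; linarith

theorem facets_cube : facets cube = Set.range cubeFacet := by
  apply Set.Subset.antisymm
  · rintro F ⟨hexp, k, hF, hk⟩
    obtain rfl : k = 3 := by
      have := hk.2.symm.trans hasDim_cube.2; omega
    obtain ⟨l, hl⟩ := hexp hF.1
    have hmem : ∀ y, y ∈ F ↔ y ∈ cube ∧ ∀ z ∈ cube, l z ≤ l y := fun y => by rw [hl]; rfl
    have hsum : ∀ y, l y = ∑ i, y i * l (Pi.single i 1) := fun y => by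
      conv_lhs => rw [pi_eq_sum_univ' y]
      rw [map_sum]
      refine Finset.sum_congr rfl fun k _ => ?_
      rw [map_smul, smul_eq_mul]
    -- a nonzero coefficient of `l` pins the coordinate on the face
    have hpin : ∀ i, l (Pi.single i 1) ≠ 0 → ∀ y ∈ F,
        y i = if decide (0 < l (Pi.single i 1)) = true then 1 else 0 := by
      intro i hi y hy
      rw [hmem] at hy
      have hupd : ∀ r, l (Function.update y i r) = l y + (r - y i) * l (Pi.single i 1) :=
          fun r => by
        have : Function.update y i r = y + (r - y i) • Pi.single i 1 := by
          ext k
          by_cases h : k = i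
          · subst h; simp
          · simp [h]
        rw [this, map_add, map_smul, smul_eq_mul]
      have h0 := hy.2 _ (update_mem_cube hy.1 i le_rfl zero_le_one)
      have h1 := hy.2 _ (update_mem_cube hy.1 i zero_le_one le_rfl)
      rw [hupd] at h0 h1
      have hyi := mem_cube.1 hy.1 i
      rcases lt_or_gt_of_ne hi with hneg | hpos
      · rw [if_neg (by simpa using hneg.le)]
        by_contra hne
        have : 0 < y i := lt_of_le_of_ne hyi.1 (Ne.symm hne)
        nlinarith
      · rw [if_pos (by simpa using hpos)]
        by_contra hne
        have : y i < 1 := lt_of_le_of_ne hyi.2 hne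
        nlinarith
    have hspan : ∀ i, l (Pi.single i 1) ≠ 0 →
        vectorSpan ℝ F ≤ LinearMap.ker (LinearMap.proj i) := by
      intro i hi
      rw [vectorSpan_def, Submodule.span_le]
      rintro _ ⟨y, hy, z, hz, rfl⟩
      change y i - z i = 0
      rw [hpin i hi y hy, hpin i hi z hz, sub_self]
    obtain ⟨i, hi⟩ : ∃ i, l (Pi.single i 1) ≠ 0 := by
      by_contra! hcon
      have : F = cube := by
        have h0 : ∀ y, l y = 0 := fun y => by
          rw [hsum]
          exact Finset.sum_eq_zero fun k _ => by rw [hcon, mul_zero]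
        ext y
        rw [hmem]
        simp [h0]
      rw [this] at hF
      have := hF.2.symm.trans hasDim_cube.2
      omega
    have honly : ∀ k, k ≠ i → l (Pi.single k 1) = 0 := by
      intro k hki
      by_contra hk
      have hlt : LinearMap.ker (LinearMap.proj i : (Fin 4 → ℝ) →ₗ[ℝ] ℝ) ⊓
          LinearMap.ker (LinearMap.proj k) < LinearMap.ker (LinearMap.proj i) := by
        refine lt_of_le_of_ne inf_le_left fun heq => ?_
        have h1 : (Pi.single k 1 : Fin 4 → ℝ) ∈
            LinearMap.ker (LinearMap.proj i : (Fin 4 → ℝ) →ₗ[ℝ] ℝ) := by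
          change (Pi.single k (1 : ℝ) : Fin 4 → ℝ) i = 0
          exact Pi.single_eq_of_ne (Ne.symm hki) 1
        rw [← heq] at h1
        have h2 : (Pi.single k (1 : ℝ) : Fin 4 → ℝ) k = 0 := h1.2
        rw [Pi.single_eq_same] at h2
        exact one_ne_zero h2
      have h1 := Submodule.finrank_lt_finrank_of_lt hlt
      have h2 := Submodule.finrank_mono (le_inf (hspan i hi) (hspan k hk))
      rw [finrank_ker_proj] at h1
      rw [hF.2] at h2
      omega
    obtain ⟨y0, hy0⟩ := hF.1
    refine ⟨(i, decide (0 < l (Pi.single i 1))), ?_⟩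
    ext y
    constructor
    · rintro ⟨hy, hyi⟩
      rw [hmem] at hy0 ⊢
      refine ⟨hy, fun z hz => (hy0.2 z hz).trans (le_of_eq ?_)⟩
      rw [hsum, hsum, Finset.sum_eq_single_of_mem i (Finset.mem_univ i),
        Finset.sum_eq_single_of_mem i (Finset.mem_univ i), hyi, hpin i hi y0 ((hmem y0).2 hy0)]
      · intro k _ hk; rw [honly k hk, mul_zero]
      · intro k _ hk; rw [honly k hk, mul_zero]
    · intro hy
      exact ⟨((hmem y).1 hy).1, hpin i hi y hy⟩
  · rintro _ ⟨x, rfl⟩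
    exact ⟨isExposed_cubeFacet x, 3, hasDim_cubeFacet x, hasDim_cube⟩

theorem encard_facets_cube : (facets cube).encard = 8 := by
  rw [facets_cube, ← Set.image_univ, cubeFacet_injective.encard_image, Set.encard_univ]
  simp

/-- The ends of an edge of the cube differ in one coordinate only. -/
theorem IsEdge.eq_of_ne {x y : Fin 4 → ℝ} (h : IsEdge cube x y) {i k : Fin 4} (hi : x i ≠ y i)
    (hk : x k ≠ y k) : i = k := by
  obtain ⟨hne, hx, hy, hexp⟩ := h
  by_contra hik
  obtain ⟨l, hl⟩ := hexp ⟨x, left_mem_segment ℝ x y⟩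
  have hxs : x ∈ segment ℝ x y := left_mem_segment ℝ x y
  have hys : y ∈ segment ℝ x y := right_mem_segment ℝ x y
  rw [hl] at hxs hys
  have hx' := mem_cube.1 hx.1 i
  have hy' := mem_cube.1 hy.1 i
  -- exchanging the `i`-th coordinates of `x` and `y` stays in the face
  have hz := update_mem_cube hx.1 i hy'.1 hy'.2
  have hz' := update_mem_cube hy.1 i hx'.1 hx'.2
  have hsum : Function.update x i (y i) + Function.update y i (x i) = x + y := by
    ext m
    by_cases h : m = i
    · subst h; simp [add_comm]
    · simp [h]
  have hlsum := congrArg l hsum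
  rw [map_add, map_add] at hlsum
  have h1 := hys.2 _ hz'
  have h2 := hxs.2 _ hz
  have hzs : Function.update x i (y i) ∈ segment ℝ x y := by
    rw [hl]
    exact ⟨hz, fun w hw => by linarith [hxs.2 w hw]⟩
  rw [segment_eq_image'] at hzs
  obtain ⟨θ, -, hθ⟩ := hzs
  have e1 := congrFun hθ i
  have e2 := congrFun hθ k
  simp only [Pi.add_apply, Pi.smul_apply, Pi.sub_apply, smul_eq_mul, Function.update_self,
    Function.update_of_ne (Ne.symm hik)] at e1 e2
  have h3 : θ = 0 := by
    have : θ * (y k - x k) = 0 := by linarith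
    exact (mul_eq_zero.1 this).resolve_right (sub_ne_zero.2 hk.symm)
  rw [h3] at e1
  exact hi (by linarith)

theorem isAdmissible_cube : IsAdmissible cube coordSum := by
  rintro x y h ⟨r, hr⟩
  have h1 := (hr x (left_mem_segment ℝ x y)).trans (hr y (right_mem_segment ℝ x y)).symm
  obtain ⟨i, hi⟩ := Function.ne_iff.1 h.1
  have h2 : ∑ k ∈ Finset.univ.erase i, x k = ∑ k ∈ Finset.univ.erase i, y k :=
    Finset.sum_congr rfl fun k hk => by
      by_contra hne
      exact (Finset.ne_of_mem_erase hk) (h.eq_of_ne hi hne).symm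
  rw [coordSum_apply, coordSum_apply, ← Finset.add_sum_erase _ x (Finset.mem_univ i),
    ← Finset.add_sum_erase _ y (Finset.mem_univ i), h2] at h1
  exact hi (add_right_cancel h1)

theorem coordSum_nonneg {x : Fin 4 → ℝ} (hx : x ∈ cube) : 0 ≤ coordSum x := by
  rw [coordSum_apply]
  exact Finset.sum_nonneg fun i _ => (mem_cube.1 hx i).1

theorem isSource_cube : IsSource cube coordSum 0 := by
  refine ⟨⟨zero_mem_cube, -∑ i, ContinuousLinearMap.proj i, fun y hy => ?_⟩, fun x hx => ?_⟩
  · have h := fun i => (mem_cube.1 hy i).1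
    have h0 := Finset.sum_nonneg fun i (_ : i ∈ Finset.univ) => h i
    refine ⟨by simpa using h0, fun h1 => ?_⟩
    simp only [map_zero, neg_apply, sum_apply,
      ContinuousLinearMap.proj_apply] at h1
    ext i
    exact (Finset.sum_eq_zero_iff_of_nonneg fun i _ => h i).1 (by linarith) i (Finset.mem_univ i)
  · have := hx.2
    rw [map_zero] at this
    exact this.not_ge (coordSum_nonneg hx.1.2.1.1)

theorem isSink_cube : IsSink cube coordSum 1 := by
  refine ⟨⟨one_mem_cube, ∑ i, ContinuousLinearMap.proj i, fun y hy => ?_⟩, fun x hx => ?_⟩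
  · have h := fun i => (mem_cube.1 hy i).2
    have h0 := Finset.sum_le_sum fun i (_ : i ∈ Finset.univ) => h i
    refine ⟨by simpa using h0, fun h1 => ?_⟩
    simp only [sum_apply, ContinuousLinearMap.proj_apply, Pi.one_apply] at h1
    ext i
    exact (Finset.sum_eq_sum_iff_of_le fun i _ => h i).1 (le_antisymm h0 h1) i (Finset.mem_univ i)
  · have := hx.2
    rw [coordSum_apply, coordSum_apply] at this
    exact this.not_ge (Finset.sum_le_sum fun i _ => (mem_cube.1 hx.1.2.2.1.1 i).2)

/-- A directed path along edges of the cube changes one coordinate at a time. -/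
theorem four_le_of_hasDirectedPath {k : ℕ} (h : HasDirectedPath cube coordSum 0 1 k) : 4 ≤ k := by
  obtain ⟨v, hv0, hvk, hv⟩ := h
  -- after `m` arcs at most `m` coordinates are different from zero
  have key : ∀ m : ℕ, ∀ hm : m < k + 1,
      (Finset.univ.filter fun i => v ⟨m, hm⟩ i ≠ 0).card ≤ m := by
    intro m
    induction m with
    | zero =>
      intro hm
      have : v ⟨0, hm⟩ = 0 := hv0
      rw [this]
      simp
    | succ m ih =>
      intro hm
      have harc := hv ⟨m, by omega⟩
      obtain ⟨i, hi⟩ := Function.ne_iff.1 harc.1.1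
      have hsub : (Finset.univ.filter fun i => v ⟨m + 1, hm⟩ i ≠ 0) ⊆
          insert i (Finset.univ.filter fun i => v ⟨m, by omega⟩ i ≠ 0) := by
        intro k hk
        rw [Finset.mem_insert, or_iff_not_imp_left]
        intro hki
        have : v ⟨m, by omega⟩ k = v ⟨m + 1, hm⟩ k := by
          by_contra hne
          exact hki (harc.1.eq_of_ne hi hne).symm
        simpa [this] using hk
      exact (Finset.card_le_card hsub).trans ((Finset.card_insert_le _ _).trans
        (Nat.succ_le_succ (ih (by omega))))
  have := key k (by omega)
  have h1 : v ⟨k, by omega⟩ = 1 := hvk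
  simpa [h1] using this

theorem directedDist_cube : directedDist cube coordSum 0 1 = 4 := by
  refine le_antisymm (directedDist_le_four isPolytope_cube hasDim_cube encard_facets_cube
    isAdmissible_cube isSource_cube isSink_cube) (le_sInf ?_)
  rintro _ ⟨k, rfl, hk⟩
  exact_mod_cast four_le_of_hasDirectedPath hk

end Cube

theorem isGreatest_sourceSinkDistances : IsGreatest (sourceSinkDistances 4 8) 4 := by
  refine ⟨⟨4, cube, coordSum, 0, 1, isPolytope_cube, hasDim_cube, encard_facets_cube,
    isAdmissible_cube, isSource_cube, isSink_cube, directedDist_cube.symm⟩, ?_⟩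
  rintro _ ⟨N, P, f, s, t, hP, hdim, hn, hf, hs, ht, rfl⟩
  exact directedDist_le_four hP hdim hn hf hs ht

end PolytopePaths

theorem mainTheorem5 :
    IsGreatest (PolytopePaths.sourceSinkDistances 4 8) (PolytopePaths.deltaSM 4 8) ∧
      PolytopePaths.deltaSM 4 8 = 4 := by
  have h := PolytopePaths.isGreatest_sourceSinkDistances
  have h4 : PolytopePaths.deltaSM 4 8 = 4 := h.isLUB.sSup_eq
  exact ⟨h4.symm ▸ h, h4⟩
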